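/- **Setting.** Let $F\in\mathbb C[x]$ have degree $n\ge 2$ and leading coefficient $a_n$ with $\frac14<|a_n|\le 1$. Roots are listed with multiplicity. $\Delta(m,r)$ is the open disk with center $m$ and radius $r$, and $t\Delta(m,r)=\Delta(m,tr)$. Squares are closed, axis-aligned and of width $w(B)=2^\ell$, $\ell\in\mathbb Z$; $2B$ is the closed square with the same center and twice the width; $\Delta_B$ is the disk with the center of $B$ and radius $\frac34w(B)$. Let $\mathcal B$ be a square such that all roots of $F$ in $2\mathcal B$ are simple. For a region $R$, $\mathcal Z(R)$ is the collection of roots in $R$, and $\sigma_F(R)$ is the least distance between a root in $R$ and another root of $F$ ($+\infty$ if $R$ contains no root). A disk isolates a root $z$ if it contains $z$ and no other root. For a finite set $C$ of squares (also viewed as their union), $B_C$ is the smallest axis-aligned square containing $C$ with the same left and the same upper border as $C$; $w(C)$ and $m_C$ are the width and center of $B_C$; $r(C)=w(C)/2$, $\Delta_C=\Delta(m_C,\frac34w(C))$, and $C^+=\bigcup_{B\in C}2B$. If all squares of $C$ have the same width, it is denoted $2^{\ell_C}$; $s_C$ is the number of squares. All logarithms are binary. An $L$-bit approximation of a number is a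 dyadic (Gaussian) number with denominator $2^{L+1}$ and error less than $2^{-L}$; any such approximations may be supplied. **Tests.** *Soft comparison of $E_\ell,E_r\ge 0$*: for $L=1,2,4,\dots$ take $L$-bit approximations $\tilde E_\ell,\tilde E_r$ and put $E^\pm_\bullet=\max(0,\tilde E_\bullet\pm2^{-L})$; return True if $E_\ell^->E_r^+$, False if $E_\ell^+<E_r^-$, Undecided if $\frac23E_\ell^+\le E_r^-<E_r^+\le\frac32E_\ell^-$; otherwise continue. *Test $\mathbf T_*(\Delta)$, $\Delta=\Delta(m,r)$*: apply $\lceil\log(1+\log n)\rceil+5$ Graeffe iterations $G_e(x^2)+xG_o(x^2)\mapsto(-1)^n[G_e(x)^2-xG_o(x)^2]$ to $F(m+rx)$, giving $\sum_{i\le n} f_ix^i$. For each $k=0,\dots,n$ and $L=1,2,4,\dots$, with $\varepsilon=2^{-L-\lceil\log(n+1)\rceil}$, take $(L+\lceil\log(n+1)\rceil)$-bit approximations $\tilde f_i$ and put $f_i^-=\max(0,|\tilde f_i|-\varepsilon)$, $f_i^+=|\tilde f_i|+\varepsilon$; the $k$-th test succeeds if $f_k^->\sum_{i\ne k}f_i^+$,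 fails if $\sum_{i\ne k}f_i^->f_k^+$ or if both $\sum_{i\neq k}f_i^-\ge\frac23f_k^+$ and $\frac32f_k^-\ge\sum_{i\ne k}f_i^+$, and otherwise goes on to the next $L$. $\mathbf T_*(\Delta)$ returns a $k$ whose test succeeds, and $-1$ if there is none. **Algorithm $\mathbb C$Isolate.** *Bisection* of $C$: divide each square into four, discard the sub-squares $B$ with $\mathbf T_*(\Delta_B)=0$, and group the others into maximal connected components. *NewtonTest* for $(C,N,k,x)$: if the soft comparison of $E_\ell=4r(C)|F'(x)|$ with $E_r=|F(x)|$ returns False, fail. Otherwise, from $L$-bit approximations of $F(x)$ and $F'(x)$, $L=1,2,4,\dots$, derive a $(6-\ell_C+\log N)$-bit approximation $y$ of $x-k\frac{F(x)}{F'(x)}$. Let $\Delta'=\Delta(y,\frac18\cdot\frac{2^{\ell_C}}N)$; fail if $\Delta'\cap C=\emptyset$ or $\mathbf T_*(\Delta')\ne k$; otherwise succeed with $C'$ the set of those sub-squares of width $2^{\ell_C-1}/N$ of squares of $C$ (each divided into $4N^2$) that meet $\Delta'$. Start with the empty list $\mathcal O$ and $\mathcal C=\{(\mathcal B,4)\}$.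 *Preprocessing*: repeatedly replace the unique pair $(C,N_C)\in\mathcal C$ by the pairs $(C',4)$, $C'$ a component returned by Bisection of $C$, until the components no longer cover $\mathcal B$. *Main loop*: while $\mathcal C\neq\emptyset$, remove an arbitrary pair $(C,N_C)$. If $4\Delta_C$ meets no other component and $\mathbf T_*(2\Delta_C)=\mathbf T_*(4\Delta_C)=k$ for some $k\ge1$, then: if $k=1$, add $2\Delta_C$ to $\mathcal O$ and go on with the next pair; if $k>1$, choose any $x_C\in\mathcal B\setminus C$ with distance $2^{\ell_C-1}$ from $C$ and at least $2^{\ell_C-1}$ from the boundary of $\mathcal B$, and if NewtonTest for $(C,N_C,k,x_C)$ succeeds with $C'$, add $(C',N_C^2)$ to $\mathcal C$ and go on with the next pair. In all other cases add the pairs $(C',\max(4,\sqrt{N_C}))$ for the components $C'$ returned by Bisection of $C$. Return $\mathcal O$. **Theorem.** For all choices of approximations, of pairs and of points $x_C$, the algorithm $\mathbb C$Isolate terminates (all inner loops stop, and a point $x_C$ exists whenever one is needed) and returns a list $\mathcal O$ of pairwise disjoint disks such that for each $\Delta\in\mathcal O$ both $\Delta$ and $2\Delta$ isolate a root of $F$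 contained in $2\mathcal B$, and every root of $F$ in $\mathcal B$ is isolated by some disk of $\mathcal O$. Moreover, at every stage of the algorithm (at the beginning of each round of the two outer loops, and at the end): * (a) For each $(C,N_C)\in\mathcal C$, $C$ is non-empty and connected and consists of non-overlapping squares in $\mathcal B$ of the same width $2^{\ell_C}$, $\ell_C\in\mathbb Z$, aligned to the grid of mesh $2^{\ell_C}$ through the corners of $\mathcal B$. * (b) For distinct pairs $(C_1,N_{C_1}),(C_2,N_{C_2})\in\mathcal C$, the distance between $C_1$ and $C_2$ in the max-norm (hence also the Euclidean distance) is at least $\max(2^{\ell_{C_1}},2^{\ell_{C_2}})$; in particular, $C_1^+$ and $C_2^+$ have disjoint interiors. * (c) Every root of $F$ in $\mathcal B$ lies in a component $C$ with $(C,N_C)\in\mathcal C$ or is isolated by a disk already in $\mathcal O$. * (d) For each square $B\ne\mathcal B$ of a component in $\mathcal C$, $2B$ contains a root of $F$. * (e) $s_C\le 9\,|\mathcal Z(C^+)|$ for each $(C,N_C)\in\mathcal C$, and $\sum_{(C,N_C)\in\mathcal C}s_C\le 9\,|\mathcal Z(2\mathcal B)|$; here the initial component $C=\mathcal B$, respectively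 the initial stage, is excepted if $2\mathcal B$ contains no root. * (f) For each $(C,N_C)\in\mathcal C$, let $\operatorname{anc}^*(C)$ be the nearest ancestor of $C$ (the component from which $C$ resulted, the one from which that resulted, and so on) for which NewtonTest was successful, and $\mathcal B$ if there is none. Then $w(C)\le\frac{2w(\operatorname{anc}^*(C))}{\sqrt{N_C}}\le\frac{2w(\mathcal B)}{\sqrt{N_C}}$. * (g) With $\sigma:=\min(\sigma_F(2\mathcal B),\,2^8w(\mathcal B))$, for each $(C,N_C)\in\mathcal C$: $\displaystyle\frac{\sigma^2}{2^{17}n^2w(\mathcal B)}\le2^{\ell_C}\le w(\mathcal B)$ and $\displaystyle4\le N_C\le\Big(\frac{2^9w(\mathcal B)}{\sigma}\Big)^2$. -/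

import Mathlib

open Polynomial
open scoped ENNReal

noncomputable section

namespace CIsolate

/-! ### Disks, squares and components -/

/-- The open disk `Δ(m, r)`. -/
structure Disk where
  center : ℂ
  radius : ℝ

namespace Disk

/-- The set of points of the (open) disk. -/
def toSet (D : Disk) : Set ℂ := Metric.ball D.center D.radius

/-- The scaled disk `t · Δ`. -/
def scale (t : ℝ) (D : Disk) : Disk := ⟨D.center, t * D.radius⟩

end Disk

/-- A closed axis-aligned square of width `2 ^ exp`, given by its lower left corner. -/
@[ext]
structure Square where
  corner : ℂ
  exp : ℤ

namespace Square

/-- The width `w(B) = 2 ^ ℓ`. -/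
def width (B : Square) : ℝ := (2 : ℝ) ^ B.exp

/-- The set of points of the closed square. -/
def toSet (B : Square) : Set ℂ :=
  {z | z.re ∈ Set.Icc B.corner.re (B.corner.re + B.width) ∧
       z.im ∈ Set.Icc B.corner.im (B.corner.im + B.width)}

/-- The center of the square. -/
def center (B : Square) : ℂ := ⟨B.corner.re + B.width / 2, B.corner.im + B.width / 2⟩

/-- The closed square `2B` with the same center and twice the width. -/
def double (B : Square) : Set ℂ :=
  {z | |z.re - B.center.re| ≤ B.width ∧ |z.im - B.center.im| ≤ B.width}

open scoped Classical in
/-- The `2 ^ p × 2 ^ p` equally sized sub-squares of `B`. -/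
def subdivide (p : ℕ) (B : Square) : Finset Square :=
  (Finset.range (2 ^ p) ×ˢ Finset.range (2 ^ p)).image fun q =>
    { corner := ⟨B.corner.re + q.1 * (2 : ℝ) ^ (B.exp - p),
                 B.corner.im + q.2 * (2 : ℝ) ^ (B.exp - p)⟩
      exp := B.exp - p }

end Square

/-- A component, as a finite set of squares. -/
abbrev Component := Finset Square

namespace Component

/-- The closed region covered by the squares of `C`. -/
def region (C : Component) : Set ℂ := ⋃ B ∈ C, B.toSet

/-- The enlarged region `C⁺`, the union of the squares `2B`. -/
def enlarged (C : Component) : Set ℂ := ⋃ B ∈ C, B.double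

open scoped Classical in
/-- `ℓ_C`: the squares of `C` have width `2 ^ ℓ_C`. (For squares of different widths this is the
largest exponent; that all widths agree is part of the theorem.) -/
def level (C : Component) : ℤ := if h : C.Nonempty then C.sup' h Square.exp else 0

/-- `w(C)`: the width of the enclosing square `B_C`, the smallest axis-aligned square that contains
`C`, has the same left border as `C` and the same upper border as `C`. -/
def width (C : Component) : ℝ :=
  max (sSup (Complex.re '' C.region) - sInf (Complex.re '' C.region))
      (sSup (Complex.im '' C.region) - sInf (Complex.im '' C.region))

/-- `m_C`: the center of the enclosing square `B_C`. -/
def center (C : Component) : ℂ :=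
  ⟨sInf (Complex.re '' C.region) + C.width / 2, sSup (Complex.im '' C.region) - C.width / 2⟩

/-- `Δ_C`: the disk with center `m_C` and radius `(3/4) w(C)`. -/
def disk (C : Component) : Disk := ⟨C.center, 3 / 4 * C.width⟩

/-- `r(C) = w(C) / 2`. -/
def radius (C : Component) : ℝ := C.width / 2

end Component

/-- `B` and `B'` are connected in `S` by a chain of squares of `S` in which consecutive squares
intersect. -/
def ConnectedIn (S : Finset Square) (B B' : Square) : Prop :=
  Relation.ReflTransGen
    (fun X Y : Square => X ∈ S ∧ Y ∈ S ∧ (X.toSet ∩ Y.toSet).Nonempty) B B'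

open scoped Classical in
/-- The maximal connected components of a finite set of squares. -/
def maxComponents (S : Finset Square) : Finset Component :=
  S.image fun B => S.filter fun B' => ConnectedIn S B B'

/-! ### Roots -/

open scoped Classical in
/-- The roots of `F` in a region, with multiplicities. -/
def rootsIn (F : ℂ[X]) (R : Set ℂ) : Multiset ℂ := F.roots.filter (· ∈ R)

/-- The number of roots of `F` in a region, counted with multiplicity. -/
def numRoots (F : ℂ[X]) (R : Set ℂ) : ℕ := Multiset.card (rootsIn F R)

/-- The disk `D` is isolating for the root `z`: it contains `z` and no other root (roots being
listed with multiplicity). -/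
def IsIsolating (F : ℂ[X]) (D : Disk) (z : ℂ) : Prop := rootsIn F D.toSet = {z}

/-- `σ_F(R)`: the least distance between a root of `F` in `R` and another root of `F`, the roots
being listed with multiplicity (`∞` if there is no root in `R`). -/
def separation (F : ℂ[X]) (R : Set ℂ) : ℝ≥0∞ :=
  ⨅ (z : ℂ) (_ : z ∈ F.roots ∧ z ∈ R), ⨅ (y : ℂ) (_ : y ∈ F.roots.erase z), edist z y

/-- `min (σ_F(2B), 2^8 w(B))`, a real number. -/
def cappedSeparation (F : ℂ[X]) (B : Square) : ℝ :=
  (min (separation F B.double) (ENNReal.ofReal (2 ^ 8 * B.width))).toReal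

/-! ### Approximate arithmetic

The algorithm only sees approximations, any of the admissible ones. The outcome of a call is
therefore described by a relation: `Outcome … o` holds if `o` can be the outcome for some admissible
approximations. In an `Option`-valued outcome, `none` means that a loop never stops. -/

/-- `a'` is a Gaussian integer divided by `2 ^ (L + 1)`. -/
def IsDyadic (L : ℤ) (a' : ℂ) : Prop :=
  ∃ u v : ℤ, a' = (⟨u / (2 : ℝ) ^ (L + 1), v / (2 : ℝ) ^ (L + 1)⟩ : ℂ)

/-- `a'` is an `L`-bit approximation of the complex number `a`. -/
def IsApprox (L : ℤ) (a a' : ℂ) : Prop := IsDyadic L a' ∧ ‖a - a'‖ < (2 : ℝ) ^ (-L)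

/-- `a'` is an `L`-bit approximation of the real number `a`. -/
def IsRealApprox (L : ℤ) (a a' : ℝ) : Prop :=
  (∃ u : ℤ, a' = u / (2 : ℝ) ^ (L + 1)) ∧ |a - a'| < (2 : ℝ) ^ (-L)

open scoped Classical in
/-- The result of a loop that, in its `j`-th round, either returns `some` value or goes on (`none`);
the result is `none` if the loop never returns. -/
def loopResult {α : Type} (d : ℕ → Option α) : Option α :=
  if h : ∃ j, (d j).isSome then d (Nat.find h) else none

/-- The answers of the soft comparison. -/
inductive SoftAnswer
  | yes
  | no
  | undecided

open scoped Classical in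
/-- One round of the soft comparison of `El` and `Er`, with precision `L`. -/
def softCompareRound (L : ℕ) (El Er : ℝ) : Option SoftAnswer :=
  let ε : ℝ := (2 : ℝ) ^ (-(L : ℤ))
  let Elm := max 0 (El - ε)
  let Elp := max 0 (El + ε)
  let Erm := max 0 (Er - ε)
  let Erp := max 0 (Er + ε)
  if Elm > Erp then some .yes
  else if Elp < Erm then some .no
  else if 2 / 3 * Elp ≤ Erm ∧ Erm < Erp ∧ Erp ≤ 3 / 2 * Elm then some .undecided
  else none

/-- Outcomes of the soft version of the predicate `El > Er`; the precision is `L = 1, 2, 4, …`. -/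
def SoftCompareOutcome (El Er : ℝ) (o : Option SoftAnswer) : Prop :=
  ∃ l r : ℕ → ℝ,
    (∀ j, IsRealApprox (2 ^ j : ℕ) El (l j) ∧ IsRealApprox (2 ^ j : ℕ) Er (r j)) ∧
    o = loopResult fun j => softCompareRound (2 ^ j) (l j) (r j)

/-! ### Counting roots in a disk: the test `T_*` -/

/-- `F_Δ(x) = F(m + r x)`. -/
def shiftScale (F : ℂ[X]) (D : Disk) : ℂ[X] := F.comp (C D.center + C (D.radius : ℂ) * X)

/-- One Graeffe iteration for a polynomial of degree `n`:
`(-1)^n (G_e(x)^2 - x G_o(x)^2)`, where `G(x) = G_e(x^2) + x G_o(x^2)`. -/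
def graeffe (n : ℕ) (G : ℂ[X]) : ℂ[X] :=
  (-1) ^ n *
    ((∑ i ∈ Finset.range (n / 2 + 1), C (G.coeff (2 * i)) * X ^ i) ^ 2 -
      X * (∑ i ∈ Finset.range ((n + 1) / 2), C (G.coeff (2 * i + 1)) * X ^ i) ^ 2)

/-- The number `⌈log (1 + log n)⌉ + 5` of Graeffe iterations (binary logarithms). -/
def graeffeCount (n : ℕ) : ℕ := ⌈Real.logb 2 (1 + Real.logb 2 n)⌉₊ + 5

open scoped Classical in
/-- One round of the soft version of Pellet's test `|f_k| > ∑_{i ≠ k} |f_i|` for a polynomial of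
degree `n`, with precision `L`; `f` are the approximations of the coefficients. -/
def pelletRound (n k L : ℕ) (f : ℕ → ℂ) : Option Bool :=
  let ε : ℝ := (2 : ℝ) ^ (-((L : ℤ) + Nat.clog 2 (n + 1)))
  let lo : ℕ → ℝ := fun i => max 0 (‖f i‖ - ε)
  let hi : ℕ → ℝ := fun i => ‖f i‖ + ε
  let others := (Finset.range (n + 1)).erase k
  if lo k - ∑ i ∈ others, hi i > 0 then some true
  else if ∑ i ∈ others, lo i - hi k > 0 then some false
  else if ∑ i ∈ others, lo i - 2 / 3 * hi k ≥ 0 ∧ 3 / 2 * lo k - ∑ i ∈ others, hi i ≥ 0 then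
    some false
  else none

/-- Outcomes of the soft version of Pellet's test, applied to `G` (of degree `n`) and `k`; the
precision is `L = 1, 2, 4, …`. -/
def PelletOutcome (n : ℕ) (G : ℂ[X]) (k : ℕ) (o : Option Bool) : Prop :=
  ∃ f : ℕ → ℕ → ℂ,
    (∀ j, ∀ i ≤ n, IsApprox ((2 ^ j : ℕ) + Nat.clog 2 (n + 1)) (G.coeff i) (f j i)) ∧
    o = loopResult fun j => pelletRound n k (2 ^ j) (f j)

/-- Outcomes of the test `T_*(Δ)`: some `k` for which the soft Pellet test succeeds on the iterated
Graeffe transform of `F_Δ`, and `-1` if there is no such `k`. -/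
def CountOutcome (F : ℂ[X]) (D : Disk) (o : Option ℤ) : Prop :=
  ∃ t : ℕ → Option Bool,
    (∀ k ≤ F.natDegree, PelletOutcome F.natDegree
      ((graeffe F.natDegree)^[graeffeCount F.natDegree] (shiftScale F D)) k (t k)) ∧
    (((∃ k ≤ F.natDegree, t k = none) ∧ o = none) ∨
     ((∀ k ≤ F.natDegree, t k ≠ none) ∧
        ((∃ k ≤ F.natDegree, t k = some true ∧ o = some (k : ℤ)) ∨
         ((∀ k ≤ F.natDegree, t k ≠ some true) ∧ o = some (-1)))))

/-! ### Bisection -/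

open scoped Classical in
/-- Outcomes of the bisection routine: every square is divided into four, the sub-squares `B` with
`T_*(Δ_B) = 0` are discarded, and the others are grouped into maximal connected components. -/
def BisectionOutcome (F : ℂ[X]) (C : Component) (o : Option (Finset Component)) : Prop :=
  ∃ t : Square → Option ℤ,
    (∀ B ∈ C.biUnion (Square.subdivide 1), CountOutcome F ⟨B.center, 3 / 4 * B.width⟩ (t B)) ∧
    (((∃ B ∈ C.biUnion (Square.subdivide 1), t B = none) ∧ o = none) ∨
     ((∀ B ∈ C.biUnion (Square.subdivide 1), t B ≠ none) ∧
        o = some (maxComponents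
          ((C.biUnion (Square.subdivide 1)).filter fun B => t B ≠ some 0))))

/-! ### The Newton test -/

/-- From `L`-bit approximations `a`, `b` of `F(x)`, `F'(x)` one can derive that `y` is a
`(6 - ℓ + log N)`-bit approximation of the Newton iterate `x - k F(x) / F'(x)`: it is one for all
values compatible with `a` and `b`. Note that `2^(-(6 - ℓ + log N)) = 2^ℓ / (64 N)`. -/
def NewtonCertified (L : ℕ) (ℓ : ℤ) (N k : ℕ) (x a b y : ℂ) : Prop :=
  ∀ u v : ℂ, ‖u - a‖ < (2 : ℝ) ^ (-(L : ℤ)) → ‖v - b‖ < (2 : ℝ) ^ (-(L : ℤ)) →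
    v ≠ 0 ∧ IsApprox (6 - ℓ + Nat.log 2 N) (x - k * (u / v)) y

/-- Outcomes of the loop (with precision `L = 1, 2, 4, …`) that approximates the Newton iterate. -/
def NewtonIterateOutcome (F : ℂ[X]) (ℓ : ℤ) (N k : ℕ) (x : ℂ) (o : Option ℂ) : Prop :=
  ∃ a b : ℕ → ℂ,
    (∀ j, IsApprox (2 ^ j : ℕ) (F.eval x) (a j) ∧
      IsApprox (2 ^ j : ℕ) (F.derivative.eval x) (b j)) ∧
    ((∃ j y, NewtonCertified (2 ^ j) ℓ N k x (a j) (b j) y ∧ o = some y) ∨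
     ((∀ j y, ¬ NewtonCertified (2 ^ j) ℓ N k x (a j) (b j) y) ∧ o = none))

/-- The disk `Δ' = Δ(y, 2^(ℓ_C) / (8 N))`. -/
def newtonDisk (C : Component) (N : ℕ) (y : ℂ) : Disk := ⟨y, 1 / 8 * ((2 : ℝ) ^ C.level / N)⟩

open scoped Classical in
/-- The set of all sub-squares of width `2^(ℓ_C - 1) / N` of the squares of `C` that intersect
`Δ'`. (Each square is divided into `4 N^2` sub-squares; `N` is a power of two.) -/
def newtonComponent (C : Component) (N : ℕ) (y : ℂ) : Component :=
  (C.biUnion (Square.subdivide (Nat.log 2 N + 1))).filter fun B =>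
    (B.toSet ∩ (newtonDisk C N y).toSet).Nonempty

/-- The results of the Newton test. -/
inductive NewtonResult
  | failure
  | success (C' : Component)

/-- Outcomes of the Newton test for `(C, N, k, x)`. -/
inductive NewtonOutcome (F : ℂ[X]) (C : Component) (N k : ℕ) (x : ℂ) :
    Option NewtonResult → Prop
  | compare_hang
      (h : SoftCompareOutcome (4 * C.radius * ‖F.derivative.eval x‖) ‖F.eval x‖ none) :
      NewtonOutcome F C N k x none
  | compare_no
      (h : SoftCompareOutcome (4 * C.radius * ‖F.derivative.eval x‖) ‖F.eval x‖
        (some .no)) :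
      NewtonOutcome F C N k x (some .failure)
  | iterate_hang (a : SoftAnswer) (ha : a ≠ .no)
      (h : SoftCompareOutcome (4 * C.radius * ‖F.derivative.eval x‖) ‖F.eval x‖ (some a))
      (hy : NewtonIterateOutcome F C.level N k x none) :
      NewtonOutcome F C N k x none
  | disk_outside (a : SoftAnswer) (ha : a ≠ .no)
      (h : SoftCompareOutcome (4 * C.radius * ‖F.derivative.eval x‖) ‖F.eval x‖ (some a))
      (y : ℂ) (hy : NewtonIterateOutcome F C.level N k x (some y))
      (hd : Disjoint (newtonDisk C N y).toSet C.region) :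
      NewtonOutcome F C N k x (some .failure)
  | count_hang (a : SoftAnswer) (ha : a ≠ .no)
      (h : SoftCompareOutcome (4 * C.radius * ‖F.derivative.eval x‖) ‖F.eval x‖ (some a))
      (y : ℂ) (hy : NewtonIterateOutcome F C.level N k x (some y))
      (hd : ¬ Disjoint (newtonDisk C N y).toSet C.region)
      (hc : CountOutcome F (newtonDisk C N y) none) :
      NewtonOutcome F C N k x none
  | count_ne (a : SoftAnswer) (ha : a ≠ .no)
      (h : SoftCompareOutcome (4 * C.radius * ‖F.derivative.eval x‖) ‖F.eval x‖ (some a))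
      (y : ℂ) (hy : NewtonIterateOutcome F C.level N k x (some y))
      (hd : ¬ Disjoint (newtonDisk C N y).toSet C.region)
      (c : ℤ) (hc : CountOutcome F (newtonDisk C N y) (some c)) (hck : c ≠ k) :
      NewtonOutcome F C N k x (some .failure)
  | count_eq (a : SoftAnswer) (ha : a ≠ .no)
      (h : SoftCompareOutcome (4 * C.radius * ‖F.derivative.eval x‖) ‖F.eval x‖ (some a))
      (y : ℂ) (hy : NewtonIterateOutcome F C.level N k x (some y))
      (hd : ¬ Disjoint (newtonDisk C N y).toSet C.region)
      (hc : CountOutcome F (newtonDisk C N y) (some (k : ℤ))) :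
      NewtonOutcome F C N k x (some (.success (newtonComponent C N y)))

/-! ### The algorithm -/

/-- A pair `(C, N_C)`. The field `ancestors` is not used by the algorithm: it records the component
from which `C` resulted, followed by the ancestors of that component; the Boolean tells whether the
Newton test was successful for that ancestor. -/
structure Entry where
  comp : Component
  speed : ℕ
  ancestors : List (Component × Bool)

/-- The two phases of the algorithm. -/
inductive Phase
  | preprocessing
  | mainLoop

/-- A state of the algorithm, at the beginning of a round of one of its two outer loops. -/
structure State where
  phase : Phase
  output : List Disk
  entries : Finset Entry

/-- The initial state: `O` is empty and `𝒞 = {(B, 4)}`. -/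
def initialState (B₀ : Square) : State := ⟨.preprocessing, [], {⟨{B₀}, 4, []⟩}⟩

/-- The algorithm returns `O` in this state. -/
def IsFinal (s : State) : Prop := s.phase = .mainLoop ∧ s.entries = ∅

/-- The component resulting from a bisection of `e`, with speed `N`. -/
def bisectionChild (e : Entry) (N : ℕ) (C' : Component) : Entry :=
  ⟨C', N, (e.comp, false) :: e.ancestors⟩

open scoped Classical in
/-- The phase after a round of the preprocessing, which is repeated until the union of the
components differs from `B₀`. -/
def nextPhase (B₀ : Square) (D : Finset Component) : Phase :=
  if (⋃ C ∈ D, Component.region C) = B₀.toSet then .preprocessing else .mainLoop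

/-- `4Δ_C` meets no other current component. -/
def WellSeparated (rest : Finset Entry) (C : Component) : Prop :=
  ∀ e ∈ rest, e.comp ≠ C → Disjoint (C.disk.scale 4).toSet e.comp.region

/-- Outcomes of the test whether `C` is well separated and `k = T_*(2Δ_C) = T_*(4Δ_C)` for some
`k ≥ 1`. The outcome `some 0` means that the answer is negative, `some k` with `k ≥ 1` that it is
positive with this `k`. -/
inductive ClusterOutcome (F : ℂ[X]) (rest : Finset Entry) (C : Component) : Option ℕ → Prop
  | not_separated (hs : ¬ WellSeparated rest C) : ClusterOutcome F rest C (some 0)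
  | hang (hs : WellSeparated rest C)
      (h : CountOutcome F (C.disk.scale 2) none ∨ CountOutcome F (C.disk.scale 4) none) :
      ClusterOutcome F rest C none
  | negative (hs : WellSeparated rest C) (a b : ℤ)
      (ha : CountOutcome F (C.disk.scale 2) (some a))
      (hb : CountOutcome F (C.disk.scale 4) (some b)) (h : ¬ (a = b ∧ 1 ≤ a)) :
      ClusterOutcome F rest C (some 0)
  | positive (hs : WellSeparated rest C) (k : ℕ) (hk : 1 ≤ k)
      (ha : CountOutcome F (C.disk.scale 2) (some (k : ℤ)))
      (hb : CountOutcome F (C.disk.scale 4) (some (k : ℤ))) :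
      ClusterOutcome F rest C (some k)

/-- The points admissible as `x_C`. -/
def IsStartPoint (B₀ : Square) (C : Component) (x : ℂ) : Prop :=
  x ∈ B₀.toSet \ C.region ∧ Metric.infDist x C.region = (2 : ℝ) ^ (C.level - 1) ∧
    (2 : ℝ) ^ (C.level - 1) ≤ Metric.infDist x (frontier B₀.toSet)

/-- In the main loop, the linear step is reached for the pair `e`. -/
def ReachesBisection (F : ℂ[X]) (B₀ : Square) (rest : Finset Entry) (e : Entry) : Prop :=
  ClusterOutcome F rest e.comp (some 0) ∨
  ∃ k x, 1 < k ∧ ClusterOutcome F rest e.comp (some k) ∧ IsStartPoint B₀ e.comp x ∧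
    NewtonOutcome F e.comp e.speed k x (some .failure)

open scoped Classical in
/-- One round of one of the two outer loops. `Step F B₀ s (some t)` means that `s` can be followed
by `t`; `Step F B₀ s none` means that the round may fail to produce a next state, because an inner
loop does not stop or no admissible point `x_C` exists.
In the main loop any pair may be picked. The speed `N_C` is always of the form `2^(2^m)` with
`m ≥ 1`, so that `Nat.sqrt` is its exact square root. -/
inductive Step (F : ℂ[X]) (B₀ : Square) : State → Option State → Prop
  | pre_hang (O : List Disk) (e : Entry) (h : BisectionOutcome F e.comp none) :
      Step F B₀ ⟨.preprocessing, O, {e}⟩ none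
  | pre (O : List Disk) (e : Entry) (D : Finset Component)
      (h : BisectionOutcome F e.comp (some D)) :
      Step F B₀ ⟨.preprocessing, O, {e}⟩
        (some ⟨nextPhase B₀ D, O, D.image (bisectionChild e 4)⟩)
  | cluster_hang (O : List Disk) (𝒞 : Finset Entry) (e : Entry) (he : e ∈ 𝒞)
      (h : ClusterOutcome F (𝒞.erase e) e.comp none) :
      Step F B₀ ⟨.mainLoop, O, 𝒞⟩ none
  | isolate (O : List Disk) (𝒞 : Finset Entry) (e : Entry) (he : e ∈ 𝒞)
      (h : ClusterOutcome F (𝒞.erase e) e.comp (some 1)) :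
      Step F B₀ ⟨.mainLoop, O, 𝒞⟩
        (some ⟨.mainLoop, O ++ [e.comp.disk.scale 2], 𝒞.erase e⟩)
  | no_point (O : List Disk) (𝒞 : Finset Entry) (e : Entry) (he : e ∈ 𝒞) (k : ℕ) (hk : 1 < k)
      (h : ClusterOutcome F (𝒞.erase e) e.comp (some k))
      (hx : ∀ x, ¬ IsStartPoint B₀ e.comp x) :
      Step F B₀ ⟨.mainLoop, O, 𝒞⟩ none
  | newton_hang (O : List Disk) (𝒞 : Finset Entry) (e : Entry) (he : e ∈ 𝒞) (k : ℕ) (hk : 1 < k)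
      (h : ClusterOutcome F (𝒞.erase e) e.comp (some k)) (x : ℂ) (hx : IsStartPoint B₀ e.comp x)
      (hN : NewtonOutcome F e.comp e.speed k x none) :
      Step F B₀ ⟨.mainLoop, O, 𝒞⟩ none
  | newton (O : List Disk) (𝒞 : Finset Entry) (e : Entry) (he : e ∈ 𝒞) (k : ℕ) (hk : 1 < k)
      (h : ClusterOutcome F (𝒞.erase e) e.comp (some k)) (x : ℂ) (hx : IsStartPoint B₀ e.comp x)
      (C' : Component) (hN : NewtonOutcome F e.comp e.speed k x (some (.success C'))) :
      Step F B₀ ⟨.mainLoop, O, 𝒞⟩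
        (some ⟨.mainLoop, O,
          insert ⟨C', e.speed ^ 2, (e.comp, true) :: e.ancestors⟩ (𝒞.erase e)⟩)
  | bisect_hang (O : List Disk) (𝒞 : Finset Entry) (e : Entry) (he : e ∈ 𝒞)
      (h : ReachesBisection F B₀ (𝒞.erase e) e) (hb : BisectionOutcome F e.comp none) :
      Step F B₀ ⟨.mainLoop, O, 𝒞⟩ none
  | bisect (O : List Disk) (𝒞 : Finset Entry) (e : Entry) (he : e ∈ 𝒞)
      (h : ReachesBisection F B₀ (𝒞.erase e) e) (D : Finset Component)
      (hb : BisectionOutcome F e.comp (some D)) :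
      Step F B₀ ⟨.mainLoop, O, 𝒞⟩
        (some ⟨.mainLoop, O,
          𝒞.erase e ∪ D.image (bisectionChild e (max 4 (Nat.sqrt e.speed)))⟩)

/-- The states that occur in some run of the algorithm. -/
def Reachable (F : ℂ[X]) (B₀ : Square) (s : State) : Prop :=
  Relation.ReflTransGen (fun s t => Step F B₀ s (some t)) (initialState B₀) s

/-- Termination: no run is infinite, no round can fail to finish, and a run can only end by
returning. -/
def Terminates (F : ℂ[X]) (B₀ : Square) : Prop :=
  (¬ ∃ run : ℕ → State, run 0 = initialState B₀ ∧ ∀ i, Step F B₀ (run i) (some (run (i + 1)))) ∧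
  ∀ s, Reachable F B₀ s →
    ¬ Step F B₀ s none ∧ (IsFinal s ∨ ∃ t, Step F B₀ s (some t))

/-- The output is as required. -/
def CorrectOutput (F : ℂ[X]) (B₀ : Square) (O : List Disk) : Prop :=
  O.Pairwise (fun D D' => Disjoint D.toSet D'.toSet) ∧
  (∀ D ∈ O, ∃ z ∈ B₀.double, IsIsolating F D z ∧ IsIsolating F (D.scale 2) z) ∧
  ∀ z ∈ B₀.toSet, F.IsRoot z → ∃ D ∈ O, IsIsolating F D z

/-- `anc^*(C)`: the first ancestor for which the Newton test was successful, and `B₀` if there is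
none. -/
def ancStar (B₀ : Square) (e : Entry) : Component :=
  match e.ancestors.find? (fun p => p.2) with
  | some p => p.1
  | none => {B₀}

end CIsolate

end

open CIsolate

namespace CIsolate

/-! ### Pellet's theorem -/

/-! Everything rests on two guarantees of the counting test. If a soft Pellet test succeeds, one
coefficient strictly dominates the others, so the argument principle (`pellet`) counts the roots in
the unit disk. Graeffe iteration only raises the scaled roots to a power, so a returned k ≥ 0 is the
number of roots in the disk (`CountOutcome.numRoots_eq`). Conversely, if no root lies between
(2√2/3)Δ and (4/3)Δ, the iteration drives every root so close to 0 or ∞ that one coefficient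
dominates by more than the tolerance of the soft test, and the correct count must be returned
(`CountOutcome.eq_of_numRoots`).

Hence bisection loses no root, and each square it keeps has a root in the interior of its double. A
successful Newton test needs no convergence theory: Δ' and the larger disk 2Δ_C both contain k
roots, so they contain the same roots. As k ≥ 2, the diameter of Δ' bounds the separation σ, which
limits N and the new mesh (`newtonComponent_spec`).

These facts feed the invariant `StateInv`. A component of mesh below σ/2^10 has one root common to
the interiors of all its doubles, fits into a 2 × 2 block, is well separated, and passes both
counting tests with k = 1. It is therefore output and never bisected
(`StateInv.level_of_reachesBisection`). In the preprocessing such a mesh is impossible because the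
component covers the whole square (`EntryInv.level_of_cover`). So meshes stay at least σ/2^11, which
is stronger than the lower bound in (g), and the potential ∑ s_C 8^(ℓ_C - L) decreases in every
round.

The inner loops stop because roots of the initial square outside C keep max-norm distance at least
2^ℓ_C from C, so F(x_C) ≠ 0; if the soft comparison is then not answered by False, also F'(x_C) ≠ 0.

Output disks have radius 3/2 times a power of two. Comparing these powers for an old and a new disk,
and using that 2D avoids the current components and that 4Δ_C contains a single root, gives
disjointness (`StateInv.isolate`). For (e), a point lies in the open doubles of at most nine
squares, all in one component (`CoreInv.sum_card_le`). -/

/-- The polynomial with leading coefficient `c` and roots `s`. -/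
noncomputable def polyOfRoots (c : ℂ) (s : Multiset ℂ) : ℂ[X] :=
  C c * (s.map fun z => X - C z).prod

lemma polyOfRoots_cons (c z : ℂ) (s : Multiset ℂ) :
    polyOfRoots c (z ::ₘ s) = (X - C z) * polyOfRoots c s := by
  simp [polyOfRoots]; ring

lemma natDegree_polyOfRoots {c : ℂ} (hc : c ≠ 0) (s : Multiset ℂ) :
    (polyOfRoots c s).natDegree = Multiset.card s := by
  rw [polyOfRoots, natDegree_C_mul hc, natDegree_multiset_prod_X_sub_C_eq_card]

lemma roots_polyOfRoots {c : ℂ} (hc : c ≠ 0) (s : Multiset ℂ) : (polyOfRoots c s).roots = s := by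
  rw [polyOfRoots, roots_C_mul _ hc, roots_multiset_prod_X_sub_C]

lemma eval_polyOfRoots (c : ℂ) (s : Multiset ℂ) (x : ℂ) :
    (polyOfRoots c s).eval x = c * (s.map fun z => x - z).prod := by
  simp [polyOfRoots, eval_multiset_prod]

lemma eq_polyOfRoots (F : ℂ[X]) : F = polyOfRoots F.leadingCoeff F.roots :=
  (IsAlgClosed.splits F).eq_prod_roots

-- A pole inside the circle contributes 2πi, a pole outside contributes 0. Integrability is carried
-- through the induction because splitting the integral of the sum requires it.
open scoped Classical in
lemma circleIntegral_sum_inv (s : Multiset ℂ) (hs : ∀ z ∈ s, ‖z‖ ≠ 1) :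
    CircleIntegrable (fun x => (s.map fun z => (x - z)⁻¹).sum) 0 1 ∧
    (∮ x in C(0, 1), (s.map fun z => (x - z)⁻¹).sum) =
      (Multiset.card (s.filter (‖·‖ < 1)) : ℂ) * (2 * Real.pi * Complex.I) := by
  induction s using Multiset.induction with
  | empty => simp [circleIntegral, CircleIntegrable]
  | cons a s ih =>
    obtain ⟨ih1, ih2⟩ := ih fun z hz => hs z (Multiset.mem_cons_of_mem hz)
    have ha : ‖a‖ ≠ 1 := hs a (Multiset.mem_cons_self _ _)
    have hi : CircleIntegrable (fun x => (x - a)⁻¹) 0 1 := by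
      apply ContinuousOn.circleIntegrable zero_le_one
      refine ContinuousOn.inv₀ (by fun_prop) fun x hx h => ha ?_
      rw [← sub_eq_zero.1 h]; simpa using hx
    have hv : (∮ x in C(0, 1), (x - a)⁻¹) =
        (if ‖a‖ < 1 then 1 else 0) * (2 * Real.pi * Complex.I) := by
      split_ifs with h
      · rw [one_mul]
        exact circleIntegral.integral_sub_inv_of_mem_ball (by simpa using h)
      · rw [zero_mul]
        have h1 : 1 < ‖a‖ := lt_of_le_of_ne (not_lt.1 h) (Ne.symm ha)
        have hne : ∀ x : ℂ, ‖x‖ ≤ 1 → x - a ≠ 0 := fun x hx h0 => by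
          rw [sub_eq_zero.1 h0] at hx; linarith
        refine Complex.circleIntegral_eq_zero_of_differentiable_on_off_countable zero_le_one
          Set.countable_empty ?_ ?_
        · exact ContinuousOn.inv₀ (by fun_prop) fun x hx => hne x (by simpa using hx)
        · intro x hx
          have hx' : ‖x‖ < 1 := by simpa using hx.1
          exact DifferentiableAt.inv (by fun_prop) (hne x hx'.le)
    simp only [Multiset.map_cons, Multiset.sum_cons]
    refine ⟨hi.add ih1, ?_⟩
    rw [circleIntegral.integral_add hi ih1, hv, ih2, Multiset.filter_cons]
    split_ifs <;> simp
    ring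

lemma eval_eq_sum_polyOfRoots {c : ℂ} (hc : c ≠ 0) (s : Multiset ℂ) (x : ℂ) :
    (polyOfRoots c s).eval x =
      ∑ i ∈ Finset.range (Multiset.card s + 1), (polyOfRoots c s).coeff i * x ^ i := by
  rw [eval_eq_sum_range, natDegree_polyOfRoots hc]

open scoped Classical in
/-- Pellet's theorem for the unit disk. -/
theorem pellet {c : ℂ} (hc : c ≠ 0) (s : Multiset ℂ) {k : ℕ} (hk : k ≤ Multiset.card s)
    (h : ∑ i ∈ (Finset.range (Multiset.card s + 1)).erase k, ‖(polyOfRoots c s).coeff i‖ <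
      ‖(polyOfRoots c s).coeff k‖) :
    Multiset.card (s.filter (‖·‖ < 1)) = k := by
  set f := polyOfRoots c s with hf
  have hk0 : f.coeff k ≠ 0 := fun h0 => by
    rw [h0, norm_zero] at h
    exact absurd h (not_lt.2 (Finset.sum_nonneg fun _ _ => norm_nonneg _))
  have hx0 : ∀ x : ℂ, ‖x‖ = 1 → x ≠ 0 := fun x hx h0 => by simp [h0] at hx
  -- Dividing by the dominant monomial keeps the values on the circle in the unit disk around 1.
  -- There f has no zero and the principal logarithm is differentiable.
  have hclose : ∀ x : ℂ, ‖x‖ = 1 → ‖f.eval x / (f.coeff k * x ^ k) - 1‖ < 1 := by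
    intro x hx
    have hd : f.coeff k * x ^ k ≠ 0 := mul_ne_zero hk0 (pow_ne_zero _ (hx0 x hx))
    have : f.eval x / (f.coeff k * x ^ k) - 1 =
        (∑ i ∈ (Finset.range (Multiset.card s + 1)).erase k, f.coeff i * x ^ i) /
          (f.coeff k * x ^ k) := by
      rw [div_sub_one hd, hf, eval_eq_sum_polyOfRoots hc,
        ← Finset.add_sum_erase _ _ (Finset.mem_range.2 (Nat.lt_succ_of_le hk)),
        add_sub_cancel_left]
    rw [this, norm_div, norm_mul, norm_pow, hx, one_pow, mul_one, div_lt_one (norm_pos_iff.2 hk0)]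
    refine lt_of_le_of_lt (norm_sum_le _ _) (lt_of_le_of_lt (Finset.sum_le_sum fun i _ => ?_) h)
    simp [hx]
  have hfx : ∀ x : ℂ, ‖x‖ = 1 → f.eval x ≠ 0 := fun x hx h0 => by
    have := hclose x hx
    simp [h0] at this
  have hs : ∀ z ∈ s, ‖z‖ ≠ 1 := fun z hz h1 => by
    refine hfx z h1 ?_
    rw [hf, eval_polyOfRoots, Multiset.prod_eq_zero, mul_zero]
    exact Multiset.mem_map.2 ⟨z, hz, sub_self z⟩
  obtain ⟨hint, hval⟩ := circleIntegral_sum_inv s hs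
  have hlog : ∀ x : ℂ, ‖x‖ = 1 → f.derivative.eval x / f.eval x =
      (s.map fun z => (x - z)⁻¹).sum := by
    intro x hx
    rw [(IsAlgClosed.splits f).eval_derivative_div_eval_of_ne_zero (hfx x hx), hf,
      roots_polyOfRoots hc]
    simp [one_div]
  -- The integrand f'/f - k/x has the antiderivative log(f/(f_k x^k)) along the circle, so its
  -- integral over the closed curve vanishes.
  have hzero : (∮ x in C(0, 1), ((s.map fun z => (x - z)⁻¹).sum - k * (x - 0)⁻¹)) = 0 := by
    refine circleIntegral.integral_eq_zero_of_hasDerivWithinAt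
      (f := fun x => Complex.log (f.eval x / (f.coeff k * x ^ k))) zero_le_one fun x hx => ?_
    have hx1 : ‖x‖ = 1 := by simpa using hx
    have hx0' := hx0 x hx1
    have hd : f.coeff k * x ^ k ≠ 0 := mul_ne_zero hk0 (pow_ne_zero _ hx0')
    have hslit : f.eval x / (f.coeff k * x ^ k) ∈ Complex.slitPlane := by
      have := hclose x hx1
      have h2 := (Complex.abs_re_le_norm _).trans_lt this
      rw [Complex.sub_re, Complex.one_re, abs_lt] at h2
      exact Or.inl (by linarith)
    have h1 := (f.hasDerivAt x).div (((hasDerivAt_pow k x).const_mul (f.coeff k))) hd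
    refine ((h1.clog hslit).hasDerivWithinAt (s := Metric.sphere 0 1)).congr_deriv ?_
    rw [← hlog x hx1, Pi.div_apply]
    have := hfx x hx1
    rcases k with _ | k
    · simp at *
      field_simp
    · simp only [Nat.add_sub_cancel, sub_zero]
      field_simp
      ring
  have hk1 : CircleIntegrable (fun x : ℂ => (k : ℂ) * (x - 0)⁻¹) 0 1 := by
    apply ContinuousOn.circleIntegrable zero_le_one
    refine ContinuousOn.mul continuousOn_const (ContinuousOn.inv₀ (by fun_prop) fun x hx => ?_)
    rw [sub_zero]; exact hx0 x (by simpa using hx)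
  rw [circleIntegral.integral_sub hint hk1, hval, circleIntegral.integral_const_mul,
    circleIntegral.integral_sub_inv_of_mem_ball (by simp), ← sub_mul, mul_eq_zero] at hzero
  rcases hzero with h0 | h0
  · exact_mod_cast sub_eq_zero.1 h0
  · exact absurd h0 Complex.two_pi_I_ne_zero

/-! ### Graeffe iteration -/

/-- The two ranges have the right lengths: there are n/2 + 1 even and (n+1)/2 odd indices up to n.
-/
lemma sum_range_even_odd (c : ℕ → ℂ) (y : ℂ) (n : ℕ) :
    ∑ i ∈ Finset.range (n + 1), c i * y ^ i =
      ∑ i ∈ Finset.range (n / 2 + 1), c (2 * i) * (y ^ 2) ^ i +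
        y * ∑ i ∈ Finset.range ((n + 1) / 2), c (2 * i + 1) * (y ^ 2) ^ i := by
  induction n with
  | zero => simp
  | succ n ih =>
    rw [Finset.sum_range_succ, ih]
    rcases Nat.even_or_odd' n with ⟨m, rfl | rfl⟩
    · rw [show (2 * m + 1 + 1) / 2 = m + 1 by omega, show (2 * m + 1) / 2 = m by omega,
        show 2 * m / 2 = m by omega, Finset.sum_range_succ _ m, Finset.sum_range_succ _ m]
      ring
    · rw [show (2 * m + 1 + 1 + 1) / 2 = m + 1 by omega, show (2 * m + 1 + 1) / 2 = m + 1 by omega,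
        show (2 * m + 1) / 2 = m by omega, Finset.sum_range_succ _ (m + 1),
        show 2 * (m + 1) = 2 * m + 1 + 1 by ring]
      ring

/-- Writing f(y) = e + y·o, with e and o functions of y², gives f(y)f(-y) = e² - y²o². So the
transform at y² is (-1)^n f(y)f(-y), and the factors for a root z combine to y² - z². Testing at
squares suffices, since every complex number is one. -/
lemma graeffe_polyOfRoots {c : ℂ} (hc : c ≠ 0) (s : Multiset ℂ) :
    graeffe (Multiset.card s) (polyOfRoots c s) = polyOfRoots (c ^ 2) (s.map (· ^ 2)) := by
  refine Polynomial.funext fun x => ?_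
  obtain ⟨y, rfl⟩ : ∃ y : ℂ, y ^ 2 = x := IsAlgClosed.exists_pow_nat_eq x two_pos
  have h1 := eval_eq_sum_polyOfRoots hc s y
  have h2 := eval_eq_sum_polyOfRoots hc s (-y)
  rw [sum_range_even_odd] at h1 h2
  have h3 : (-1 : ℂ) ^ (Multiset.card s) * ((polyOfRoots c s).eval y * (polyOfRoots c s).eval (-y))
      = (polyOfRoots (c ^ 2) (s.map (· ^ 2))).eval (y ^ 2) := by
    simp only [eval_polyOfRoots, Multiset.map_map, Function.comp_def]
    induction s using Multiset.induction with
    | empty => simp; ring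
    | cons a s ih =>
      have ih := ih (eval_eq_sum_polyOfRoots hc s y |>.trans (sum_range_even_odd _ _ _))
        (eval_eq_sum_polyOfRoots hc s (-y) |>.trans (sum_range_even_odd _ _ _))
      simp only [Multiset.card_cons, Multiset.map_cons, Multiset.prod_cons, pow_succ (-1 : ℂ)]
      linear_combination (y ^ 2 - a ^ 2) * ih
  rw [← h3, h1, h2]
  simp only [graeffe, eval_mul, eval_pow, eval_neg, eval_one, eval_sub, eval_finsetSum, eval_C,
    eval_X, neg_sq]
  ring

lemma graeffe_iterate_polyOfRoots {c : ℂ} (hc : c ≠ 0) (s : Multiset ℂ) (N : ℕ) :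
    (graeffe (Multiset.card s))^[N] (polyOfRoots c s) =
      polyOfRoots (c ^ 2 ^ N) (s.map (· ^ 2 ^ N)) := by
  induction N with
  | zero => simp
  | succ N ih =>
    have h := graeffe_polyOfRoots (pow_ne_zero (2 ^ N) hc) (s.map (· ^ 2 ^ N))
    rw [Multiset.card_map] at h
    rw [Function.iterate_succ_apply', ih, h, Multiset.map_map, ← pow_mul, ← pow_succ]
    congr 1
    refine Multiset.map_congr rfl fun z _ => ?_
    simp only [Function.comp_apply]
    rw [← pow_mul, ← pow_succ]

lemma shiftScale_eq (F : ℂ[X]) (D : Disk) (hr : D.radius ≠ 0) :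
    shiftScale F D = polyOfRoots (F.leadingCoeff * (D.radius : ℂ) ^ Multiset.card F.roots)
      (F.roots.map fun z => (z - D.center) / D.radius) := by
  have hr' : (D.radius : ℂ) ≠ 0 := by exact_mod_cast hr
  have key : ∀ (c : ℂ) (s : Multiset ℂ),
      (polyOfRoots c s).comp (C D.center + C (D.radius : ℂ) * X) =
      polyOfRoots (c * (D.radius : ℂ) ^ Multiset.card s)
        (s.map fun z => (z - D.center) / D.radius) := by
    intro c s
    induction s using Multiset.induction with
    | empty => simp [polyOfRoots]
    | cons a s ih =>
      rw [polyOfRoots_cons, mul_comp, ih, Multiset.map_cons, polyOfRoots_cons]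
      simp only [polyOfRoots, Multiset.card_cons, sub_comp, X_comp, C_comp]
      have : (C D.center + C (D.radius : ℂ) * X - C a : ℂ[X]) =
          C (D.radius : ℂ) * (X - C ((a - D.center) / D.radius)) := by
        rw [mul_sub, ← C_mul, mul_div_cancel₀ _ hr', C_sub]; ring
      rw [this, pow_succ]
      simp only [C_mul]
      ring
  conv_lhs => rw [shiftScale, eq_polyOfRoots F]
  exact key _ _

/-! ### A converse of Pellet's theorem -/

/-- The sum of the absolute values of the first `N` coefficients. -/
noncomputable def coeffNorm (N : ℕ) (p : ℂ[X]) : ℝ := ∑ i ∈ Finset.range N, ‖p.coeff i‖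

lemma coeffNorm_nonneg (N : ℕ) (p : ℂ[X]) : 0 ≤ coeffNorm N p :=
  Finset.sum_nonneg fun _ _ => norm_nonneg _

lemma coeffNorm_add_le (N : ℕ) (p q : ℂ[X]) :
    coeffNorm N (p + q) ≤ coeffNorm N p + coeffNorm N q := by
  rw [coeffNorm, coeffNorm, coeffNorm, ← Finset.sum_add_distrib]
  exact Finset.sum_le_sum fun i _ => by rw [coeff_add]; exact norm_add_le _ _

lemma coeffNorm_C_mul (N : ℕ) (a : ℂ) (p : ℂ[X]) :
    coeffNorm N (C a * p) = ‖a‖ * coeffNorm N p := by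
  simp [coeffNorm, Finset.mul_sum]

lemma coeffNorm_X_mul_le (N : ℕ) (p : ℂ[X]) : coeffNorm N (X * p) ≤ coeffNorm N p := by
  rcases N with _ | N
  · simp [coeffNorm]
  · rw [coeffNorm, Finset.sum_range_succ', coeffNorm, Finset.sum_range_succ]
    simp

lemma coeffNorm_monomial_le (N k : ℕ) (a : ℂ) : coeffNorm N (C a * X ^ k) ≤ ‖a‖ := by
  rw [coeffNorm_C_mul]
  refine mul_le_of_le_one_right (norm_nonneg _) ?_
  simp only [coeffNorm, coeff_X_pow]
  refine (Finset.sum_le_sum (g := fun i => if i = k then 1 else 0) fun i _ => ?_).trans ?_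
  · split_ifs <;> simp
  · rw [Finset.sum_ite_eq']; split_ifs <;> simp

-- A factor X - z behaves like X if z is small and like the constant -z if z is large. In the sum
-- norm of the coefficients, either replacement has relative error at most ρ, and the errors
-- multiply up to (1 + ρ)^n - 1.
open scoped Classical in
lemma exists_coeffNorm_sub_le {c : ℂ} (hc : c ≠ 0) {ρ : ℝ} (hρ : 0 < ρ)
    (N : ℕ) (s : Multiset ℂ) (hs : ∀ z ∈ s, ‖z‖ ≤ ρ ∨ ρ⁻¹ ≤ ‖z‖) :
    ∃ b : ℂ, b ≠ 0 ∧
      coeffNorm N (polyOfRoots c s - C b * X ^ Multiset.card (s.filter (‖·‖ ≤ ρ))) ≤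
        ‖b‖ * ((1 + ρ) ^ Multiset.card s - 1) := by
  induction s using Multiset.induction with
  | empty => exact ⟨c, hc, by simp [polyOfRoots, coeffNorm]⟩
  | cons z s ih =>
    obtain ⟨b, hb, hle⟩ := ih fun z hz => hs z (Multiset.mem_cons_of_mem hz)
    set k := Multiset.card (s.filter (‖·‖ ≤ ρ))
    set P := polyOfRoots c s
    have hP : coeffNorm N P ≤ ‖b‖ * (1 + ρ) ^ Multiset.card s := by
      have h1 := coeffNorm_add_le N (P - C b * X ^ k) (C b * X ^ k)
      rw [sub_add_cancel] at h1
      linarith [coeffNorm_monomial_le N k b]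
    have hbn := norm_pos_iff.2 hb
    by_cases hz : ‖z‖ ≤ ρ
    · refine ⟨b, hb, ?_⟩
      rw [Multiset.filter_cons_of_pos (p := (‖·‖ ≤ ρ)) s hz, Multiset.card_cons, polyOfRoots_cons,
        Multiset.card_cons]
      have e : (X - C z) * P - C b * X ^ (k + 1) = X * (P - C b * X ^ k) + C (-z) * P := by
        rw [C_neg]; ring
      rw [e]
      refine (coeffNorm_add_le _ _ _).trans ?_
      rw [coeffNorm_C_mul, norm_neg]
      have h1 := (coeffNorm_X_mul_le N (P - C b * X ^ k)).trans hle
      have h2 : ‖z‖ * coeffNorm N P ≤ ρ * (‖b‖ * (1 + ρ) ^ Multiset.card s) :=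
        mul_le_mul hz hP (coeffNorm_nonneg _ _) hρ.le
      rw [pow_succ]
      linarith
    · have hz' : ρ⁻¹ ≤ ‖z‖ := (hs z (Multiset.mem_cons_self _ _)).resolve_left hz
      have hzpos : 0 < ‖z‖ := lt_of_lt_of_le (inv_pos.2 hρ) hz'
      have hz0 : z ≠ 0 := norm_pos_iff.1 hzpos
      refine ⟨-z * b, mul_ne_zero (neg_ne_zero.2 hz0) hb, ?_⟩
      rw [Multiset.filter_cons_of_neg (p := (‖·‖ ≤ ρ)) s hz, polyOfRoots_cons, Multiset.card_cons]
      have e : (X - C z) * P - C (-z * b) * X ^ k = C (-z) * (P - C b * X ^ k) + X * P := by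
        rw [C_mul, C_neg]; ring
      rw [e]
      refine (coeffNorm_add_le _ _ _).trans ?_
      rw [coeffNorm_C_mul, norm_mul, norm_neg]
      have h1 := mul_le_mul_of_nonneg_left hle hzpos.le
      have h2 := (coeffNorm_X_mul_le N P).trans hP
      have h3 : ‖b‖ * (1 + ρ) ^ Multiset.card s ≤
          ‖z‖ * (ρ * (‖b‖ * (1 + ρ) ^ Multiset.card s)) := by
        rw [← mul_assoc]
        refine le_mul_of_one_le_left (by positivity) ?_
        have := mul_le_mul_of_nonneg_right hz' hρ.le
        rwa [inv_mul_cancel₀ hρ.ne'] at this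
      rw [pow_succ]
      linarith

lemma one_add_pow_le_three_halves {ρ : ℝ} {n : ℕ} (hn : n ≠ 0) (hρ0 : 0 ≤ ρ)
    (hρ : ρ ≤ 1 / (4 * n ^ 2)) : (1 + ρ) ^ n ≤ 3 / 2 := by
  have hn1 : (1 : ℝ) ≤ n := by exact_mod_cast Nat.one_le_iff_ne_zero.2 hn
  have h1 : (n : ℝ) * ρ ≤ 1 / 4 := by
    calc (n : ℝ) * ρ ≤ n * (1 / (4 * n ^ 2)) := by gcongr
      _ = 1 / (4 * n) := by field_simp
      _ ≤ 1 / 4 := by apply one_div_le_one_div_of_le <;> linarith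
  have h2 : (1 + ρ) ^ n ≤ Real.exp (n * ρ) := by
    rw [Real.exp_nat_mul]
    exact pow_le_pow_left₀ (by linarith) (by linarith [Real.add_one_le_exp ρ]) n
  have h3 : Real.exp (n * ρ) ≤ Real.exp (1 / 4) := Real.exp_le_exp.2 h1
  have h4 : Real.exp (1 / 4) ≤ 3 / 2 := by
    have := Real.exp_bound_div_one_sub_of_interval (x := 1 / 4) (by norm_num) (by norm_num)
    linarith
  linarith

open scoped Classical in
/-- If all roots are very small or very large, the corresponding coefficient dominates. -/
lemma coeff_dominates {c : ℂ} (hc : c ≠ 0) {s : Multiset ℂ} (hs0 : Multiset.card s ≠ 0) {ρ : ℝ}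
    (hρ : 0 < ρ) (hρn : ρ ≤ 1 / (4 * (Multiset.card s : ℝ) ^ 2))
    (hs : ∀ z ∈ s, ‖z‖ ≤ ρ ∨ ρ⁻¹ ≤ ‖z‖) {k : ℕ} (hk : Multiset.card (s.filter (‖·‖ ≤ ρ)) = k) :
    ∑ i ∈ (Finset.range (Multiset.card s + 1)).erase k, ‖(polyOfRoots c s).coeff i‖ <
      2 / 3 * ‖(polyOfRoots c s).coeff k‖ := by
  obtain ⟨b, hb, h⟩ := exists_coeffNorm_sub_le hc hρ (Multiset.card s + 1) s hs
  rw [hk] at h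
  have hbn := norm_pos_iff.2 hb
  have hpow := one_add_pow_le_three_halves hs0 hρ.le hρn
  have hkn : k ∈ Finset.range (Multiset.card s + 1) := by
    rw [← hk, Finset.mem_range, Nat.lt_succ_iff]
    exact Multiset.card_le_card (Multiset.filter_le _ _)
  rw [coeffNorm, ← Finset.add_sum_erase _ _ hkn] at h
  have e1 : ∑ i ∈ (Finset.range (Multiset.card s + 1)).erase k,
      ‖(polyOfRoots c s - C b * X ^ k).coeff i‖ =
      ∑ i ∈ (Finset.range (Multiset.card s + 1)).erase k, ‖(polyOfRoots c s).coeff i‖ := by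
    refine Finset.sum_congr rfl fun i hi => ?_
    simp [coeff_X_pow, (Finset.mem_erase.1 hi).1]
  rw [e1] at h
  have e2 : ‖b‖ ≤ ‖(polyOfRoots c s).coeff k‖ + ‖(polyOfRoots c s - C b * X ^ k).coeff k‖ := by
    have : b = (polyOfRoots c s).coeff k - (polyOfRoots c s - C b * X ^ k).coeff k := by simp
    conv_lhs => rw [this]
    exact norm_sub_le _ _
  have := norm_nonneg ((polyOfRoots c s - C b * X ^ k).coeff k)
  -- With S the sum of the other coefficients and d = |f_k - b|, the facts are S + d ≤ |b|/2 and |b|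
  -- ≤ |f_k| + d. The bound 3/2 on the power is what makes the first right-hand side |b|/2.
  nlinarith

/-- The ceiling j satisfies 2^j ≥ 1 + log n = log(2n). -/
lemma two_mul_le_two_pow_graeffe {n : ℕ} (hn : n ≠ 0) :
    ∃ j : ℕ, graeffeCount n = j + 5 ∧ (2 * n : ℝ) ≤ 2 ^ 2 ^ j := by
  refine ⟨⌈Real.logb 2 (1 + Real.logb 2 n)⌉₊, rfl, ?_⟩
  set j := ⌈Real.logb 2 (1 + Real.logb 2 n)⌉₊
  have hn1 : (1 : ℝ) ≤ n := by exact_mod_cast Nat.one_le_iff_ne_zero.2 hn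
  have hl : 0 ≤ Real.logb 2 n := Real.logb_nonneg one_lt_two hn1
  have h1 : 1 + Real.logb 2 n ≤ (2 : ℝ) ^ j := by
    have := Nat.le_ceil (Real.logb 2 (1 + Real.logb 2 n))
    rw [Real.logb_le_iff_le_rpow one_lt_two (by linarith)] at this
    exact_mod_cast this
  have h2 : Real.logb 2 (2 * n) ≤ ((2 ^ j : ℕ) : ℝ) := by
    rw [Real.logb_mul two_ne_zero (by positivity), Real.logb_self_eq_one one_lt_two]
    exact_mod_cast h1
  rw [Real.logb_le_iff_le_rpow one_lt_two (by positivity), Real.rpow_natCast] at h2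
  exact h2

/-- The five extra iterations give the exponent 2 · 16 · 2^j: squaring brings x to at most 8/9, the
16th power brings that below 1/4, and the 2^j-th power below 1/(2n)². -/
lemma graeffe_contraction {n : ℕ} (hn : n ≠ 0) {x : ℝ} (hx : x ^ 2 ≤ 8 / 9) :
    x ^ 2 ^ graeffeCount n ≤ 1 / (4 * (n : ℝ) ^ 2) := by
  obtain ⟨j, hj, hle⟩ := two_mul_le_two_pow_graeffe hn
  have hn1 : (1 : ℝ) ≤ n := by exact_mod_cast Nat.one_le_iff_ne_zero.2 hn
  have e : 2 ^ (j + 5) = 2 * (16 * 2 ^ j) := by rw [pow_add]; ring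
  rw [hj, e, pow_mul]
  calc (x ^ 2) ^ (16 * 2 ^ j) ≤ (8 / 9) ^ (16 * 2 ^ j) := pow_le_pow_left₀ (sq_nonneg _) hx _
    _ = ((8 / 9) ^ 16) ^ 2 ^ j := pow_mul _ _ _
    _ ≤ ((1 / 2) ^ 2) ^ 2 ^ j := pow_le_pow_left₀ (by norm_num) (by norm_num) _
    _ = 1 / (2 ^ 2 ^ j) ^ 2 := by rw [← pow_mul, mul_comm, pow_mul, one_div_pow, one_div_pow]
    _ ≤ 1 / (2 * n) ^ 2 := by gcongr
    _ = _ := by ring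

/-! ### Approximations and loops -/

lemma exists_two_zpow_neg_lt {δ : ℝ} (hδ : 0 < δ) : ∃ j : ℕ, (2 : ℝ) ^ (-((2 ^ j : ℕ) : ℤ)) < δ := by
  obtain ⟨j, hj⟩ := exists_pow_lt_of_lt_one hδ (by norm_num : (1 / 2 : ℝ) < 1)
  refine ⟨j, lt_of_le_of_lt ?_ hj⟩
  rw [zpow_neg, zpow_natCast, one_div, inv_pow]
  exact inv_anti₀ (by positivity) (pow_le_pow_right₀ one_le_two Nat.lt_two_pow_self.le)

lemma exists_int_div_close (L : ℤ) (a : ℝ) :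
    ∃ u : ℤ, |a - u / (2 : ℝ) ^ (L + 1)| ≤ (2 : ℝ) ^ (-(L + 1)) / 2 := by
  have hp : (0 : ℝ) < 2 ^ (L + 1) := by positivity
  refine ⟨round (a * 2 ^ (L + 1)), ?_⟩
  have h := abs_sub_round (a * (2 : ℝ) ^ (L + 1))
  have e : a - round (a * (2 : ℝ) ^ (L + 1)) / (2 : ℝ) ^ (L + 1) =
      (a * 2 ^ (L + 1) - round (a * (2 : ℝ) ^ (L + 1))) / 2 ^ (L + 1) := by
    field_simp
  rw [e, abs_div, abs_of_pos hp, zpow_neg, div_le_iff₀ hp]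
  calc _ ≤ 1 / 2 := h
    _ = _ := by field_simp

/-- Rounding each coordinate costs at most a quarter of 2^(-L). That only half of the admissible
error is used leaves room for the perturbation in `NewtonIterateOutcome.ne_none`. -/
lemma exists_isDyadic_close (L : ℤ) (a : ℂ) :
    ∃ a', IsDyadic L a' ∧ ‖a - a'‖ ≤ (2 : ℝ) ^ (-L) / 2 := by
  obtain ⟨u, hu⟩ := exists_int_div_close L a.re
  obtain ⟨v, hv⟩ := exists_int_div_close L a.im
  refine ⟨_, ⟨u, v, rfl⟩, (Complex.norm_le_abs_re_add_abs_im _).trans ?_⟩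
  rw [Complex.sub_re, Complex.sub_im]
  refine (add_le_add hu hv).trans (le_of_eq ?_)
  rw [neg_add, zpow_add₀ two_ne_zero, zpow_neg_one]
  ring

lemma exists_isApprox (L : ℤ) (a : ℂ) : ∃ a', IsApprox L a a' := by
  obtain ⟨a', h1, h2⟩ := exists_isDyadic_close L a
  exact ⟨a', h1, h2.trans_lt (half_lt_self (by positivity))⟩

lemma exists_isRealApprox (L : ℤ) (a : ℝ) : ∃ a', IsRealApprox L a a' := by
  obtain ⟨u, hu⟩ := exists_int_div_close L a
  refine ⟨_, ⟨u, rfl⟩, hu.trans_lt ?_⟩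
  refine (half_lt_self (by positivity)).trans_le ?_
  exact zpow_le_zpow_right₀ one_le_two (by lia)

lemma exists_of_loopResult_eq_some {α : Type} {d : ℕ → Option α} {v : α}
    (h : loopResult d = some v) : ∃ j, d j = some v := by
  unfold loopResult at h
  split_ifs at h
  exact ⟨_, h⟩

lemma loopResult_ne_none {α : Type} {d : ℕ → Option α} {j : ℕ} (h : (d j).isSome) :
    loopResult d ≠ none := by
  classical
  have hex : ∃ j, (d j).isSome := ⟨j, h⟩
  unfold loopResult
  rw [dif_pos hex]
  exact Option.isSome_iff_ne_none.1 (Nat.find_spec hex)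

/-! ### The soft comparison -/

/-- A sufficiently fine precision detects a gap between different values, and places equal positive
values within the factor 3/2 of each other. Positivity excludes comparing 0 with 0, where no
criterion ever applies. -/
lemma SoftCompareOutcome.ne_none {El Er : ℝ} (hl : 0 ≤ El) (hr : 0 < Er) :
    ¬ SoftCompareOutcome El Er none := by
  rintro ⟨l, r, hlr, ho⟩
  obtain ⟨δ, hδ, hδE⟩ : ∃ δ > 0, (El = Er ∧ δ ≤ Er) ∨ δ ≤ |El - Er| := by
    by_cases h : El = Er
    · exact ⟨Er, hr, Or.inl ⟨h, le_rfl⟩⟩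
    · exact ⟨_, abs_pos.2 (sub_ne_zero.2 h), Or.inr le_rfl⟩
  -- With ε the precision, the case of equality needs a margin of 10ε and the case of a gap 4ε.
  obtain ⟨j, hj⟩ := exists_two_zpow_neg_lt (show 0 < δ / 16 by linarith)
  refine loopResult_ne_none (j := j) ?_ ho.symm
  obtain ⟨⟨-, h1⟩, -, h2⟩ := hlr j
  have hε : (0 : ℝ) < 2 ^ (-((2 ^ j : ℕ) : ℤ)) := by positivity
  simp only [softCompareRound]
  set ε : ℝ := 2 ^ (-((2 ^ j : ℕ) : ℤ))
  rw [abs_lt] at h1 h2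
  rcases hδE with ⟨he, hδE⟩ | hδE
  · subst he
    split_ifs with c1 c2 c3
    · rfl
    · rfl
    · rfl
    · refine absurd ⟨?_, ?_, ?_⟩ c3
      · rw [max_eq_right (by linarith), max_eq_right (by linarith)]; linarith
      · rw [max_eq_right (by linarith), max_eq_right (by linarith)]; linarith
      · rw [max_eq_right (by linarith), max_eq_right (by linarith)]; linarith
  · rcases le_abs.1 hδE with h | h
    · rw [if_pos]
      · rfl
      · rw [max_eq_right (by linarith), max_eq_right (by linarith)]; linarith
    · rw [if_neg, if_pos]
      · rfl
      · rw [max_eq_right (by linarith), max_eq_right (by linarith)]; linarith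
      · rw [not_lt, max_eq_right (a := 0) (b := r j + ε) (by linarith)]
        exact max_le (by linarith) (by linarith)

lemma SoftCompareOutcome.exists (El Er : ℝ) : ∃ o, SoftCompareOutcome El Er o := by
  choose l hl using fun j : ℕ => exists_isRealApprox (2 ^ j : ℕ) El
  choose r hr using fun j : ℕ => exists_isRealApprox (2 ^ j : ℕ) Er
  exact ⟨_, l, r, fun j => ⟨hl j, hr j⟩, rfl⟩

/-- Applied with El = 4r(C)|F'(x)|, this shows F'(x) ≠ 0 as soon as the comparison does not answer
False. -/
lemma SoftCompareOutcome.pos {El Er : ℝ} (hr : 0 < Er) {a : SoftAnswer} (ha : a ≠ .no)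
    (h : SoftCompareOutcome El Er (some a)) : 0 < El := by
  obtain ⟨l, r, hlr, ho⟩ := h
  obtain ⟨j, hj⟩ := exists_of_loopResult_eq_some ho.symm
  obtain ⟨⟨-, h1⟩, -, h2⟩ := hlr j
  simp only [softCompareRound] at hj
  set ε : ℝ := 2 ^ (-((2 ^ j : ℕ) : ℤ))
  rw [abs_lt] at h1 h2
  have hrp : 0 < max 0 (r j + ε) := lt_max_of_lt_right (by linarith)
  have hfin : 0 < max 0 (l j - ε) → 0 < El := fun h => by
    rcases lt_max_iff.1 h with h | h
    · exact absurd h (lt_irrefl _)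
    · linarith
  split_ifs at hj with c1 c2 c3
  · exact hfin (hrp.trans c1)
  · exact absurd (Option.some.inj hj).symm ha
  · exact hfin (by linarith [c3.2.2])

/-! ### The Newton iterate -/

lemma NewtonIterateOutcome.exists (F : ℂ[X]) (ℓ : ℤ) (N k : ℕ) (x : ℂ) :
    ∃ o, NewtonIterateOutcome F ℓ N k x o := by
  choose a ha using fun j : ℕ => exists_isApprox (2 ^ j : ℕ) (F.eval x)
  choose b hb using fun j : ℕ => exists_isApprox (2 ^ j : ℕ) (F.derivative.eval x)
  by_cases h : ∃ j y, NewtonCertified (2 ^ j) ℓ N k x (a j) (b j) y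
  · obtain ⟨j, y, h⟩ := h
    exact ⟨some y, a, b, fun j => ⟨ha j, hb j⟩, Or.inl ⟨j, y, h, rfl⟩⟩
  · push Not at h
    exact ⟨none, a, b, fun j => ⟨ha j, hb j⟩, Or.inr ⟨h, rfl⟩⟩

/-- The map (u, v) ↦ x - k u/v is continuous where v ≠ 0. One half of the permitted error is spent
on rounding the exact iterate, the other half on this continuity. -/
lemma NewtonIterateOutcome.ne_none {F : ℂ[X]} {ℓ : ℤ} {N k : ℕ} {x : ℂ}
    (hx : F.derivative.eval x ≠ 0) : ¬ NewtonIterateOutcome F ℓ N k x none := by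
  rintro ⟨a, b, hab, ⟨_, _, _, h⟩ | ⟨h, -⟩⟩
  · cases h
  set p : ℤ := 6 - ℓ + Nat.log 2 N with hp
  set t := x - k * (F.eval x / F.derivative.eval x) with ht
  obtain ⟨y, hy1, hy2⟩ := exists_isDyadic_close p t
  have hpos : (0 : ℝ) < 2 ^ (-p) / 2 := by positivity
  have hc : ContinuousAt (fun q : ℂ × ℂ => x - k * (q.1 / q.2))
      (F.eval x, F.derivative.eval x) := by
    refine continuousAt_const.sub (continuousAt_const.mul ?_)
    exact continuousAt_fst.div continuousAt_snd hx
  have hne : ∀ᶠ q : ℂ × ℂ in nhds (F.eval x, F.derivative.eval x), q.2 ≠ 0 :=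
    continuousAt_snd.eventually_ne hx
  obtain ⟨δ, hδ, hδ'⟩ := Metric.eventually_nhds_iff.1
    ((Metric.continuousAt_iff'.1 hc _ hpos).and hne)
  -- A compatible value is within 2^(-L) of the approximation, which is within 2^(-L) of the exact
  -- value; hence δ/2.
  obtain ⟨j, hj⟩ := exists_two_zpow_neg_lt (half_pos hδ)
  refine h j y fun u v hu hv => ?_
  have hq : dist (u, v) (F.eval x, F.derivative.eval x) < δ := by
    obtain ⟨⟨-, h1⟩, -, h2⟩ := hab j
    rw [Prod.dist_eq, max_lt_iff]
    constructor
    · calc dist u (F.eval x) ≤ dist u (a j) + dist (a j) (F.eval x) := dist_triangle _ _ _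
        _ < δ := by
          rw [dist_eq_norm, dist_comm, dist_eq_norm]
          linarith
    · calc dist v (F.derivative.eval x) ≤ dist v (b j) + dist (b j) (F.derivative.eval x) :=
            dist_triangle _ _ _
        _ < δ := by
          rw [dist_eq_norm, dist_comm, dist_eq_norm]
          linarith
  obtain ⟨h3, h4⟩ := hδ' hq
  refine ⟨h4, hy1, ?_⟩
  rw [dist_eq_norm] at h3
  calc ‖x - k * (u / v) - y‖ ≤ ‖x - k * (u / v) - t‖ + ‖t - y‖ := norm_sub_le_norm_sub_add_norm_sub _ _ _
    _ < 2 ^ (-p) := by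
      simp only at h3
      linarith

/-! ### The soft version of Pellet's test -/

section Pellet

variable {n k L : ℕ} {f : ℕ → ℂ} {g : ℕ → ℂ}

lemma pelletRound_bounds
    (h : ∀ i ≤ n, ‖g i - f i‖ < (2 : ℝ) ^ (-((L : ℤ) + Nat.clog 2 (n + 1)))) :
    ∀ i ≤ n, max 0 (‖f i‖ - (2 : ℝ) ^ (-((L : ℤ) + Nat.clog 2 (n + 1)))) ≤ ‖g i‖ ∧
      ‖g i‖ ≤ ‖f i‖ + (2 : ℝ) ^ (-((L : ℤ) + Nat.clog 2 (n + 1))) := by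
  intro i hi
  have h1 := norm_sub_norm_le (g i) (f i)
  have h2 := norm_sub_norm_le (f i) (g i)
  rw [norm_sub_rev] at h2
  have h3 := h i hi
  exact ⟨max_le (norm_nonneg _) (by linarith), by linarith⟩

lemma pelletRound_true (hk : k ≤ n)
    (h : ∀ i ≤ n, ‖g i - f i‖ < (2 : ℝ) ^ (-((L : ℤ) + Nat.clog 2 (n + 1))))
    (ht : pelletRound n k L f = some true) :
    ∑ i ∈ (Finset.range (n + 1)).erase k, ‖g i‖ < ‖g k‖ := by
  have hb := pelletRound_bounds h
  simp only [pelletRound] at ht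
  split_ifs at ht with c1 <;> try simp at ht
  have h1 : ∑ i ∈ (Finset.range (n + 1)).erase k, ‖g i‖ ≤
      ∑ i ∈ (Finset.range (n + 1)).erase k,
        (‖f i‖ + (2 : ℝ) ^ (-((L : ℤ) + Nat.clog 2 (n + 1)))) :=
    Finset.sum_le_sum fun i hi =>
      (hb i (Nat.lt_succ_iff.1 (Finset.mem_range.1 (Finset.mem_of_mem_erase hi)))).2
  linarith [(hb k hk).1]

/-- Both failing criteria lead to the same weak inequality, and its factor 2/3 is the one that
`coeff_dominates` excludes. -/
lemma pelletRound_false (hk : k ≤ n)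
    (h : ∀ i ≤ n, ‖g i - f i‖ < (2 : ℝ) ^ (-((L : ℤ) + Nat.clog 2 (n + 1))))
    (ht : pelletRound n k L f = some false) :
    2 / 3 * ‖g k‖ ≤ ∑ i ∈ (Finset.range (n + 1)).erase k, ‖g i‖ := by
  have hb := pelletRound_bounds h
  have h1 : ∑ i ∈ (Finset.range (n + 1)).erase k,
        max 0 (‖f i‖ - (2 : ℝ) ^ (-((L : ℤ) + Nat.clog 2 (n + 1)))) ≤
      ∑ i ∈ (Finset.range (n + 1)).erase k, ‖g i‖ :=
    Finset.sum_le_sum fun i hi =>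
      (hb i (Nat.lt_succ_iff.1 (Finset.mem_range.1 (Finset.mem_of_mem_erase hi)))).1
  have h2 := (hb k hk).2
  have h3 := norm_nonneg (g k)
  simp only [pelletRound] at ht
  split_ifs at ht with c1 c2 c3
  · simp at ht
  · linarith
  · linarith [c3.1]

/-- Each bound is off by at most 2ε, in total by 2(n + 1)ε. If this is less than the gap between the
two sides, a strict criterion applies; if the sides agree and are large in comparison, the last
criterion does. -/
lemma pelletRound_isSome (hk : k ≤ n)
    (h : ∀ i ≤ n, ‖g i - f i‖ < (2 : ℝ) ^ (-((L : ℤ) + Nat.clog 2 (n + 1)))) {A B : ℝ}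
    (hA : ∑ i ∈ (Finset.range (n + 1)).erase k, ‖g i‖ = A) (hB : ‖g k‖ = B)
    (hL : (A = B ∧ 2 * (n + 1) * (2 : ℝ) ^ (-(L : ℤ)) ≤ A / 3) ∨
      2 * (n + 1) * (2 : ℝ) ^ (-(L : ℤ)) < |B - A|) :
    (pelletRound n k L f).isSome := by
  have hε : (2 : ℝ) ^ (-((L : ℤ) + Nat.clog 2 (n + 1))) ≤ (2 : ℝ) ^ (-(L : ℤ)) :=
    zpow_le_zpow_right₀ one_le_two (by lia)
  simp only [pelletRound]
  have hε0 : (0 : ℝ) < (2 : ℝ) ^ (-((L : ℤ) + Nat.clog 2 (n + 1))) := by positivity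
  set ε : ℝ := (2 : ℝ) ^ (-((L : ℤ) + Nat.clog 2 (n + 1)))
  set others := (Finset.range (n + 1)).erase k with hothers
  have hkr : k ∈ Finset.range (n + 1) := Finset.mem_range.2 (Nat.lt_succ_of_le hk)
  have hcard : (others.card : ℝ) = n := by
    rw [hothers, Finset.card_erase_of_mem hkr, Finset.card_range, Nat.add_sub_cancel]
  have hb : ∀ i ≤ n, ‖g i‖ - 2 * ε ≤ max 0 (‖f i‖ - ε) ∧ ‖f i‖ + ε ≤ ‖g i‖ + 2 * ε := by
    intro i hi
    have h1 := norm_sub_norm_le (g i) (f i)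
    have h2 := norm_sub_norm_le (f i) (g i)
    rw [norm_sub_rev] at h2
    have h3 := h i hi
    exact ⟨le_max_of_le_right (by linarith), by linarith⟩
  have hmem : ∀ i ∈ others, i ≤ n := fun i hi =>
    Nat.lt_succ_iff.1 (Finset.mem_range.1 (Finset.mem_of_mem_erase hi))
  have h1 : A - 2 * ε * n ≤ ∑ i ∈ others, max 0 (‖f i‖ - ε) := by
    rw [← hA, ← hcard, mul_comm (2 * ε), ← nsmul_eq_mul, ← Finset.sum_const,
      ← Finset.sum_sub_distrib]
    exact Finset.sum_le_sum fun i hi => (hb i (hmem i hi)).1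
  have h2 : ∑ i ∈ others, (‖f i‖ + ε) ≤ A + 2 * ε * n := by
    rw [← hA, ← hcard, mul_comm (2 * ε), ← nsmul_eq_mul, ← Finset.sum_const,
      ← Finset.sum_add_distrib]
    exact Finset.sum_le_sum fun i hi => (hb i (hmem i hi)).2
  obtain ⟨h3, h4⟩ := hb k hk
  rw [hB] at h3 h4
  have hη : 2 * ε * n + 2 * ε ≤ 2 * (n + 1) * (2 : ℝ) ^ (-(L : ℤ)) := by
    have : (0 : ℝ) ≤ n := n.cast_nonneg
    nlinarith
  have hn : 0 ≤ 2 * ε * n := by positivity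
  split_ifs with c1 c2 c3
  · rfl
  · rfl
  · rfl
  · exfalso
    rcases hL with ⟨he, hL⟩ | hL
    · exact c3 ⟨by linarith, by linarith⟩
    · rcases lt_abs.1 hL with h' | h' <;> linarith

end Pellet

lemma PelletOutcome.exists (n : ℕ) (G : ℂ[X]) (k : ℕ) : ∃ o, PelletOutcome n G k o := by
  choose f hf using fun j i : ℕ =>
    exists_isApprox ((2 ^ j : ℕ) + Nat.clog 2 (n + 1)) (G.coeff i)
  exact ⟨_, f, fun j i _ => hf j i, rfl⟩

/-- The non-zero coefficient prevents both sides of the comparison from vanishing, the only case in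
which no precision is enough. -/
lemma PelletOutcome.ne_none {n k : ℕ} {G : ℂ[X]} (hk : k ≤ n) (hG : ∃ i ≤ n, G.coeff i ≠ 0) :
    ¬ PelletOutcome n G k none := by
  rintro ⟨f, hf, ho⟩
  set A := ∑ i ∈ (Finset.range (n + 1)).erase k, ‖G.coeff i‖ with hA
  set B := ‖G.coeff k‖ with hB
  have hA0 : 0 ≤ A := Finset.sum_nonneg fun _ _ => norm_nonneg _
  have hpos : 0 < A + B := by
    obtain ⟨i, hi, hne⟩ := hG
    rw [hA, hB, add_comm, Finset.add_sum_erase _ (fun i => ‖G.coeff i‖)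
      (Finset.mem_range.2 (Nat.lt_succ_of_le hk))]
    exact Finset.sum_pos' (fun _ _ => norm_nonneg _)
      ⟨i, Finset.mem_range.2 (Nat.lt_succ_of_le hi), norm_pos_iff.2 hne⟩
  obtain ⟨δ, hδ, hδE⟩ : ∃ δ > 0, (A = B ∧ δ ≤ A / 3) ∨ δ ≤ |B - A| := by
    by_cases h : A = B
    · exact ⟨A / 3, by linarith, Or.inl ⟨h, le_rfl⟩⟩
    · exact ⟨_, abs_pos.2 (sub_ne_zero.2 (Ne.symm h)), Or.inr le_rfl⟩
  have hn : (0 : ℝ) < 2 * (n + 1) := by positivity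
  obtain ⟨j, hj⟩ := exists_two_zpow_neg_lt (div_pos hδ hn)
  rw [lt_div_iff₀ hn, mul_comm] at hj
  refine loopResult_ne_none (j := j) ?_ ho.symm
  refine pelletRound_isSome (g := G.coeff) hk (fun i hi => (hf j i hi).2) hA.symm hB.symm ?_
  rcases hδE with ⟨h1, h2⟩ | h
  · exact Or.inl ⟨h1, hj.le.trans h2⟩
  · exact Or.inr (hj.trans_le h)

lemma PelletOutcome.of_true {n k : ℕ} {G : ℂ[X]} (hk : k ≤ n)
    (h : PelletOutcome n G k (some true)) :
    ∑ i ∈ (Finset.range (n + 1)).erase k, ‖G.coeff i‖ < ‖G.coeff k‖ := by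
  obtain ⟨f, hf, ho⟩ := h
  obtain ⟨j, hj⟩ := exists_of_loopResult_eq_some ho.symm
  exact pelletRound_true (g := G.coeff) hk (fun i hi => (hf j i hi).2) hj

lemma PelletOutcome.of_false {n k : ℕ} {G : ℂ[X]} (hk : k ≤ n)
    (h : PelletOutcome n G k (some false)) :
    2 / 3 * ‖G.coeff k‖ ≤ ∑ i ∈ (Finset.range (n + 1)).erase k, ‖G.coeff i‖ := by
  obtain ⟨f, hf, ho⟩ := h
  obtain ⟨j, hj⟩ := exists_of_loopResult_eq_some ho.symm
  exact pelletRound_false (g := G.coeff) hk (fun i hi => (hf j i hi).2) hj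

/-! ### The counting test -/

section Count

variable {F : ℂ[X]} {D : Disk}

lemma card_roots_eq (F : ℂ[X]) : Multiset.card F.roots = F.natDegree :=
  (IsAlgClosed.splits F).natDegree_eq_card_roots.symm

/-- The roots of the iterated Graeffe transform of `F_Δ`. -/
noncomputable def graeffeRoots (F : ℂ[X]) (D : Disk) : Multiset ℂ :=
  F.roots.map fun z => ((z - D.center) / D.radius) ^ 2 ^ graeffeCount F.natDegree

lemma card_graeffeRoots (F : ℂ[X]) (D : Disk) : Multiset.card (graeffeRoots F D) = F.natDegree := by
  rw [graeffeRoots, Multiset.card_map, card_roots_eq]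

lemma exists_graeffe_eq (hF : F ≠ 0) (hr : 0 < D.radius) :
    ∃ c : ℂ, c ≠ 0 ∧
      (graeffe F.natDegree)^[graeffeCount F.natDegree] (shiftScale F D) =
        polyOfRoots c (graeffeRoots F D) := by
  have hr' : (D.radius : ℂ) ≠ 0 := by exact_mod_cast hr.ne'
  have hc : F.leadingCoeff * (D.radius : ℂ) ^ Multiset.card F.roots ≠ 0 :=
    mul_ne_zero (leadingCoeff_ne_zero.2 hF) (pow_ne_zero _ hr')
  refine ⟨_, pow_ne_zero (2 ^ graeffeCount F.natDegree) hc, ?_⟩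
  have h := graeffe_iterate_polyOfRoots hc (F.roots.map fun z => (z - D.center) / D.radius)
    (graeffeCount F.natDegree)
  rw [Multiset.card_map, card_roots_eq] at h
  rw [shiftScale_eq F D hr.ne', card_roots_eq, h, graeffeRoots, Multiset.map_map]
  rfl

lemma norm_graeffeRoot (hr : 0 < D.radius) (z : ℂ) (M : ℕ) :
    ‖((z - D.center) / D.radius) ^ M‖ = (dist z D.center / D.radius) ^ M := by
  rw [norm_pow, norm_div, dist_eq_norm, Complex.norm_real, Real.norm_of_nonneg hr.le]

open scoped Classical in
lemma numRoots_eq_card_filter (hr : 0 < D.radius) :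
    numRoots F D.toSet = Multiset.card ((graeffeRoots F D).filter (‖·‖ < 1)) := by
  rw [graeffeRoots, Multiset.filter_map, Multiset.card_map, numRoots, rootsIn]
  congr 1
  refine Multiset.filter_congr fun z _ => ?_
  simp only [Function.comp_apply]
  rw [norm_graeffeRoot hr, pow_lt_one_iff_of_nonneg (by positivity) (by positivity),
    div_lt_one hr, Disk.toSet, Metric.mem_ball]

lemma CountOutcome.exists (F : ℂ[X]) (D : Disk) : ∃ o, CountOutcome F D o := by
  choose t ht using fun k => PelletOutcome.exists F.natDegree
    ((graeffe F.natDegree)^[graeffeCount F.natDegree] (shiftScale F D)) k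
  by_cases h : ∃ k ≤ F.natDegree, t k = none
  · exact ⟨none, t, fun k _ => ht k, Or.inl ⟨h, rfl⟩⟩
  · push Not at h
    by_cases h2 : ∃ k ≤ F.natDegree, t k = some true
    · obtain ⟨k, hk, hk2⟩ := h2
      exact ⟨some k, t, fun k _ => ht k, Or.inr ⟨h, Or.inl ⟨k, hk, hk2, rfl⟩⟩⟩
    · push Not at h2
      exact ⟨some (-1), t, fun k _ => ht k, Or.inr ⟨h, Or.inr ⟨h2, rfl⟩⟩⟩

lemma CountOutcome.ne_none (hF : F ≠ 0) (hr : 0 < D.radius) : ¬ CountOutcome F D none := by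
  rintro ⟨t, ht, ⟨⟨k, hk, h⟩, -⟩ | ⟨-, ⟨k, -, -, h⟩ | ⟨-, h⟩⟩⟩
  · have := ht k hk
    rw [h] at this
    obtain ⟨c, hc, hG⟩ := exists_graeffe_eq hF hr
    refine PelletOutcome.ne_none hk ⟨F.natDegree, le_rfl, ?_⟩ this
    rw [hG, ← card_graeffeRoots F D, ← natDegree_polyOfRoots hc, coeff_natDegree,
      leadingCoeff_ne_zero]
    intro h0
    rw [polyOfRoots, mul_eq_zero, C_eq_zero] at h0
    exact (monic_multiset_prod_of_monic _ _ fun z _ => monic_X_sub_C z).ne_zero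
      (h0.resolve_left hc)
  · cases h
  · cases h

/-- If `T_*(Δ) = k ≥ 0`, then `Δ` contains exactly `k` roots. -/
lemma CountOutcome.numRoots_eq (hF : F ≠ 0) (hr : 0 < D.radius) {k : ℕ}
    (h : CountOutcome F D (some (k : ℤ))) : numRoots F D.toSet = k := by
  obtain ⟨t, ht, ⟨-, h⟩ | ⟨-, ⟨k', hk, hk2, h⟩ | ⟨-, h⟩⟩⟩ := h
  · cases h
  · have hkk : k = k' := by exact_mod_cast Option.some.inj h
    subst hkk
    have := ht k hk
    rw [hk2] at this
    have h1 := this.of_true hk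
    obtain ⟨c, hc, hG⟩ := exists_graeffe_eq hF hr
    rw [hG, ← card_graeffeRoots F D] at h1
    rw [numRoots_eq_card_filter hr]
    exact pellet hc _ (by rwa [card_graeffeRoots]) h1
  · have := Option.some.inj h; lia

open scoped Classical in
lemma rootsIn_mono {R R' : Set ℂ} (h : R ⊆ R') : rootsIn F R ≤ rootsIn F R' :=
  Multiset.monotone_filter_right F.roots fun _ hz => h hz

lemma numRoots_mono {R R' : Set ℂ} (h : R ⊆ R') : numRoots F R ≤ numRoots F R' :=
  Multiset.card_le_card (rootsIn_mono h)

open scoped Classical in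
lemma mem_rootsIn {R : Set ℂ} {z : ℂ} : z ∈ rootsIn F R ↔ z ∈ F.roots ∧ z ∈ R :=
  Multiset.mem_filter

lemma rootsIn_eq_of_numRoots_le {R R' : Set ℂ} (h : R ⊆ R') (hn : numRoots F R' ≤ numRoots F R) :
    rootsIn F R = rootsIn F R' :=
  Multiset.eq_of_le_of_card_le (rootsIn_mono h) hn

lemma Disk.toSet_scale_subset {s t : ℝ} (hr : 0 ≤ D.radius) (h : s ≤ t) :
    (D.scale s).toSet ⊆ (D.scale t).toSet :=
  Metric.ball_subset_ball (mul_le_mul_of_nonneg_right h hr)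

lemma sq_two_sqrt_two_div_three : (2 * √2 / 3) ^ 2 = (8 / 9 : ℝ) := by
  rw [div_pow, mul_pow, Real.sq_sqrt zero_le_two]; norm_num

lemma two_sqrt_two_div_three_lt_one : 2 * √2 / 3 < 1 := by
  have := sq_two_sqrt_two_div_three
  have h0 := Real.sqrt_nonneg 2
  nlinarith

/-- If both `(2√2/3)Δ` and `(4/3)Δ` contain exactly `k` roots, then `T_*(Δ) = k`. -/
lemma CountOutcome.eq_of_numRoots (hn : F.natDegree ≠ 0) (hr : 0 < D.radius) {k : ℕ}
    (h1 : numRoots F (D.scale (2 * √2 / 3)).toSet = k)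
    (h2 : numRoots F (D.scale (4 / 3)).toSet = k) {c : ℤ} (h : CountOutcome F D (some c)) :
    c = k := by
  classical
  have hF : F ≠ 0 := fun h0 => hn (by rw [h0, natDegree_zero])
  have hlt := two_sqrt_two_div_three_lt_one
  have hpos : 0 < 2 * √2 / 3 := by positivity
  set x := 2 * √2 / 3 with hx
  have hkn : k ≤ F.natDegree := by
    rw [← h1, ← card_roots_eq]; exact Multiset.card_le_card (Multiset.filter_le _ _)
  have hsub := Disk.toSet_scale_subset (D := D) hr.le (show x ≤ 4 / 3 by linarith)
  have heq := rootsIn_eq_of_numRoots_le (F := F) hsub (by rw [h1, h2])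
  have hM : 2 ^ graeffeCount F.natDegree ≠ 0 := by positivity
  have hxinv : x⁻¹ ≤ 4 / 3 := by
    rw [inv_le_comm₀ hpos (by norm_num)]
    have := sq_two_sqrt_two_div_three
    nlinarith
  -- Equal counts leave no root in the annulus, and x⁻¹ ≤ 4/3. So after the iteration the roots have
  -- absolute value at most ρ or at least ρ⁻¹, where ρ is the corresponding power of x.
  have hdich : ∀ z ∈ F.roots,
      (z ∈ (D.scale x).toSet ∧ (dist z D.center / D.radius) ^ 2 ^ graeffeCount F.natDegree ≤
        x ^ 2 ^ graeffeCount F.natDegree) ∨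
      (z ∉ (D.scale x).toSet ∧ (x ^ 2 ^ graeffeCount F.natDegree)⁻¹ ≤
        (dist z D.center / D.radius) ^ 2 ^ graeffeCount F.natDegree) := by
    intro z hz
    by_cases hzx : z ∈ (D.scale x).toSet
    · refine Or.inl ⟨hzx, pow_le_pow_left₀ (by positivity) ?_ _⟩
      rw [div_le_iff₀ hr]
      exact (Metric.mem_ball.1 hzx).le
    · refine Or.inr ⟨hzx, ?_⟩
      have : z ∉ (D.scale (4 / 3)).toSet := fun hz2 => hzx
        (mem_rootsIn.1 (heq.symm ▸ mem_rootsIn.2 ⟨hz, hz2⟩)).2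
      rw [Disk.toSet, Metric.mem_ball, not_lt] at this
      rw [← inv_pow]
      refine pow_le_pow_left₀ (by positivity) (hxinv.trans ?_) _
      rw [le_div_iff₀ hr]
      exact this
  have hsmall : x ^ 2 ^ graeffeCount F.natDegree < 1 := pow_lt_one₀ hpos.le hlt hM
  have hspos : 0 < x ^ 2 ^ graeffeCount F.natDegree := pow_pos hpos _
  obtain ⟨c', hc', hG⟩ := exists_graeffe_eq hF hr
  have hdom := coeff_dominates hc' (s := graeffeRoots F D) (by rwa [card_graeffeRoots])
    (ρ := x ^ 2 ^ graeffeCount F.natDegree) hspos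
    (by rw [card_graeffeRoots]; exact graeffe_contraction hn sq_two_sqrt_two_div_three.le)
    (by
      intro w hw
      obtain ⟨z, hz, rfl⟩ := Multiset.mem_map.1 hw
      rw [norm_graeffeRoot hr]
      exact (hdich z hz).imp And.right And.right) (k := k)
    (by
      rw [graeffeRoots, Multiset.filter_map, Multiset.card_map, ← h1, numRoots, rootsIn]
      congr 1
      refine Multiset.filter_congr fun z hz => ?_
      simp only [Function.comp_apply]
      rw [norm_graeffeRoot hr]
      rcases hdich z hz with h | h
      · exact ⟨fun _ => h.1, fun _ => h.2⟩
      · refine ⟨fun h' => ?_, fun h' => absurd h' h.1⟩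
        have := one_lt_inv₀ hspos |>.2 hsmall
        linarith [h.2])
  rw [card_graeffeRoots, ← hG] at hdom
  have hD : numRoots F D.toSet = k := by
    have e : (D.scale 1).toSet = D.toSet := by simp [Disk.scale, Disk.toSet]
    refine le_antisymm ?_ ?_
    · rw [← h2, ← e]
      exact numRoots_mono (Disk.toSet_scale_subset hr.le (by norm_num))
    · rw [← h1, ← e]
      exact numRoots_mono (Disk.toSet_scale_subset hr.le hlt.le)
  have hcopy := h
  obtain ⟨t, ht, ⟨-, h⟩ | ⟨hnn, ⟨k', hk', hk2, h⟩ | ⟨hnt, h⟩⟩⟩ := h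
  · cases h
  · obtain rfl := Option.some.inj h
    rw [← hD, hcopy.numRoots_eq hF hr]
  -- The answer -1 is impossible: the test for the true k neither runs forever nor fails, since
  -- failing would contradict the dominance of its coefficient.
  · exfalso
    have := ht k hkn
    rcases htk : t k with _ | _ | _
    · exact hnn k hkn htk
    · rw [htk] at this
      exact absurd hdom (not_lt.2 (this.of_false hkn))
    · exact hnt k hkn htk

end Count

/-! ### Squares of a grid -/

/-- The distance of two points in the max-norm. -/
def maxDist (z w : ℂ) : ℝ := max |z.re - w.re| |z.im - w.im|

lemma maxDist_le_dist (z w : ℂ) : maxDist z w ≤ dist z w := by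
  rw [dist_eq_norm, maxDist, ← Complex.sub_re, ← Complex.sub_im]
  exact max_le (Complex.abs_re_le_norm _) (Complex.abs_im_le_norm _)

lemma maxDist_comm (z w : ℂ) : maxDist z w = maxDist w z := by
  rw [maxDist, maxDist, abs_sub_comm, abs_sub_comm z.im]

lemma maxDist_triangle (x y z : ℂ) : maxDist x z ≤ maxDist x y + maxDist y z := by
  unfold maxDist
  refine max_le ?_ ?_
  · exact (abs_sub_le _ y.re _).trans (add_le_add (le_max_left _ _) (le_max_left _ _))
  · exact (abs_sub_le _ y.im _).trans (add_le_add (le_max_right _ _) (le_max_right _ _))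

lemma dist_le_sqrt_two_mul_maxDist (z w : ℂ) : dist z w ≤ √2 * maxDist z w := by
  rw [dist_eq_norm, maxDist, ← Complex.sub_re, ← Complex.sub_im]
  exact Complex.norm_le_sqrt_two_mul_max _

namespace Square

lemma width_pos (B : Square) : 0 < B.width := by unfold width; positivity

/-- The interior of the square `2B`. -/
def openDouble (B : Square) : Set ℂ := {z | maxDist z B.center < B.width}

lemma openDouble_subset_double (B : Square) : B.openDouble ⊆ B.double := fun _ hz =>
  ⟨(le_max_left _ _).trans hz.le, (le_max_right _ _).trans hz.le⟩

lemma mem_openDouble {B : Square} {z : ℂ} : z ∈ B.openDouble ↔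
    B.corner.re - B.width / 2 < z.re ∧ z.re < B.corner.re + 3 / 2 * B.width ∧
    B.corner.im - B.width / 2 < z.im ∧ z.im < B.corner.im + 3 / 2 * B.width := by
  unfold openDouble maxDist
  simp only [Set.mem_ofPred_eq, max_lt_iff, center, abs_lt]
  constructor
  · rintro ⟨⟨_, _⟩, _, _⟩
    refine ⟨?_, ?_, ?_, ?_⟩ <;> linarith
  · rintro ⟨_, _, _, _⟩
    refine ⟨⟨?_, ?_⟩, ?_, ?_⟩ <;> linarith

lemma mem_toSet {B : Square} {z : ℂ} : z ∈ B.toSet ↔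
    B.corner.re ≤ z.re ∧ z.re ≤ B.corner.re + B.width ∧
    B.corner.im ≤ z.im ∧ z.im ≤ B.corner.im + B.width := by
  simp [toSet, and_assoc]

lemma corner_mem (B : Square) : B.corner ∈ B.toSet := by
  have := B.width_pos
  rw [mem_toSet]; refine ⟨?_, ?_, ?_, ?_⟩ <;> linarith

lemma toSet_eq (B : Square) : B.toSet =
    Set.Icc B.corner.re (B.corner.re + B.width) ×ℂ Set.Icc B.corner.im (B.corner.im + B.width) :=
  rfl

lemma isCompact_toSet (B : Square) : IsCompact B.toSet := by
  rw [toSet_eq]; exact isCompact_Icc.reProdIm isCompact_Icc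

lemma mem_interior_toSet {B : Square} {z : ℂ} : z ∈ interior B.toSet ↔
    B.corner.re < z.re ∧ z.re < B.corner.re + B.width ∧
    B.corner.im < z.im ∧ z.im < B.corner.im + B.width := by
  rw [toSet_eq, Complex.interior_reProdIm, interior_Icc, interior_Icc, Complex.mem_reProdIm]
  simp [and_assoc]

lemma convex_toSet (B : Square) : Convex ℝ B.toSet := by
  exact ((convex_Icc _ _).linear_preimage Complex.reLm).inter
    ((convex_Icc _ _).linear_preimage Complex.imLm)

/-- The sub-square with indices `p` and `q` of the grid that divides `B` into `2 ^ m × 2 ^ m`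
squares. -/
noncomputable def sub (B : Square) (m p q : ℕ) : Square :=
  ⟨⟨B.corner.re + p * (2 : ℝ) ^ (B.exp - m), B.corner.im + q * (2 : ℝ) ^ (B.exp - m)⟩, B.exp - m⟩

lemma mem_subdivide {B B' : Square} {m : ℕ} :
    B' ∈ B.subdivide m ↔ ∃ p q : ℕ, p < 2 ^ m ∧ q < 2 ^ m ∧ B' = B.sub m p q := by
  simp only [subdivide, Finset.mem_image, Finset.mem_product, Finset.mem_range, Prod.exists]
  constructor
  · rintro ⟨p, q, ⟨hp, hq⟩, rfl⟩; exact ⟨p, q, hp, hq, rfl⟩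
  · rintro ⟨p, q, hp, hq, rfl⟩; exact ⟨p, q, ⟨hp, hq⟩, rfl⟩

lemma exp_of_mem {B B' : Square} {m : ℕ} (h : B' ∈ B.subdivide m) : B'.exp = B.exp - m := by
  obtain ⟨p, q, -, -, rfl⟩ := mem_subdivide.1 h; rfl

lemma width_of_mem {B B' : Square} {m : ℕ} (h : B' ∈ B.subdivide m) :
    B'.width = (2 : ℝ) ^ (B.exp - m) := by
  rw [width, exp_of_mem h]

lemma two_pow_mul_zpow (e : ℤ) (m : ℕ) : (2 : ℝ) ^ m * 2 ^ (e - m) = 2 ^ e := by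
  rw [← zpow_natCast, ← zpow_add₀ two_ne_zero]; congr 1; ring

lemma two_pow_mul_width_of_mem {B B' : Square} {m : ℕ} (h : B' ∈ B.subdivide m) :
    2 ^ m * B'.width = B.width := by
  rw [width_of_mem h, two_pow_mul_zpow, width]

lemma subdivide_zero (B : Square) : B.subdivide 0 = {B} := by
  ext B'
  rw [mem_subdivide, Finset.mem_singleton]
  constructor
  · rintro ⟨p, q, hp, hq, rfl⟩
    obtain rfl : p = 0 := by simpa using hp
    obtain rfl : q = 0 := by simpa using hq
    simp [sub]
  · rintro rfl
    exact ⟨0, 0, by simp, by simp, by simp [sub]⟩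

lemma subdivide_trans {B B' B'' : Square} {m p : ℕ} (h : B' ∈ B.subdivide m)
    (h' : B'' ∈ B'.subdivide p) : B'' ∈ B.subdivide (m + p) := by
  obtain ⟨a, b, ha, hb, rfl⟩ := mem_subdivide.1 h
  obtain ⟨c, d, hc, hd, rfl⟩ := mem_subdivide.1 h'
  have key : ∀ {x y : ℕ}, x < 2 ^ m → y < 2 ^ p → x * 2 ^ p + y < 2 ^ (m + p) := by
    intro x y hx hy
    rw [pow_add]
    calc x * 2 ^ p + y < x * 2 ^ p + 2 ^ p := by lia
      _ = (x + 1) * 2 ^ p := by ring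
      _ ≤ 2 ^ m * 2 ^ p := Nat.mul_le_mul_right _ hx
  refine mem_subdivide.2 ⟨a * 2 ^ p + c, b * 2 ^ p + d, key ha hc, key hb hd, ?_⟩
  have e : B.exp - ((m + p : ℕ) : ℤ) = B.exp - m - p := by push_cast; ring
  have e2 := two_pow_mul_zpow (B.exp - m) p
  simp only [sub, e]
  congr 1
  apply Complex.ext
  · simp only; rw [← e2]; push_cast; ring
  · simp only; rw [← e2]; push_cast; ring

/-- The indices of a sub-square. -/
lemma exists_index {B B' : Square} {m : ℕ} (h : B' ∈ B.subdivide m) :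
    ∃ p q : ℕ, p < 2 ^ m ∧ q < 2 ^ m ∧ B' = B.sub m p q ∧
      B'.corner.re = B.corner.re + p * B'.width ∧ B'.corner.im = B.corner.im + q * B'.width ∧
      (p + 1) * B'.width ≤ B.width ∧ (q + 1) * B'.width ≤ B.width := by
  have hw := two_pow_mul_width_of_mem h
  have hw0 := B'.width_pos
  obtain ⟨p, q, hp, hq, rfl⟩ := mem_subdivide.1 h
  have key : ∀ {x : ℕ}, x < 2 ^ m → (x + 1 : ℝ) * (B.sub m p q).width ≤ B.width := by
    intro x hx
    rw [← hw]
    refine mul_le_mul_of_nonneg_right ?_ hw0.le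
    exact_mod_cast hx
  exact ⟨p, q, hp, hq, rfl, rfl, rfl, key hp, key hq⟩

lemma toSet_subset_of_mem {B B' : Square} {m : ℕ} (h : B' ∈ B.subdivide m) :
    B'.toSet ⊆ B.toSet := by
  obtain ⟨p, q, -, -, -, h1, h2, h3, h4⟩ := exists_index h
  have hw0 := B'.width_pos
  have hp : 0 ≤ p * B'.width := by positivity
  have hq : 0 ≤ q * B'.width := by positivity
  intro z hz
  rw [mem_toSet] at *
  refine ⟨?_, ?_, ?_, ?_⟩ <;> linarith

lemma openDouble_subset_of_mem {B B' : Square} {m : ℕ} (h : B' ∈ B.subdivide m) :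
    B'.openDouble ⊆ B.openDouble := by
  obtain ⟨p, q, -, -, -, h1, h2, h3, h4⟩ := exists_index h
  have hw0 := B'.width_pos
  have hp : 0 ≤ p * B'.width := by positivity
  have hq : 0 ≤ q * B'.width := by positivity
  intro z hz
  rw [mem_openDouble] at *
  refine ⟨?_, ?_, ?_, ?_⟩ <;> linarith

lemma exists_index_interval {h a x : ℝ} (hh : 0 < h) {N : ℕ} (hN : 0 < N) (h0 : a ≤ x)
    (h1 : x ≤ a + N * h) : ∃ p < N, a + p * h ≤ x ∧ x ≤ a + p * h + h := by
  -- At the right end point the floor would give the index N, so the last interval is taken there.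
  by_cases hx : x = a + N * h
  · refine ⟨N - 1, Nat.sub_lt hN one_pos, ?_⟩
    rw [hx, Nat.cast_pred hN]
    constructor <;> linarith
  · have hlt := lt_of_le_of_ne h1 hx
    have hnn : 0 ≤ (x - a) / h := div_nonneg (by linarith) hh.le
    have e1 : (x - a) / h * h = x - a := by field_simp
    refine ⟨⌊(x - a) / h⌋₊, ?_, ?_, ?_⟩
    · rw [Nat.floor_lt hnn, div_lt_iff₀ hh]; linarith
    · have := mul_le_mul_of_nonneg_right (Nat.floor_le hnn) hh.le
      linarith
    · have := mul_le_mul_of_nonneg_right (Nat.lt_floor_add_one ((x - a) / h)).le hh.le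
      linarith

lemma exists_mem_subdivide {B : Square} {z : ℂ} (hz : z ∈ B.toSet) (m : ℕ) :
    ∃ B' ∈ B.subdivide m, z ∈ B'.toSet := by
  rw [mem_toSet, width, ← two_pow_mul_zpow B.exp m] at hz
  have hh : (0 : ℝ) < 2 ^ (B.exp - m) := by positivity
  obtain ⟨p, hp, hp1, hp2⟩ := exists_index_interval hh (N := 2 ^ m) (by positivity) hz.1
    (by push_cast; exact hz.2.1)
  obtain ⟨q, hq, hq1, hq2⟩ := exists_index_interval hh (N := 2 ^ m) (by positivity) hz.2.2.1
    (by push_cast; exact hz.2.2.2)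
  exact ⟨B.sub m p q, mem_subdivide.2 ⟨p, q, hp, hq, rfl⟩, mem_toSet.2 ⟨hp1, hp2, hq1, hq2⟩⟩

/-- Integers at distance less than two differ by at most one. -/
lemma sub_mem_of_abs_sub_lt {h a : ℝ} (hh : 0 < h) {p q : ℕ}
    (hpq : |(a + p * h) - (a + q * h)| < 2 * h) :
    (a + p * h) - (a + q * h) = 0 ∨ (a + p * h) - (a + q * h) = h ∨
      (a + p * h) - (a + q * h) = -h := by
  have e : (a + p * h) - (a + q * h) = ((p - q : ℤ) : ℝ) * h := by push_cast; ring
  rw [e] at hpq ⊢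
  rw [abs_mul, abs_of_pos hh, mul_lt_mul_iff_left₀ hh] at hpq
  have h2 : |(p : ℤ) - q| < 2 := by exact_mod_cast hpq
  rw [abs_lt] at h2
  have : (p : ℤ) - q = 0 ∨ (p : ℤ) - q = 1 ∨ (p : ℤ) - q = -1 := by lia
  rcases this with h | h | h <;> rw [h] <;> simp

section SameGrid

variable {B₀ B B' : Square} {m : ℕ}

lemma width_eq_of_mem (h : B ∈ B₀.subdivide m) (h' : B' ∈ B₀.subdivide m) :
    B'.width = B.width := by
  rw [width_of_mem h, width_of_mem h']

lemma corner_sub (h : B ∈ B₀.subdivide m) (h' : B' ∈ B₀.subdivide m) :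
    (|B.corner.re - B'.corner.re| < 2 * B.width →
      B.corner.re - B'.corner.re = 0 ∨ B.corner.re - B'.corner.re = B.width ∨
      B.corner.re - B'.corner.re = -B.width) ∧
    (|B.corner.im - B'.corner.im| < 2 * B.width →
      B.corner.im - B'.corner.im = 0 ∨ B.corner.im - B'.corner.im = B.width ∨
      B.corner.im - B'.corner.im = -B.width) := by
  obtain ⟨p, q, -, -, -, h1, h2, -, -⟩ := exists_index h
  obtain ⟨p', q', -, -, -, h1', h2', -, -⟩ := exists_index h'
  rw [h1, h2, h1', h2', width_eq_of_mem h h']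
  exact ⟨sub_mem_of_abs_sub_lt B.width_pos, sub_mem_of_abs_sub_lt B.width_pos⟩

lemma eq_of_corner (h : B ∈ B₀.subdivide m) (h' : B' ∈ B₀.subdivide m)
    (hre : B.corner.re = B'.corner.re) (him : B.corner.im = B'.corner.im) : B = B' :=
  Square.ext (Complex.ext hre him) (by rw [exp_of_mem h, exp_of_mem h'])

/-- Distinct squares of a grid differ by at least the mesh in one coordinate. -/
lemma le_abs_corner_sub_of_ne (h : B ∈ B₀.subdivide m) (h' : B' ∈ B₀.subdivide m) (hne : B ≠ B') :
    B.width ≤ |B.corner.re - B'.corner.re| ∨ B.width ≤ |B.corner.im - B'.corner.im| := by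
  have hw := B.width_pos
  obtain ⟨c1, c2⟩ := corner_sub h h'
  by_contra! hlt
  have e1 : B.corner.re - B'.corner.re = 0 := by
    rcases c1 (by linarith) with h | h | h
    · exact h
    · rw [h, abs_of_pos hw] at hlt; linarith
    · rw [h, abs_neg, abs_of_pos hw] at hlt; linarith
  have e2 : B.corner.im - B'.corner.im = 0 := by
    rcases c2 (by linarith) with h | h | h
    · exact h
    · rw [h, abs_of_pos hw] at hlt; linarith
    · rw [h, abs_neg, abs_of_pos hw] at hlt; linarith
  exact hne (eq_of_corner h h' (by linarith) (by linarith))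

lemma disjoint_interior_of_ne (h : B ∈ B₀.subdivide m) (h' : B' ∈ B₀.subdivide m) (hne : B ≠ B') :
    Disjoint (interior B.toSet) (interior B'.toSet) := by
  rw [Set.disjoint_left]
  intro z hz hz'
  rw [mem_interior_toSet] at hz hz'
  rw [width_eq_of_mem h h'] at hz'
  rcases le_abs_corner_sub_of_ne h h' hne with h | h <;> rcases le_abs.1 h with h | h <;> linarith

/-- The centre of a square of a grid is at distance at least half the mesh from the others. -/
lemma half_width_le_of_ne (h : B ∈ B₀.subdivide m) (h' : B' ∈ B₀.subdivide m) (hne : B ≠ B')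
    {z : ℂ} (hz : z ∈ B'.toSet) : B.width / 2 ≤ maxDist B.center z := by
  rw [mem_toSet, width_eq_of_mem h h'] at hz
  rw [maxDist, le_max_iff]
  simp only [center]
  rcases le_abs_corner_sub_of_ne h h' hne with h | h
  · left; rcases le_abs.1 h with h | h
    · rw [le_abs]; left; linarith
    · rw [le_abs]; right; linarith
  · right; rcases le_abs.1 h with h | h
    · rw [le_abs]; left; linarith
    · rw [le_abs]; right; linarith

/-- The coordinatewise maximum of the two lower left corners is a common point. -/
lemma inter_nonempty_of_abs_sub_le (hw : B'.width = B.width)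
    (h1 : |B.corner.re - B'.corner.re| ≤ B.width) (h2 : |B.corner.im - B'.corner.im| ≤ B.width) :
    (B.toSet ∩ B'.toSet).Nonempty := by
  have := B.width_pos
  rw [abs_le] at h1 h2
  refine ⟨⟨max B.corner.re B'.corner.re, max B.corner.im B'.corner.im⟩, ?_, ?_⟩ <;>
    rw [mem_toSet] <;> simp only [hw] <;>
    refine ⟨by simp, max_le ?_ ?_, by simp, max_le ?_ ?_⟩ <;> linarith

lemma abs_corner_sub_le_of_lt (h : B ∈ B₀.subdivide m) (h' : B' ∈ B₀.subdivide m) :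
    (|B.corner.re - B'.corner.re| < 2 * B.width → |B.corner.re - B'.corner.re| ≤ B.width) ∧
    (|B.corner.im - B'.corner.im| < 2 * B.width → |B.corner.im - B'.corner.im| ≤ B.width) := by
  have hw := B.width_pos
  obtain ⟨c1, c2⟩ := corner_sub h h'
  constructor
  · intro hlt
    rcases c1 hlt with h | h | h <;> rw [h] <;> simp [abs_of_pos hw, hw.le]
  · intro hlt
    rcases c2 hlt with h | h | h <;> rw [h] <;> simp [abs_of_pos hw, hw.le]

/-- Squares of a grid that do not intersect are at distance at least the mesh. -/
lemma width_le_maxDist (h : B ∈ B₀.subdivide m) (h' : B' ∈ B₀.subdivide m)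
    (hd : ¬ (B.toSet ∩ B'.toSet).Nonempty) {z z' : ℂ} (hz : z ∈ B.toSet) (hz' : z' ∈ B'.toSet) :
    B.width ≤ maxDist z z' := by
  have hw := width_eq_of_mem h h'
  rw [mem_toSet] at hz hz'
  rw [hw] at hz'
  rw [maxDist, le_max_iff]
  by_contra! hlt
  obtain ⟨h1, h2⟩ := hlt
  rw [abs_lt] at h1 h2
  refine hd (inter_nonempty_of_abs_sub_le hw ?_ ?_)
  · refine (abs_corner_sub_le_of_lt h h').1 ?_
    rw [abs_lt]; constructor <;> linarith
  · refine (abs_corner_sub_le_of_lt h h').2 ?_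
    rw [abs_lt]; constructor <;> linarith

/-- A common interior point forces the corners to differ by less than two meshes, hence by at most
one. For the closed doubles a difference of two meshes could occur and the bound nine would fail, so
roots are located in open doubles throughout. -/
lemma abs_corner_sub_le_of_openDouble (h : B ∈ B₀.subdivide m) (h' : B' ∈ B₀.subdivide m) {z : ℂ}
    (hz : z ∈ B.openDouble) (hz' : z ∈ B'.openDouble) :
    |B.corner.re - B'.corner.re| ≤ B.width ∧ |B.corner.im - B'.corner.im| ≤ B.width := by
  rw [mem_openDouble] at hz hz'
  rw [width_eq_of_mem h h'] at hz'
  constructor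
  · refine (abs_corner_sub_le_of_lt h h').1 ?_
    rw [abs_lt]; constructor <;> linarith
  · refine (abs_corner_sub_le_of_lt h h').2 ?_
    rw [abs_lt]; constructor <;> linarith

/-- At most nine squares of a grid are adjacent to a given one. -/
lemma card_le_nine (S : Finset Square) (hS : S ⊆ B₀.subdivide m) (hB : B ∈ B₀.subdivide m)
    (hadj : ∀ B' ∈ S, |B.corner.re - B'.corner.re| ≤ B.width ∧
      |B.corner.im - B'.corner.im| ≤ B.width) : S.card ≤ 9 := by
  classical
  let T : Finset (ℝ × ℝ) := ({0, B.width, -B.width} : Finset ℝ) ×ˢ {0, B.width, -B.width}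
  have hT : T.card ≤ 9 := by
    rw [Finset.card_product]
    exact Nat.mul_le_mul Finset.card_le_three Finset.card_le_three
  -- The offset of the corners determines the square and has three possible values in each
  -- coordinate.
  refine le_trans (Finset.card_le_card_of_injOn
    (fun B' => (B.corner.re - B'.corner.re, B.corner.im - B'.corner.im)) ?_ ?_) hT
  · intro B' hB'
    have hw := B.width_pos
    obtain ⟨h1, h2⟩ := hadj B' hB'
    obtain ⟨c1, c2⟩ := corner_sub hB (hS hB')
    simp only [T, Finset.mem_coe, Finset.mem_product, Finset.mem_insert, Finset.mem_singleton]
    exact ⟨c1 (by linarith), c2 (by linarith)⟩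
  · intro B1 h1 B2 h2 he
    simp only [Prod.mk.injEq] at he
    exact eq_of_corner (hS h1) (hS h2) (by linarith) (by linarith)

end SameGrid

/-- Points of `2B` have distance at most `w(B)/2` from `B`. -/
lemma exists_mem_toSet_of_mem_openDouble {B : Square} {z : ℂ} (hz : z ∈ B.openDouble) :
    ∃ w ∈ B.toSet, maxDist z w < B.width / 2 := by
  have hw := B.width_pos
  rw [mem_openDouble] at hz
  refine ⟨⟨max B.corner.re (min z.re (B.corner.re + B.width)),
    max B.corner.im (min z.im (B.corner.im + B.width))⟩, ?_, ?_⟩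
  · rw [mem_toSet]
    refine ⟨le_max_left _ _, max_le (by linarith) (min_le_right _ _), le_max_left _ _,
      max_le (by linarith) (min_le_right _ _)⟩
  · rw [maxDist, max_lt_iff, abs_lt, abs_lt]
    simp only
    refine ⟨⟨?_, ?_⟩, ?_, ?_⟩
    · rw [lt_sub_iff_add_lt, ← lt_sub_iff_add_lt', max_lt_iff]
      exact ⟨by linarith, (min_le_left _ _).trans_lt (by linarith)⟩
    · rw [sub_lt_comm, lt_max_iff, lt_min_iff]
      right; constructor <;> linarith
    · rw [lt_sub_iff_add_lt, ← lt_sub_iff_add_lt', max_lt_iff]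
      exact ⟨by linarith, (min_le_left _ _).trans_lt (by linarith)⟩
    · rw [sub_lt_comm, lt_max_iff, lt_min_iff]
      right; constructor <;> linarith

lemma exists_mem_toSet_of_mem_double {B : Square} {z : ℂ} (hz : z ∈ B.double) :
    ∃ w ∈ B.toSet, maxDist z w ≤ B.width / 2 := by
  have hw := B.width_pos
  obtain ⟨h1, h2⟩ := hz
  simp only [center, abs_le] at h1 h2
  refine ⟨⟨max B.corner.re (min z.re (B.corner.re + B.width)),
    max B.corner.im (min z.im (B.corner.im + B.width))⟩, ?_, ?_⟩
  · rw [mem_toSet]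
    refine ⟨le_max_left _ _, max_le (by linarith) (min_le_right _ _), le_max_left _ _,
      max_le (by linarith) (min_le_right _ _)⟩
  · rw [maxDist, max_le_iff, abs_le, abs_le]
    simp only
    refine ⟨⟨?_, ?_⟩, ?_, ?_⟩
    · rw [le_sub_iff_add_le, ← le_sub_iff_add_le', max_le_iff]
      exact ⟨by linarith, (min_le_left _ _).trans (by linarith)⟩
    · rw [sub_le_comm, le_max_iff, le_min_iff]
      right; constructor <;> linarith
    · rw [le_sub_iff_add_le, ← le_sub_iff_add_le', max_le_iff]
      exact ⟨by linarith, (min_le_left _ _).trans (by linarith)⟩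
    · rw [sub_le_comm, le_max_iff, le_min_iff]
      right; constructor <;> linarith

/-- A non-empty open subset of a union of squares `2B` meets the interior of some `2B`. -/
lemma exists_mem_openDouble_of_mem_double {B : Square} {z : ℂ} (hz : z ∈ B.double) {U : Set ℂ}
    (hU : IsOpen U) (hzU : z ∈ U) : ∃ w ∈ U, w ∈ B.openDouble := by
  have hw := B.width_pos
  obtain ⟨ε, hε, hball⟩ := Metric.isOpen_iff.1 hU z hzU
  -- Moving towards the center multiplies both offsets by 1 - t, so any t in (0, 1) gives an
  -- interior point of 2B, and a small t stays in U.
  have hc : Filter.Tendsto (fun t : ℝ => z + (t : ℂ) * (B.center - z)) (nhdsWithin 0 (Set.Ioi 0))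
      (nhds (z + ((0 : ℝ) : ℂ) * (B.center - z))) :=
    Filter.Tendsto.mono_left (Continuous.tendsto (by fun_prop) 0) nhdsWithin_le_nhds
  rw [Complex.ofReal_zero, zero_mul, add_zero] at hc
  have h1 := hc.eventually (Metric.ball_mem_nhds z hε)
  have h2 : ∀ᶠ t : ℝ in nhdsWithin 0 (Set.Ioi 0), t ∈ Set.Ioo (0 : ℝ) 1 :=
    Ioo_mem_nhdsGT one_pos
  obtain ⟨t, ht, ht0, ht1⟩ := (h1.and h2).exists
  refine ⟨_, hball ht, ?_⟩
  obtain ⟨h3, h4⟩ := hz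
  have e1 : z + (t : ℂ) * (B.center - z) - B.center = ((1 - t : ℝ) : ℂ) * (z - B.center) := by
    push_cast; ring
  change maxDist _ _ < _
  rw [maxDist, ← Complex.sub_re, ← Complex.sub_im, e1, Complex.re_ofReal_mul, Complex.im_ofReal_mul,
    abs_mul, abs_mul, abs_of_pos (by linarith : (0 : ℝ) < 1 - t), max_lt_iff, Complex.sub_re,
    Complex.sub_im]
  constructor <;> nlinarith

end Square

/-! ### The enclosing square and disk of a component -/

namespace Component

lemma mem_region {C : Component} {z : ℂ} : z ∈ C.region ↔ ∃ B ∈ C, z ∈ B.toSet := by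
  simp [region]

lemma toSet_subset_region {C : Component} {B : Square} (hB : B ∈ C) : B.toSet ⊆ C.region :=
  fun _ hz => mem_region.2 ⟨B, hB, hz⟩

lemma region_nonempty {C : Component} (h : C.Nonempty) : C.region.Nonempty := by
  obtain ⟨B, hB⟩ := h
  exact ⟨_, toSet_subset_region hB B.corner_mem⟩

lemma isCompact_region (C : Component) : IsCompact C.region :=
  C.isCompact_biUnion fun B _ => B.isCompact_toSet

lemma region_singleton (B : Square) : region {B} = B.toSet := by simp [region]

lemma isCompact_re (C : Component) : IsCompact (Complex.re '' C.region) :=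
  C.isCompact_region.image Complex.continuous_re

lemma isCompact_im (C : Component) : IsCompact (Complex.im '' C.region) :=
  C.isCompact_region.image Complex.continuous_im

/-- A component lies in its enclosing square. -/
lemma maxDist_center_le {C : Component} {z : ℂ} (hz : z ∈ C.region) :
    maxDist z C.center ≤ C.width / 2 := by
  have h1 := csInf_le C.isCompact_re.bddBelow (Set.mem_image_of_mem _ hz)
  have h2 := le_csSup C.isCompact_re.bddAbove (Set.mem_image_of_mem _ hz)
  have h3 := csInf_le C.isCompact_im.bddBelow (Set.mem_image_of_mem _ hz)
  have h4 := le_csSup C.isCompact_im.bddAbove (Set.mem_image_of_mem _ hz)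
  have h5 : sSup (Complex.re '' C.region) - sInf (Complex.re '' C.region) ≤ C.width :=
    le_max_left _ _
  have h6 : sSup (Complex.im '' C.region) - sInf (Complex.im '' C.region) ≤ C.width :=
    le_max_right _ _
  simp only [maxDist, center]
  refine max_le ?_ ?_ <;> rw [abs_le] <;> constructor <;> linarith

lemma width_mono {C C' : Component} (hC : C.Nonempty) (h : C.region ⊆ C'.region) :
    C.width ≤ C'.width := by
  have hne := region_nonempty hC
  have h1 := csInf_le_csInf C'.isCompact_re.bddBelow (hne.image _) (Set.image_mono h)
  have h2 := csSup_le_csSup C'.isCompact_re.bddAbove (hne.image _) (Set.image_mono h)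
  have h3 := csInf_le_csInf C'.isCompact_im.bddBelow (hne.image _) (Set.image_mono h)
  have h4 := csSup_le_csSup C'.isCompact_im.bddAbove (hne.image _) (Set.image_mono h)
  exact max_le_max (by linarith) (by linarith)

lemma width_le {C : Component} (hC : C.Nonempty) {d : ℝ}
    (h : ∀ z ∈ C.region, ∀ w ∈ C.region, maxDist z w ≤ d) : C.width ≤ d := by
  have hne := region_nonempty hC
  refine max_le ?_ ?_
  · obtain ⟨z, hz, h1⟩ := C.isCompact_re.sSup_mem (hne.image _)
    obtain ⟨w, hw, h2⟩ := C.isCompact_re.sInf_mem (hne.image _)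
    rw [← h1, ← h2]
    exact (le_abs_self _).trans ((le_max_left _ _).trans (h z hz w hw))
  · obtain ⟨z, hz, h1⟩ := C.isCompact_im.sSup_mem (hne.image _)
    obtain ⟨w, hw, h2⟩ := C.isCompact_im.sInf_mem (hne.image _)
    rw [← h1, ← h2]
    exact (le_abs_self _).trans ((le_max_right _ _).trans (h z hz w hw))

lemma width_singleton (B : Square) : width {B} = B.width := by
  have hw := B.width_pos
  refine le_antisymm (width_le (Finset.singleton_nonempty _) fun z hz w hw => ?_) ?_
  · rw [region_singleton, Square.mem_toSet] at hz hw
    unfold maxDist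
    refine max_le ?_ ?_ <;> rw [abs_le] <;> constructor <;> linarith
  · have h1 : (B.corner + B.width : ℂ) ∈ region {B} := by
      rw [region_singleton, Square.mem_toSet]
      refine ⟨?_, ?_, ?_, ?_⟩ <;> simp <;> linarith
    have h2 : B.corner ∈ region {B} := by rw [region_singleton]; exact B.corner_mem
    have h3 := (le_max_left _ _).trans (maxDist_center_le h1)
    have h4 := (le_max_left _ _).trans (maxDist_center_le h2)
    rw [abs_le] at h3 h4
    simp at h3 h4
    linarith

lemma width_le_of_mem {C : Component} {B : Square} (hB : B ∈ C) : B.width ≤ C.width := by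
  rw [← width_singleton]
  refine width_mono (Finset.singleton_nonempty _) ?_
  rw [region_singleton]
  exact toSet_subset_region hB

/-- Half the diagonal of the enclosing square is (√2/2)w(C), less than (3/4)w(C). -/
lemma region_subset_disk {C : Component} (hC : C.Nonempty) : C.region ⊆ C.disk.toSet := by
  intro z hz
  obtain ⟨B, hB⟩ := hC
  have hw := B.width_pos.trans_le (width_le_of_mem hB)
  have h1 := dist_le_sqrt_two_mul_maxDist z C.center
  have h2 := maxDist_center_le hz
  have h3 : √2 < 3 / 2 := by rw [Real.sqrt_lt' (by norm_num)]; norm_num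
  have h4 : 0 ≤ √2 := Real.sqrt_nonneg 2
  rw [disk, Disk.toSet, Metric.mem_ball]
  simp only
  nlinarith

/-- The roots close to the squares of `C` lie in the disk `(4√2/3) Δ_C`. -/
lemma dist_center_lt {C : Component} {B : Square} (hB : B ∈ C) {z : ℂ} (hz : z ∈ B.openDouble) :
    dist z C.center < √2 * C.width := by
  obtain ⟨w, hw, hzw⟩ := Square.exists_mem_toSet_of_mem_openDouble hz
  have h1 := maxDist_center_le (toSet_subset_region hB hw)
  have h2 := maxDist_triangle z w C.center
  have h3 := width_le_of_mem hB
  refine (dist_le_sqrt_two_mul_maxDist _ _).trans_lt ?_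
  refine mul_lt_mul_of_pos_left ?_ (by positivity)
  linarith

end Component

/-! ### Components consisting of squares of one grid -/

/-- `C` is a non-empty set of squares of the grid that divides `B₀` into `2 ^ m × 2 ^ m` squares. -/
structure IsGridComp (B₀ : Square) (m : ℕ) (C : Component) : Prop where
  nonempty : C.Nonempty
  subset : C ⊆ B₀.subdivide m

namespace IsGridComp

variable {B₀ : Square} {m : ℕ} {C : Component}

lemma level_eq (h : IsGridComp B₀ m C) : C.level = B₀.exp - m := by
  unfold Component.level
  rw [dif_pos h.nonempty]
  obtain ⟨B, hB⟩ := h.nonempty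
  refine le_antisymm (Finset.sup'_le _ _ fun B hB => (Square.exp_of_mem (h.subset hB)).le) ?_
  rw [← Square.exp_of_mem (h.subset hB)]
  exact Finset.le_sup' Square.exp hB

lemma width_eq (h : IsGridComp B₀ m C) {B : Square} (hB : B ∈ C) : B.width = 2 ^ C.level := by
  rw [h.level_eq, Square.width_of_mem (h.subset hB)]

lemma region_subset (h : IsGridComp B₀ m C) : C.region ⊆ B₀.toSet := fun z hz => by
  obtain ⟨B, hB, hz⟩ := Component.mem_region.1 hz
  exact Square.toSet_subset_of_mem (h.subset hB) hz

lemma level_le_width (h : IsGridComp B₀ m C) : (2 : ℝ) ^ C.level ≤ C.width := by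
  obtain ⟨B, hB⟩ := h.nonempty
  rw [← h.width_eq hB]
  exact Component.width_le_of_mem hB

lemma width_pos (h : IsGridComp B₀ m C) : 0 < C.width :=
  lt_of_lt_of_le (by positivity) h.level_le_width

lemma width_le (h : IsGridComp B₀ m C) : C.width ≤ B₀.width := by
  rw [← Component.width_singleton]
  refine Component.width_mono h.nonempty ?_
  rw [Component.region_singleton]
  exact h.region_subset

/-- If the squares `2B` have a common interior point, then `C` lies in a block of `2 × 2` squares:
its width is at most twice the width of the squares, and its centre belongs to `C`. -/
lemma of_mem_openDouble (h : IsGridComp B₀ m C) {z : ℂ} (hz : ∀ B ∈ C, z ∈ B.openDouble) :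
    (C.width = 2 ^ C.level ∨ C.width = 2 ^ (C.level + 1)) ∧ C.center ∈ C.region := by
  obtain ⟨B1, hB1, hmin1⟩ := C.exists_min_image (fun B => B.corner.re) h.nonempty
  obtain ⟨B2, hB2, hmax2⟩ := C.exists_max_image (fun B => B.corner.re) h.nonempty
  obtain ⟨B3, hB3, hmin3⟩ := C.exists_min_image (fun B => B.corner.im) h.nonempty
  obtain ⟨B4, hB4, hmax4⟩ := C.exists_max_image (fun B => B.corner.im) h.nonempty
  set w : ℝ := 2 ^ C.level with hw
  have hwpos : 0 < w := by positivity
  have hwB : ∀ B ∈ C, B.width = w := fun B hB => h.width_eq hB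
  have e1 : sInf (Complex.re '' C.region) = B1.corner.re := by
    refine IsLeast.csInf_eq ⟨⟨_, Component.toSet_subset_region hB1 B1.corner_mem, rfl⟩, ?_⟩
    rintro _ ⟨x, hx, rfl⟩
    obtain ⟨B, hB, hx⟩ := Component.mem_region.1 hx
    exact (hmin1 B hB).trans (Square.mem_toSet.1 hx).1
  have e2 : sSup (Complex.re '' C.region) = B2.corner.re + w := by
    refine IsGreatest.csSup_eq ⟨⟨⟨B2.corner.re + w, B2.corner.im⟩,
      Component.toSet_subset_region hB2 ?_, rfl⟩, ?_⟩
    · rw [Square.mem_toSet, hwB _ hB2]; refine ⟨?_, ?_, ?_, ?_⟩ <;> simp only <;> linarith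
    · rintro _ ⟨x, hx, rfl⟩
      obtain ⟨B, hB, hx⟩ := Component.mem_region.1 hx
      have := (Square.mem_toSet.1 hx).2.1
      rw [hwB _ hB] at this
      have := hmax2 B hB
      linarith
  have e3 : sInf (Complex.im '' C.region) = B3.corner.im := by
    refine IsLeast.csInf_eq ⟨⟨_, Component.toSet_subset_region hB3 B3.corner_mem, rfl⟩, ?_⟩
    rintro _ ⟨x, hx, rfl⟩
    obtain ⟨B, hB, hx⟩ := Component.mem_region.1 hx
    exact (hmin3 B hB).trans (Square.mem_toSet.1 hx).2.2.1
  have e4 : sSup (Complex.im '' C.region) = B4.corner.im + w := by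
    refine IsGreatest.csSup_eq ⟨⟨⟨B4.corner.re, B4.corner.im + w⟩,
      Component.toSet_subset_region hB4 ?_, rfl⟩, ?_⟩
    · rw [Square.mem_toSet, hwB _ hB4]; refine ⟨?_, ?_, ?_, ?_⟩ <;> simp only <;> linarith
    · rintro _ ⟨x, hx, rfl⟩
      obtain ⟨B, hB, hx⟩ := Component.mem_region.1 hx
      have := (Square.mem_toSet.1 hx).2.2.2
      rw [hwB _ hB] at this
      have := hmax4 B hB
      linarith
  -- Open doubles with a common point have corners at most one mesh apart, so there are at most two
  -- columns and, likewise, two rows.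
  have d1 : B2.corner.re = B1.corner.re ∨ B2.corner.re = B1.corner.re + w := by
    have ha := (Square.abs_corner_sub_le_of_openDouble (h.subset hB2) (h.subset hB1)
      (hz _ hB2) (hz _ hB1)).1
    have hm := hmin1 B2 hB2
    have hb := (Square.corner_sub (h.subset hB2) (h.subset hB1)).1
    rw [hwB _ hB2] at ha hb
    rcases hb (by linarith) with hb | hb | hb
    · left; linarith
    · right; linarith
    · left; linarith
  have d2 : B4.corner.im = B3.corner.im ∨ B4.corner.im = B3.corner.im + w := by
    have ha := (Square.abs_corner_sub_le_of_openDouble (h.subset hB4) (h.subset hB3)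
      (hz _ hB4) (hz _ hB3)).2
    have hm := hmin3 B4 hB4
    have hb := (Square.corner_sub (h.subset hB4) (h.subset hB3)).2
    rw [hwB _ hB4] at ha hb
    rcases hb (by linarith) with hb | hb | hb
    · left; linarith
    · right; linarith
    · left; linarith
  have hW : C.width = max (B2.corner.re + w - B1.corner.re) (B4.corner.im + w - B3.corner.im) := by
    rw [Component.width, e1, e2, e3, e4]
  have hdouble : (2 : ℝ) ^ (C.level + 1) = 2 * w := by
    rw [zpow_add_one₀ two_ne_zero, mul_comm]
  have hcenter : C.center = ⟨B1.corner.re + C.width / 2, B4.corner.im + w - C.width / 2⟩ := by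
    rw [Component.center, e1, e4]
  rw [hdouble, hcenter]
  by_cases hd : B2.corner.re = B1.corner.re ∧ B4.corner.im = B3.corner.im
  · have hW' : C.width = w := by rw [hW, hd.1, hd.2]; simp
    refine ⟨Or.inl hW', Component.toSet_subset_region hB1 ?_⟩
    have h1 := hmax4 B1 hB1
    have h2 := hmin3 B1 hB1
    rw [Square.mem_toSet, hwB _ hB1, hW']
    simp only
    refine ⟨?_, ?_, ?_, ?_⟩ <;> linarith [hd.2]
  · have hW' : C.width = 2 * w := by
      rw [hW]
      refine le_antisymm (max_le ?_ ?_) ?_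
      · rcases d1 with d1 | d1 <;> linarith
      · rcases d2 with d2 | d2 <;> linarith
      · rcases d1 with d1 | d1
        · rcases d2 with d2 | d2
          · exact absurd ⟨d1, d2⟩ hd
          · exact le_max_of_le_right (by linarith)
        · exact le_max_of_le_left (by linarith)
    -- The enclosing square shares its upper border with C, so its center is at the height of the
    -- lower edge of the topmost square `B4`. Horizontally it is on the line between the two
    -- columns, which bounds `B4` in either column.
    refine ⟨Or.inr hW', Component.toSet_subset_region hB4 ?_⟩
    have h1 := hmax2 B4 hB4
    have h2 := hmin1 B4 hB4
    rw [Square.mem_toSet, hwB _ hB4, hW']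
    simp only
    refine ⟨?_, ?_, ?_, ?_⟩ <;> rcases d1 with d1 | d1 <;> linarith

lemma of_sub (h : IsGridComp B₀ m C) {p : ℕ} {C' : Component} (hne : C'.Nonempty)
    (hsub : ∀ B' ∈ C', ∃ B ∈ C, B' ∈ B.subdivide p) :
    IsGridComp B₀ (m + p) C' ∧ C'.region ⊆ C.region := by
  refine ⟨⟨hne, fun B' hB' => ?_⟩, fun z hz => ?_⟩
  · obtain ⟨B, hB, h'⟩ := hsub B' hB'
    exact Square.subdivide_trans (h.subset hB) h'
  · obtain ⟨B', hB', hz⟩ := Component.mem_region.1 hz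
    obtain ⟨B, hB, h'⟩ := hsub B' hB'
    exact Component.toSet_subset_region hB (Square.toSet_subset_of_mem h' hz)

/-- If `C` does not cover `B₀`, some square of `C` has a neighbour in the grid not in `C`. -/
lemma exists_neighbour (h : IsGridComp B₀ m C) (hne : C.region ≠ B₀.toSet) :
    ∃ B ∈ C, ∃ B' ∈ B₀.subdivide m, B' ∉ C ∧
      (|B'.corner.re - B.corner.re| = B'.width ∧ B'.corner.im = B.corner.im ∨
        B'.corner.re = B.corner.re ∧ |B'.corner.im - B.corner.im| = B'.width) := by
  -- Otherwise membership in C passes along rows and columns, so C would contain every square of the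
  -- grid.
  by_contra! hcon
  have hmem : ∀ {p q}, p < 2 ^ m → q < 2 ^ m → B₀.sub m p q ∈ B₀.subdivide m := fun hp hq =>
    Square.mem_subdivide.2 ⟨_, _, hp, hq, rfl⟩
  have hw : ∀ p q, (B₀.sub m p q).width = 2 ^ (B₀.exp - m) := fun _ _ => rfl
  have hwpos : (0 : ℝ) < 2 ^ (B₀.exp - m) := by positivity
  have hre : ∀ p q, p + 1 < 2 ^ m → q < 2 ^ m →
      (B₀.sub m p q ∈ C ↔ B₀.sub m (p + 1) q ∈ C) := by
    intro p q hp hq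
    have hd : (B₀.sub m (p + 1) q).corner.re - (B₀.sub m p q).corner.re = 2 ^ (B₀.exp - m) := by
      simp [Square.sub]; ring
    constructor <;> intro hC <;> by_contra hC'
    · exact (hcon _ hC _ (hmem hp hq) hC').1 (by rw [hd, hw, abs_of_pos hwpos]) rfl
    · exact (hcon _ hC _ (hmem (by lia) hq) hC').1
        (by rw [abs_sub_comm, hd, hw, abs_of_pos hwpos]) rfl
  have him : ∀ p q, p < 2 ^ m → q + 1 < 2 ^ m →
      (B₀.sub m p q ∈ C ↔ B₀.sub m p (q + 1) ∈ C) := by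
    intro p q hp hq
    have hd : (B₀.sub m p (q + 1)).corner.im - (B₀.sub m p q).corner.im = 2 ^ (B₀.exp - m) := by
      simp [Square.sub]; ring
    constructor <;> intro hC <;> by_contra hC'
    · exact (hcon _ hC _ (hmem hp hq) hC').2 rfl (by rw [hd, hw, abs_of_pos hwpos])
    · exact (hcon _ hC _ (hmem hp (by lia)) hC').2 rfl
        (by rw [abs_sub_comm, hd, hw, abs_of_pos hwpos])
  have hre' : ∀ p q, p < 2 ^ m → q < 2 ^ m → (B₀.sub m p q ∈ C ↔ B₀.sub m 0 q ∈ C) := by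
    intro p q hp hq
    induction p with
    | zero => rfl
    | succ p ih => rw [← hre p q hp hq, ih (by lia)]
  have him' : ∀ q, q < 2 ^ m → (B₀.sub m 0 q ∈ C ↔ B₀.sub m 0 0 ∈ C) := by
    intro q hq
    induction q with
    | zero => rfl
    | succ q ih => rw [← him 0 q (by positivity) hq, ih (by lia)]
  obtain ⟨B, hB⟩ := h.nonempty
  obtain ⟨p, q, hp, hq, rfl⟩ := Square.mem_subdivide.1 (h.subset hB)
  have h0 : B₀.sub m 0 0 ∈ C := (him' q hq).1 ((hre' p q hp hq).1 hB)
  refine hne (Set.Subset.antisymm h.region_subset fun z hz => ?_)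
  obtain ⟨B', hB', hz⟩ := Square.exists_mem_subdivide hz m
  obtain ⟨p, q, hp, hq, rfl⟩ := Square.mem_subdivide.1 hB'
  exact Component.toSet_subset_region ((hre' p q hp hq).2 ((him' q hq).2 h0)) hz

/-- A component that does not cover `B₀` has an admissible starting point. -/
lemma exists_isStartPoint (h : IsGridComp B₀ m C) (hne : C.region ≠ B₀.toSet) :
    ∃ x, IsStartPoint B₀ C x := by
  obtain ⟨B, hB, B', hB', hnB', hadj⟩ := h.exists_neighbour hne
  have hwB := h.width_eq hB
  have hw' : B'.width = 2 ^ C.level := (Square.width_eq_of_mem (h.subset hB) hB').trans hwB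
  have hpos := B'.width_pos
  have hhalf : (2 : ℝ) ^ (C.level - 1) = B'.width / 2 := by
    rw [hw', zpow_sub_one₀ two_ne_zero]; rfl
  have hfar : ∀ w ∈ C.region, B'.width / 2 ≤ maxDist B'.center w := by
    intro w hw
    obtain ⟨B'', hB'', hw⟩ := Component.mem_region.1 hw
    exact Square.half_width_le_of_ne hB' (h.subset hB'') (fun he => hnB' (he ▸ hB'')) hw
  have hcmem : B'.center ∈ B'.toSet := by
    rw [Square.mem_toSet]; simp only [Square.center]
    refine ⟨?_, ?_, ?_, ?_⟩ <;> linarith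
  -- The starting point is the center of a grid square outside C that shares an edge with a square
  -- of C. The other grid squares are at least half a mesh away, and the midpoint of the common edge
  -- attains this distance.
  refine ⟨B'.center, ⟨Square.toSet_subset_of_mem hB' hcmem, fun hx => ?_⟩, ?_, ?_⟩
  · have := hfar _ hx
    rw [maxDist] at this
    simp at this
    linarith
  · rw [hhalf]
    refine le_antisymm ?_ ?_
    · have key : ∀ d : ℂ, ‖d‖ = B'.width / 2 → B'.center + d ∈ B.toSet →
          Metric.infDist B'.center C.region ≤ B'.width / 2 := by
        intro d hd hm
        refine (Metric.infDist_le_dist_of_mem (Component.toSet_subset_region hB hm)).trans ?_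
        rw [dist_self_add_right, hd]
      have hwBB : B.width = B'.width := hwB.trans hw'.symm
      rcases hadj with ⟨h1, h2⟩ | ⟨h1, h2⟩
      · rcases (abs_eq hpos.le).1 h1 with h1 | h1
        · refine key ⟨-(B'.width / 2), 0⟩ ?_ ?_
          · rw [Complex.norm_def, Complex.normSq_mk]
            simp only [mul_zero, add_zero, neg_mul_neg]
            exact Real.sqrt_mul_self (by positivity)
          · rw [Square.mem_toSet, hwBB]
            simp only [Square.center, Complex.add_re, Complex.add_im]
            refine ⟨?_, ?_, ?_, ?_⟩ <;> linarith
        · refine key ⟨B'.width / 2, 0⟩ ?_ ?_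
          · rw [Complex.norm_def, Complex.normSq_mk]
            simp only [mul_zero, add_zero]
            exact Real.sqrt_mul_self (by positivity)
          · rw [Square.mem_toSet, hwBB]
            simp only [Square.center, Complex.add_re, Complex.add_im]
            refine ⟨?_, ?_, ?_, ?_⟩ <;> linarith
      · rcases (abs_eq hpos.le).1 h2 with h2 | h2
        · refine key ⟨0, -(B'.width / 2)⟩ ?_ ?_
          · rw [Complex.norm_def, Complex.normSq_mk]
            simp only [mul_zero, zero_add, neg_mul_neg]
            exact Real.sqrt_mul_self (by positivity)
          · rw [Square.mem_toSet, hwBB]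
            simp only [Square.center, Complex.add_re, Complex.add_im]
            refine ⟨?_, ?_, ?_, ?_⟩ <;> linarith
        · refine key ⟨0, B'.width / 2⟩ ?_ ?_
          · rw [Complex.norm_def, Complex.normSq_mk]
            simp only [mul_zero, zero_add]
            exact Real.sqrt_mul_self (by positivity)
          · rw [Square.mem_toSet, hwBB]
            simp only [Square.center, Complex.add_re, Complex.add_im]
            refine ⟨?_, ?_, ?_, ?_⟩ <;> linarith
    · exact (Metric.le_infDist (Component.region_nonempty h.nonempty)).2
        fun w hw => (hfar w hw).trans (maxDist_le_dist _ _)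
  · rw [hhalf]
    have hwpos₀ := B₀.width_pos
    have hfr : (frontier B₀.toSet).Nonempty := by
      refine ⟨B₀.corner, subset_closure B₀.corner_mem, fun hc => ?_⟩
      have := (Square.mem_interior_toSet.1 hc).1
      exact lt_irrefl _ this
    refine (Metric.le_infDist hfr).2 fun w hw => ?_
    refine le_trans ?_ (maxDist_le_dist _ _)
    obtain ⟨p, q, -, -, -, h1, h2, h3, h4⟩ := Square.exists_index hB'
    have hp : 0 ≤ p * B'.width := by positivity
    have hq : 0 ≤ q * B'.width := by positivity
    have hni := hw.2
    rw [Square.mem_interior_toSet] at hni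
    by_contra! hlt
    simp only [maxDist, Square.center, max_lt_iff, abs_lt] at hlt
    obtain ⟨⟨_, _⟩, _, _⟩ := hlt
    refine hni ⟨?_, ?_, ?_, ?_⟩ <;> linarith

end IsGridComp

/-! ### Connected components -/

/-- All squares of `C` are connected in `C`. -/
def IsConn (C : Component) : Prop := ∀ B ∈ C, ∀ B' ∈ C, ConnectedIn C B B'

lemma ConnectedIn.symm {S : Finset Square} {B B' : Square} (h : ConnectedIn S B B') :
    ConnectedIn S B' B := by
  have : Std.Symm fun X Y : Square => X ∈ S ∧ Y ∈ S ∧ (X.toSet ∩ Y.toSet).Nonempty :=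
    ⟨fun X Y hXY => ⟨hXY.2.1, hXY.1, by rw [Set.inter_comm]; exact hXY.2.2⟩⟩
  exact Relation.ReflTransGen.stdSymm.symm _ _ h

section MaxComponents

variable {S : Finset Square} {C C' : Component}

lemma mem_maxComponents : C ∈ maxComponents S ↔
    ∃ B ∈ S, ∀ B', B' ∈ C ↔ B' ∈ S ∧ ConnectedIn S B B' := by
  classical
  simp only [maxComponents, Finset.mem_image]
  refine exists_congr fun B => and_congr_right fun _ => ?_
  constructor
  · rintro rfl B'; rw [Finset.mem_filter]
  · intro h; ext B'; rw [Finset.mem_filter, h]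

lemma subset_of_mem_maxComponents (h : C ∈ maxComponents S) : C ⊆ S := by
  obtain ⟨B, -, h⟩ := mem_maxComponents.1 h
  exact fun B' hB' => ((h B').1 hB').1

lemma nonempty_of_mem_maxComponents (h : C ∈ maxComponents S) : C.Nonempty := by
  obtain ⟨B, hB, h⟩ := mem_maxComponents.1 h
  exact ⟨B, (h B).2 ⟨hB, Relation.ReflTransGen.refl⟩⟩

lemma exists_mem_maxComponents {B : Square} (hB : B ∈ S) : ∃ C ∈ maxComponents S, B ∈ C := by
  classical
  refine ⟨S.filter fun B' => ConnectedIn S B B', mem_maxComponents.2 ⟨B, hB, fun B' => ?_⟩, ?_⟩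
  · rw [Finset.mem_filter]
  · rw [Finset.mem_filter]; exact ⟨hB, Relation.ReflTransGen.refl⟩

/-- A chain that starts at the representative never leaves the component, as each of its squares is
reachable from there. -/
lemma isConn_of_mem_maxComponents (h : C ∈ maxComponents S) : IsConn C := by
  obtain ⟨B, hB, h⟩ := mem_maxComponents.1 h
  have key : ∀ B', ConnectedIn S B B' → B' ∈ S → ConnectedIn C B B' := by
    intro B' hB'
    induction hB' with
    | refl => exact fun _ => Relation.ReflTransGen.refl
    | tail h1 h2 ih =>
      intro _
      refine (ih h2.1).tail ⟨(h _).2 ⟨h2.1, h1⟩, (h _).2 ⟨h2.2.1, h1.tail h2⟩, h2.2.2⟩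
  intro B1 h1 B2 h2
  exact (key B1 ((h B1).1 h1).2 ((h B1).1 h1).1).symm.trans
    (key B2 ((h B2).1 h2).2 ((h B2).1 h2).1)

lemma eq_of_inter_nonempty (h : C ∈ maxComponents S) (h' : C' ∈ maxComponents S) {B B' : Square}
    (hB : B ∈ C) (hB' : B' ∈ C') (hi : (B.toSet ∩ B'.toSet).Nonempty) : C = C' := by
  have hBS := subset_of_mem_maxComponents h hB
  have hBS' := subset_of_mem_maxComponents h' hB'
  obtain ⟨X, hX, h⟩ := mem_maxComponents.1 h
  obtain ⟨X', hX', h'⟩ := mem_maxComponents.1 h'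
  have h1 : ConnectedIn S X X' :=
    (((h B).1 hB).2.tail ⟨hBS, hBS', hi⟩).trans ((h' B').1 hB').2.symm
  ext Y
  rw [h, h']
  exact and_congr_right fun _ => ⟨h1.symm.trans, h1.trans⟩

lemma eq_of_mem_of_mem (h : C ∈ maxComponents S) (h' : C' ∈ maxComponents S) {B : Square}
    (hB : B ∈ C) (hB' : B ∈ C') : C = C' :=
  eq_of_inter_nonempty h h' hB hB' ⟨_, B.corner_mem, B.corner_mem⟩

lemma sum_card_maxComponents (S : Finset Square) : ∑ C ∈ maxComponents S, C.card = S.card := by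
  classical
  rw [← Finset.card_biUnion]
  · congr 1
    ext B
    rw [Finset.mem_biUnion]
    constructor
    · rintro ⟨C, hC, hB⟩; exact subset_of_mem_maxComponents hC hB
    · exact fun hB => exists_mem_maxComponents hB
  · intro C hC C' hC' hne
    change Disjoint C C'
    rw [Finset.disjoint_left]
    exact fun B hB hB' => hne (eq_of_mem_of_mem hC hC' hB hB')

/-- If the components cover a square, there is only one. -/
lemma exists_eq_singleton_of_cover {B₀ : Square}
    (h : (⋃ C ∈ maxComponents S, Component.region C) = B₀.toSet) :
    ∃ C, maxComponents S = {C} := by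
  classical
  have hc : B₀.corner ∈ ⋃ C ∈ maxComponents S, Component.region C := h ▸ B₀.corner_mem
  simp only [Set.mem_iUnion, exists_prop] at hc
  obtain ⟨C, hC, hcC⟩ := hc
  refine ⟨C, Finset.eq_singleton_iff_unique_mem.2 ⟨hC, fun C' hC' => ?_⟩⟩
  by_contra hne
  have hpre : IsPreconnected B₀.toSet := B₀.convex_toSet.isPreconnected
  have hcl : IsClosed (⋃ C'' ∈ (maxComponents S).erase C, Component.region C'') :=
    (((maxComponents S).erase C).isCompact_biUnion
      fun C'' _ => Component.isCompact_region C'').isClosed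
  have hdisj : ∀ z, z ∈ C.region → ∀ C'' ∈ (maxComponents S).erase C, z ∉ Component.region C'' := by
    intro z hz C'' hC'' hz'
    obtain ⟨B, hB, hzB⟩ := Component.mem_region.1 hz
    obtain ⟨B', hB', hzB'⟩ := Component.mem_region.1 hz'
    exact (Finset.mem_erase.1 hC'').1
      (eq_of_inter_nonempty hC (Finset.mem_of_mem_erase hC'') hB hB' ⟨z, hzB, hzB'⟩).symm
  have hne' : C' ∈ (maxComponents S).erase C := Finset.mem_erase.2 ⟨hne, hC'⟩
  obtain ⟨z, hz⟩ := Component.region_nonempty (nonempty_of_mem_maxComponents hC')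
  -- A second component would split the connected square into two disjoint closed parts.
  have hsub := (isPreconnected_iff_subset_of_disjoint_closed.1 hpre) C.region
    (⋃ C'' ∈ (maxComponents S).erase C, Component.region C'')
    C.isCompact_region.isClosed hcl ?_ ?_
  · rcases hsub with hs | hs
    · refine hdisj z (hs ?_) C' hne' hz
      rw [← h]
      exact Set.mem_biUnion hC' hz
    · have := hs B₀.corner_mem
      simp only [Set.mem_iUnion, exists_prop] at this
      obtain ⟨C'', h1, h2⟩ := this
      exact hdisj _ hcC C'' h1 h2
  · rw [← h]
    intro y hy
    simp only [Set.mem_iUnion, exists_prop] at hy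
    obtain ⟨C'', h1, h2⟩ := hy
    by_cases he : C'' = C
    · exact Or.inl (he ▸ h2)
    · exact Or.inr (Set.mem_biUnion (Finset.mem_erase.2 ⟨he, h1⟩ : C'' ∈ _) h2)
  · rw [Set.eq_empty_iff_forall_notMem]
    rintro y ⟨-, hy1, hy2⟩
    simp only [Set.mem_iUnion, exists_prop] at hy2
    obtain ⟨C'', h1, h2⟩ := hy2
    exact hdisj _ hy1 C'' h1 h2

end MaxComponents

/-! ### The separation of the roots -/

section Separation

variable {F : ℂ[X]} {B₀ : Square}

lemma cappedSeparation_le (F : ℂ[X]) (B₀ : Square) : cappedSeparation F B₀ ≤ 2 ^ 8 * B₀.width := by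
  have hw := B₀.width_pos
  refine ENNReal.toReal_le_of_le_ofReal (by positivity) (min_le_right _ _)

lemma cappedSeparation_le_dist {z y : ℂ} (hz : z ∈ F.roots) (hzB : z ∈ B₀.double)
    (hy : y ∈ F.roots.erase z) : cappedSeparation F B₀ ≤ dist z y := by
  refine ENNReal.toReal_le_of_le_ofReal dist_nonneg ((min_le_left _ _).trans ?_)
  rw [← edist_dist]
  exact (iInf₂_le z ⟨hz, hzB⟩).trans (iInf₂_le y hy)

/-- Distinct roots have positive distance since there are finitely many. Simplicity ensures that
erasing z once leaves no copy of z at distance 0. -/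
lemma cappedSeparation_pos (hF : F ≠ 0)
    (hsimple : ∀ z ∈ B₀.double, F.IsRoot z → F.rootMultiplicity z = 1) :
    0 < cappedSeparation F B₀ := by
  have hw := B₀.width_pos
  refine ENNReal.toReal_pos ?_ ((min_le_right _ _).trans_lt ENNReal.ofReal_lt_top).ne
  refine (lt_min ?_ (ENNReal.ofReal_pos.2 (by positivity))).ne'
  have hfin : Set.Finite {z | z ∈ F.roots} := by
    classical
    exact (F.roots.toFinset.finite_toSet).subset fun z hz => by simpa using hz
  refine (hfin.einfsep_pos).trans_le (le_iInf₂ fun z hz => le_iInf₂ fun y hy => ?_)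
  refine Set.einfsep_le_edist_of_mem (s := {z | z ∈ F.roots}) (Set.mem_ofPred.2 hz.1)
    (Set.mem_ofPred.2 (Multiset.mem_of_mem_erase hy)) fun he => ?_
  have h1 := hsimple z hz.2 ((mem_roots hF).1 hz.1)
  rw [← count_roots] at h1
  rw [← he, ← Multiset.count_pos, Multiset.count_erase_self, h1] at hy
  exact lt_irrefl _ hy

open scoped Classical in
lemma rootsIn_eq_singleton {R : Set ℂ} {z : ℂ} (hz : z ∈ F.roots) (hzR : z ∈ R)
    (h : ∀ y ∈ F.roots.erase z, y ∉ R) : rootsIn F R = {z} := by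
  rw [rootsIn, ← Multiset.cons_erase hz, Multiset.filter_cons_of_pos (p := (· ∈ R)) _ hzR,
    Multiset.filter_eq_nil.2 h]
  rfl

lemma eq_of_dist_lt (hF : F ≠ 0) {z y : ℂ} (hz : F.IsRoot z) (hzB : z ∈ B₀.double)
    (hy : F.IsRoot y) (h : dist z y < cappedSeparation F B₀) : z = y := by
  by_contra hne
  exact absurd (cappedSeparation_le_dist ((mem_roots hF).2 hz) hzB
    ((Multiset.mem_erase_of_ne (Ne.symm hne)).2 ((mem_roots hF).2 hy))) (not_le.2 h)

lemma exists_root_of_numRoots_ne_zero (hF : F ≠ 0) {R : Set ℂ} (h : numRoots F R ≠ 0) :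
    ∃ z ∈ R, F.IsRoot z := by
  obtain ⟨z, hz⟩ := Multiset.card_pos_iff_exists_mem.1 (Nat.pos_of_ne_zero h)
  obtain ⟨h1, h2⟩ := mem_rootsIn.1 hz
  exact ⟨z, h2, (mem_roots hF).1 h1⟩

end Separation

namespace Square

lemma mem_openDouble_of_maxDist_lt {B : Square} {z p : ℂ} (hp : p ∈ B.toSet)
    (h : maxDist z p < B.width / 2) : z ∈ B.openDouble := by
  rw [mem_toSet] at hp
  rw [maxDist, max_lt_iff, abs_lt, abs_lt] at h
  obtain ⟨⟨_, _⟩, _, _⟩ := h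
  rw [mem_openDouble]
  refine ⟨?_, ?_, ?_, ?_⟩ <;> linarith

lemma maxDist_le_width {B : Square} {z p : ℂ} (hz : z ∈ B.toSet) (hp : p ∈ B.toSet) :
    maxDist z p ≤ B.width := by
  rw [mem_toSet] at hp hz
  unfold maxDist
  refine max_le ?_ ?_ <;> rw [abs_le] <;> constructor <;> linarith

lemma maxDist_center_le {B : Square} {z : ℂ} (hz : z ∈ B.toSet) :
    maxDist z B.center ≤ B.width / 2 := by
  rw [mem_toSet] at hz
  simp only [maxDist, center]
  refine max_le ?_ ?_ <;> rw [abs_le] <;> constructor <;> linarith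

end Square

/-! ### Bisection -/

lemma CountOutcome.exists_some {F : ℂ[X]} {D : Disk} (hF : F ≠ 0) (hr : 0 < D.radius) :
    ∃ c, CountOutcome F D (some c) := by
  obtain ⟨_ | c, h⟩ := CountOutcome.exists F D
  · exact absurd h (CountOutcome.ne_none hF hr)
  · exact ⟨c, h⟩

lemma BisectionOutcome.ne_none {F : ℂ[X]} {C : Component} (hF : F ≠ 0) :
    ¬ BisectionOutcome F C none := by
  rintro ⟨t, ht, ⟨⟨B, hB, h⟩, -⟩ | ⟨-, h⟩⟩
  · have := ht B hB
    rw [h] at this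
    have hw := B.width_pos
    exact CountOutcome.ne_none hF (by positivity) this
  · cases h

lemma BisectionOutcome.exists_some {F : ℂ[X]} {C : Component} (hF : F ≠ 0) :
    ∃ D, BisectionOutcome F C (some D) := by
  have h : ∀ B : Square, ∃ c, CountOutcome F ⟨B.center, 3 / 4 * B.width⟩ (some c) := fun B => by
    have hw := B.width_pos
    exact CountOutcome.exists_some hF (by positivity)
  choose t ht using h
  exact ⟨_, fun B => some (t B), fun B _ => ht B, Or.inr ⟨fun _ _ => Option.some_ne_none _, rfl⟩⟩

/-- `S` consists of sub-squares of `C`, each has a root in the interior of its double, and all roots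
in `C` are covered. -/
structure IsRefinement (F : ℂ[X]) (C : Component) (p : ℕ) (S : Finset Square) : Prop where
  sub : ∀ B' ∈ S, ∃ B ∈ C, B' ∈ B.subdivide p
  root : ∀ B' ∈ S, ∃ z ∈ B'.openDouble, F.IsRoot z
  cover : ∀ z ∈ C.region, F.IsRoot z → ∃ B' ∈ S, z ∈ B'.toSet

/-- The disk Δ_B contains B, so a discarded square has no root. The disk (4/3)Δ_B has radius w(B)
and lies in the interior of 2B; were it free of roots, the test would have to return 0. So a kept
square has a root there. -/
lemma BisectionOutcome.exists_isRefinement {F : ℂ[X]} {C : Component} {D : Finset Component}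
    (hn : F.natDegree ≠ 0) (h : BisectionOutcome F C (some D)) :
    ∃ S, IsRefinement F C 1 S ∧ S.card ≤ 4 * C.card ∧ D = maxComponents S := by
  classical
  have hF : F ≠ 0 := fun h0 => hn (by rw [h0, natDegree_zero])
  obtain ⟨t, ht, ⟨-, h⟩ | ⟨hnn, h⟩⟩ := h
  · cases h
  refine ⟨(C.biUnion (Square.subdivide 1)).filter fun B => t B ≠ some 0, ⟨?_, ?_, ?_⟩, ?_, ?_⟩
  · intro B' hB'
    exact Finset.mem_biUnion.1 (Finset.mem_filter.1 hB').1
  · intro B' hB'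
    obtain ⟨hB', ht0⟩ := Finset.mem_filter.1 hB'
    have hw := B'.width_pos
    by_contra hno
    have hz : numRoots F (Metric.ball B'.center B'.width) = 0 := by
      by_contra hne
      obtain ⟨z, hz, hr⟩ := exists_root_of_numRoots_ne_zero hF hne
      exact hno ⟨z, (maxDist_le_dist _ _).trans_lt hz, hr⟩
    have hD := ht B' hB'
    rcases htB : t B' with _ | c
    · exact hnn B' hB' htB
    · rw [htB] at hD ht0
      have h2 : numRoots F (Disk.scale (4 / 3) ⟨B'.center, 3 / 4 * B'.width⟩).toSet = 0 := by
        rw [Disk.scale, Disk.toSet, ← mul_assoc]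
        norm_num
        exact hz
      have h1 := numRoots_mono (F := F) (Disk.toSet_scale_subset
        (D := ⟨B'.center, 3 / 4 * B'.width⟩) (by positivity)
        (show 2 * √2 / 3 ≤ 4 / 3 by linarith [two_sqrt_two_div_three_lt_one]))
      have := hD.eq_of_numRoots hn (by positivity) (by lia) h2
      exact ht0 (by rw [this]; rfl)
  · intro z hz hroot
    obtain ⟨B, hB, hzB⟩ := Component.mem_region.1 hz
    obtain ⟨B', hB', hzB'⟩ := Square.exists_mem_subdivide hzB 1
    have hmem : B' ∈ C.biUnion (Square.subdivide 1) := Finset.mem_biUnion.2 ⟨B, hB, hB'⟩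
    refine ⟨B', Finset.mem_filter.2 ⟨hmem, fun h0 => ?_⟩, hzB'⟩
    have hw := B'.width_pos
    have hD := ht B' hmem
    rw [h0] at hD
    have h1 := CountOutcome.numRoots_eq (k := 0) hF (by positivity) hD
    rw [numRoots, Multiset.card_eq_zero] at h1
    have : z ∈ rootsIn F (Disk.toSet ⟨B'.center, 3 / 4 * B'.width⟩) := by
      refine mem_rootsIn.2 ⟨(mem_roots hF).2 hroot, ?_⟩
      have h2 := dist_le_sqrt_two_mul_maxDist z B'.center
      have h3 := Square.maxDist_center_le hzB'
      have h4 : √2 < 3 / 2 := by rw [Real.sqrt_lt' (by norm_num)]; norm_num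
      rw [Disk.toSet, Metric.mem_ball]
      simp only
      nlinarith [Real.sqrt_nonneg 2]
    rw [h1] at this
    simp at this
  · refine (Finset.card_filter_le _ _).trans (Finset.card_biUnion_le.trans ?_)
    rw [mul_comm, ← smul_eq_mul, ← Finset.sum_const]
    refine Finset.sum_le_sum fun B _ => Finset.card_image_le.trans ?_
    simp
  · exact Option.some.inj h

/-! ### Newton steps -/

section Newton

variable {F : ℂ[X]} {B₀ : Square} {m : ℕ} {C : Component} {N k a : ℕ} {x y : ℂ}

lemma two_zpow_level_sub (ℓ : ℤ) (a : ℕ) :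
    (2 : ℝ) ^ (ℓ - (a + 1 : ℕ)) = 2 ^ ℓ / (2 * 2 ^ a) := by
  rw [zpow_sub₀ two_ne_zero, zpow_natCast, pow_succ]; ring

lemma mem_newtonComponent {B' : Square} (hN : N = 2 ^ a) :
    B' ∈ newtonComponent C N y ↔
      (∃ B ∈ C, B' ∈ B.subdivide (a + 1)) ∧ (B'.toSet ∩ (newtonDisk C N y).toSet).Nonempty := by
  classical
  rw [newtonComponent, Finset.mem_filter, Finset.mem_biUnion, hN, Nat.log_pow one_lt_two]

/-- The radius of Δ' is a quarter of the new mesh, so its points are less than half a mesh from any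
square that it meets. -/
lemma newtonDisk_subset_openDouble (hC : IsGridComp B₀ m C) (hN : N = 2 ^ a) {B' : Square}
    (h : B' ∈ newtonComponent C N y) {z : ℂ} (hz : z ∈ (newtonDisk C N y).toSet) :
    z ∈ B'.openDouble := by
  obtain ⟨⟨B, hB, hB'⟩, p, hp, hpD⟩ := (mem_newtonComponent hN).1 h
  refine Square.mem_openDouble_of_maxDist_lt hp ((maxDist_le_dist _ _).trans_lt ?_)
  have h1 := two_zpow_level_sub C.level a
  have h2 : B'.width = 2 ^ (C.level - (a + 1 : ℕ)) := by
    have := Square.exp_of_mem (hC.subset hB)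
    rw [Square.width_of_mem hB', this, ← hC.level_eq]
  have h3 : (newtonDisk C N y).radius = B'.width / 4 := by
    rw [h2, h1, newtonDisk, hN]; push_cast; ring
  rw [Disk.toSet, Metric.mem_ball, h3] at hz hpD
  linarith [dist_triangle_right z p (newtonDisk C N y).center]

lemma newtonDisk_radius_pos (C : Component) (hN : N = 2 ^ a) (y : ℂ) :
    0 < (newtonDisk C N y).radius := by
  rw [newtonDisk, hN]; push_cast; positivity

/-- The center of Δ' lies in the open double of every chosen square. Thus these squares are pairwise
adjacent, which gives connectedness, the bound nine and a width of at most two meshes. -/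
lemma newtonComponent_spec (hF : F ≠ 0) (hC : IsGridComp B₀ m C) (hN : N = 2 ^ a) (hk : 1 < k)
    (h2Δ : numRoots F (C.disk.scale 2).toSet = k)
    (hd : ¬ Disjoint (newtonDisk C N y).toSet C.region)
    (hc : CountOutcome F (newtonDisk C N y) (some (k : ℤ))) :
    IsRefinement F C (a + 1) (newtonComponent C N y) ∧
      IsGridComp B₀ (m + (a + 1)) (newtonComponent C N y) ∧
      IsConn (newtonComponent C N y) ∧ (newtonComponent C N y).card ≤ 9 ∧
      (newtonComponent C N y).width ≤ 2 ^ C.level / N ∧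
      cappedSeparation F B₀ ≤ 2 ^ C.level / (4 * N) := by
  have hNpos : (0 : ℝ) < N := by rw [hN]; push_cast; positivity
  have hN1 : (1 : ℝ) ≤ N := by rw [hN]; push_cast; exact one_le_pow₀ one_le_two
  have hrad := newtonDisk_radius_pos C hN y
  have hcount := hc.numRoots_eq hF hrad
  have hℓ : (0 : ℝ) < 2 ^ C.level := by positivity
  -- Δ' meets Δ_C and has radius at most w(C)/8, so it stays within 3/4 + 2/8 ≤ 3/2 times w(C) of
  -- the center. Equal counts then put all roots of 2Δ_C into Δ'.
  have hsub : (newtonDisk C N y).toSet ⊆ (C.disk.scale 2).toSet := by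
    obtain ⟨p, hpD, hpC⟩ := Set.not_disjoint_iff.1 hd
    have h1 := Component.region_subset_disk hC.nonempty hpC
    have h2 := hC.level_le_width
    have h3 : (newtonDisk C N y).radius ≤ C.width / 8 := by
      rw [newtonDisk]
      simp only
      have : (2 : ℝ) ^ C.level / N ≤ 2 ^ C.level := div_le_self hℓ.le hN1
      linarith
    intro z hz
    rw [Disk.toSet, Metric.mem_ball] at *
    have e1 : (C.disk.scale 2).radius = 2 * (3 / 4 * C.width) := rfl
    have e2 : C.disk.radius = 3 / 4 * C.width := rfl
    have e3 : (C.disk.scale 2).center = C.disk.center := rfl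
    rw [e1, e3]
    rw [e2] at h1
    have h4 := dist_triangle_right z p (newtonDisk C N y).center
    have h5 := dist_triangle z p C.disk.center
    have hw := hC.width_pos
    linarith
  have heq := rootsIn_eq_of_numRoots_le (F := F) hsub (by rw [hcount, h2Δ])
  have hexists : ∀ z ∈ C.region, z ∈ (newtonDisk C N y).toSet →
      ∃ B' ∈ newtonComponent C N y, z ∈ B'.toSet := by
    intro z hz hzD
    obtain ⟨B, hB, hzB⟩ := Component.mem_region.1 hz
    obtain ⟨B', hB', hzB'⟩ := Square.exists_mem_subdivide hzB (a + 1)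
    exact ⟨B', (mem_newtonComponent hN).2 ⟨⟨B, hB, hB'⟩, z, hzB', hzD⟩, hzB'⟩
  have href : IsRefinement F C (a + 1) (newtonComponent C N y) := by
    refine ⟨fun B' hB' => ((mem_newtonComponent hN).1 hB').1, fun B' hB' => ?_,
      fun z hz hroot => ?_⟩
    · obtain ⟨z, hz, hroot⟩ := exists_root_of_numRoots_ne_zero hF
        (R := (newtonDisk C N y).toSet) (by lia)
      exact ⟨z, newtonDisk_subset_openDouble hC hN hB' hz, hroot⟩
    · refine hexists z hz (mem_rootsIn.1 (heq.symm ▸ mem_rootsIn.2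
        ⟨(mem_roots hF).2 hroot, ?_⟩ : z ∈ rootsIn F (newtonDisk C N y).toSet)).2
      have h1 := Component.region_subset_disk hC.nonempty hz
      refine (Metric.ball_subset_ball ?_) h1
      have := hC.width_pos
      change 3 / 4 * C.width ≤ 2 * (3 / 4 * C.width)
      linarith
  have hne : (newtonComponent C N y).Nonempty := by
    obtain ⟨p, hpD, hpC⟩ := Set.not_disjoint_iff.1 hd
    obtain ⟨B', hB', -⟩ := hexists p hpC hpD
    exact ⟨B', hB'⟩
  obtain ⟨hgrid, hreg⟩ := hC.of_sub hne href.sub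
  have hy : ∀ B' ∈ newtonComponent C N y, y ∈ B'.openDouble := fun B' hB' =>
    newtonDisk_subset_openDouble hC hN hB' (Metric.mem_ball_self hrad)
  have hlev : (2 : ℝ) ^ (newtonComponent C N y).level = 2 ^ C.level / (2 * N) := by
    rw [hgrid.level_eq, hN, show B₀.exp - ((m + (a + 1) : ℕ) : ℤ) = C.level - (a + 1 : ℕ) by
      rw [hC.level_eq]; push_cast; ring, two_zpow_level_sub]
    push_cast; ring
  refine ⟨href, hgrid, ?_, ?_, ?_, ?_⟩
  · intro B hB B' hB'
    obtain ⟨h1, h2⟩ := Square.abs_corner_sub_le_of_openDouble (hgrid.subset hB) (hgrid.subset hB')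
      (hy B hB) (hy B' hB')
    exact Relation.ReflTransGen.single ⟨hB, hB', Square.inter_nonempty_of_abs_sub_le
      (Square.width_eq_of_mem (hgrid.subset hB) (hgrid.subset hB')) h1 h2⟩
  · obtain ⟨B, hB⟩ := hne
    exact Square.card_le_nine _ hgrid.subset (hgrid.subset hB) fun B' hB' =>
      Square.abs_corner_sub_le_of_openDouble (hgrid.subset hB) (hgrid.subset hB')
        (hy B hB) (hy B' hB')
  · have e : (2 : ℝ) ^ ((newtonComponent C N y).level + 1) = 2 ^ C.level / N := by
      rw [zpow_add_one₀ two_ne_zero, hlev]; field_simp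
    have hpos : (0 : ℝ) < 2 ^ C.level / N := by positivity
    rcases (hgrid.of_mem_openDouble hy).1 with h | h
    · rw [h, hlev, mul_comm, ← div_div]; linarith
    · rw [h, e]
  · classical
    -- As k > 1, the disk contains two entries of the list of roots, at distance less than its
    -- diameter 2^ℓ/(4N).
    have hcard : 1 < Multiset.card (rootsIn F (newtonDisk C N y).toSet) := by
      rw [numRoots] at hcount; lia
    obtain ⟨z, hz⟩ := Multiset.card_pos_iff_exists_mem.1 (zero_lt_one.trans hcard)
    have hcard' : 0 < Multiset.card ((rootsIn F (newtonDisk C N y).toSet).erase z) := by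
      rw [Multiset.card_erase_of_mem hz, Nat.pred_eq_sub_one]; lia
    obtain ⟨z', hz'⟩ := Multiset.card_pos_iff_exists_mem.1 hcard'
    have hz'D := (mem_rootsIn.1 (Multiset.mem_of_mem_erase hz')).2
    have hz'r : z' ∈ F.roots.erase z :=
      Multiset.mem_of_le (Multiset.erase_le_erase z (Multiset.filter_le _ _)) hz'
    obtain ⟨hzr, hzD⟩ := mem_rootsIn.1 hz
    obtain ⟨B, hB⟩ := hne
    have hzB : z ∈ B₀.double := Square.openDouble_subset_double _
      (Square.openDouble_subset_of_mem (hgrid.subset hB) (newtonDisk_subset_openDouble hC hN hB hzD))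
    refine (cappedSeparation_le_dist hzr hzB hz'r).trans ?_
    rw [Disk.toSet, Metric.mem_ball] at hzD hz'D
    have h1 := dist_triangle_right z z' (newtonDisk C N y).center
    have e : (newtonDisk C N y).radius = 2 ^ C.level / (4 * N) / 2 := by
      rw [newtonDisk]; field_simp; norm_num
    rw [e] at hzD hz'D
    linarith

end Newton

/-! ### The entries of a state -/

/-- The distance of two components is at least the maximum of the widths of their squares. -/
def Sep (C C' : Component) : Prop :=
  ∀ z ∈ C.region, ∀ w ∈ C'.region, max ((2 : ℝ) ^ C.level) ((2 : ℝ) ^ C'.level) ≤ maxDist z w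

lemma Sep.symm {C C' : Component} (h : Sep C C') : Sep C' C := fun z hz w hw => by
  rw [max_comm, maxDist_comm]; exact h w hw z hz

lemma Sep.mono {C₁ C₂ C₁' : Component} (h : Sep C₁ C₂) (hr : C₁'.region ⊆ C₁.region)
    (hl : C₁'.level ≤ C₁.level) : Sep C₁' C₂ := fun z hz w hw =>
  le_trans (max_le_max (zpow_le_zpow_right₀ one_le_two hl) le_rfl) (h z (hr hz) w hw)

/-- A common point would be less than w/2 from one component and at most w'/2 from the other,
bringing them closer than max(w, w'). One of the doubles must be open for strictness. -/
lemma Sep.disjoint_openDouble {B₀ : Square} {m m' : ℕ} {C C' : Component} (h : Sep C C')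
    (hC : IsGridComp B₀ m C) (hC' : IsGridComp B₀ m' C') {B B' : Square} (hB : B ∈ C)
    (hB' : B' ∈ C') {z : ℂ} (hz : z ∈ B.openDouble) : z ∉ B'.double := by
  intro hz'
  obtain ⟨p, hp, h1⟩ := Square.exists_mem_toSet_of_mem_openDouble hz
  obtain ⟨p', hp', h2⟩ := Square.exists_mem_toSet_of_mem_double hz'
  have h3 := h p (Component.toSet_subset_region hB hp) p' (Component.toSet_subset_region hB' hp')
  rw [← hC.width_eq hB, ← hC'.width_eq hB'] at h3
  have h4 := maxDist_triangle p z p'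
  rw [maxDist_comm p z] at h4
  linarith [le_max_left B.width B'.width, le_max_right B.width B'.width]

/-- The invariant of a pair `(C, N_C)`. -/
structure EntryInv (F : ℂ[X]) (B₀ : Square) (e : Entry) : Prop where
  grid : ∃ m, IsGridComp B₀ m e.comp
  conn : IsConn e.comp
  root : ∀ B ∈ e.comp, B ≠ B₀ → ∃ z ∈ B.openDouble, F.IsRoot z
  far : ∀ z ∈ B₀.toSet, F.IsRoot z →
    z ∈ e.comp.region ∨ ∀ p ∈ e.comp.region, (2 : ℝ) ^ e.comp.level ≤ maxDist z p
  speed_eq : ∃ j, 1 ≤ j ∧ e.speed = 2 ^ 2 ^ j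
  speed_le : (e.speed : ℝ) ≤ (2 ^ 9 * B₀.width / cappedSeparation F B₀) ^ 2
  anc_le : (ancStar B₀ e).width ≤ B₀.width
  width_le : e.comp.width ≤ 2 * (ancStar B₀ e).width / √(e.speed : ℝ)
  level_ge : cappedSeparation F B₀ / 2 ^ 11 ≤ 2 ^ e.comp.level

/-- The weight of an entry in the potential that decreases in every step. -/
def weight (L : ℤ) (e : Entry) : ℕ := e.comp.card * 8 ^ (e.comp.level - L).toNat

/-- The set `E` of entries may replace the entry `e`. -/
structure Replaces (F : ℂ[X]) (B₀ : Square) (e : Entry) (E : Finset Entry) : Prop where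
  inv : ∀ c ∈ E, EntryInv F B₀ c
  region : ∀ c ∈ E, c.comp.region ⊆ e.comp.region
  level : ∀ c ∈ E, c.comp.level ≤ e.comp.level
  double : ∀ c ∈ E, ∀ B' ∈ c.comp, B' ≠ B₀ ∧ ∃ B ∈ e.comp, B'.openDouble ⊆ B.openDouble
  sep : ∀ c ∈ E, ∀ c' ∈ E, c ≠ c' → Sep c.comp c'.comp
  cover : ∀ z ∈ e.comp.region, F.IsRoot z → ∃ c ∈ E, z ∈ c.comp.region
  weight : ∀ L, (∀ c ∈ E, L ≤ c.comp.level) → ∑ c ∈ E, weight L c < weight L e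

section EntryLemmas

variable {F : ℂ[X]} {B₀ : Square} {e : Entry}

lemma IsRefinement.ne {C : Component} {p m : ℕ} {S : Finset Square}
    (h : IsRefinement F C (p + 1) S) (hC : IsGridComp B₀ m C) {B' : Square} (hB' : B' ∈ S) :
    B' ≠ B₀ := by
  obtain ⟨B, hB, hB'⟩ := h.sub B' hB'
  have h1 := Square.exp_of_mem hB'
  have h2 := Square.exp_of_mem (hC.subset hB)
  rintro rfl
  push_cast at h1
  lia

lemma EntryInv.speed_ge (h : EntryInv F B₀ e) : 4 ≤ e.speed := by
  obtain ⟨j, hj, he⟩ := h.speed_eq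
  rw [he]
  calc 4 = 2 ^ 2 ^ 1 := rfl
    _ ≤ 2 ^ 2 ^ j := Nat.pow_le_pow_right two_pos (Nat.pow_le_pow_right two_pos hj)

lemma weight_pos {m : ℕ} (h : IsGridComp B₀ m e.comp) (L : ℤ) : 0 < weight L e :=
  Nat.mul_pos (Finset.card_pos.2 h.nonempty) (by positivity)

lemma sqrt_two_pow_two_pow {j : ℕ} (hj : 1 ≤ j) :
    ∃ i, 1 ≤ i ∧ max 4 (Nat.sqrt (2 ^ 2 ^ j)) = 2 ^ 2 ^ i := by
  obtain ⟨j, rfl⟩ := Nat.exists_eq_add_of_le' hj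
  have h1 : Nat.sqrt (2 ^ 2 ^ (j + 1)) = 2 ^ 2 ^ j := by
    rw [pow_succ 2 j, pow_mul, Nat.sqrt_eq']
  rw [h1]
  -- For N = 4 the square root is 2, and the maximum restores 4; otherwise it has no effect.
  rcases j with _ | j
  · exact ⟨1, le_rfl, by norm_num⟩
  · refine ⟨j + 1, by lia, max_eq_right ?_⟩
    calc 4 = 2 ^ 2 ^ 1 := rfl
      _ ≤ 2 ^ 2 ^ (j + 1) := Nat.pow_le_pow_right two_pos (Nat.pow_le_pow_right two_pos (by lia))

lemma far_of_mem {C C' : Component} {m : ℕ} (hC : IsGridComp B₀ m C) {z : ℂ} (h : z ∈ C'.region)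
    (hs : C' = C ∨ Sep C' C) : z ∈ C.region ∨ ∀ p ∈ C.region, (2 : ℝ) ^ C.level ≤ maxDist z p := by
  rcases hs with rfl | hs
  · exact Or.inl h
  · exact Or.inr fun p hp => (le_max_right _ _).trans (hs z h p hp)

/-- The mesh is halved, so the hypothesis with 2^10 yields the invariant with 2^11 for the children.
-/
lemma EntryInv.bisect (hn : F.natDegree ≠ 0) (he : EntryInv F B₀ e)
    (hlev : cappedSeparation F B₀ / 2 ^ 10 ≤ 2 ^ e.comp.level) {N : ℕ}
    (hN : ∃ j, 1 ≤ j ∧ N = 2 ^ 2 ^ j) (hNe : N ≤ e.speed) {D : Finset Component}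
    (h : BisectionOutcome F e.comp (some D)) [DecidableEq Entry] :
    Replaces F B₀ e (D.image (bisectionChild e N)) ∧
      ∀ C ∈ D, ∀ C' ∈ D, (C.region ∩ C'.region).Nonempty → C = C' := by
  obtain ⟨m, hC⟩ := he.grid
  obtain ⟨S, hS, hcard, rfl⟩ := h.exists_isRefinement hn
  have hgrid : ∀ C' ∈ maxComponents S,
      IsGridComp B₀ (m + 1) C' ∧ C'.region ⊆ e.comp.region := fun C' hC' =>
    hC.of_sub (nonempty_of_mem_maxComponents hC')
      fun B' hB' => hS.sub B' (subset_of_mem_maxComponents hC' hB')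
  have hlevel : ∀ C' ∈ maxComponents S, C'.level = e.comp.level - 1 := fun C' hC' => by
    rw [(hgrid C' hC').1.level_eq, hC.level_eq]; push_cast; ring
  have hinter : ∀ C ∈ maxComponents S, ∀ C' ∈ maxComponents S,
      (C.region ∩ C'.region).Nonempty → C = C' := by
    rintro C hC C' hC' ⟨z, hz, hz'⟩
    obtain ⟨B, hB, hz⟩ := Component.mem_region.1 hz
    obtain ⟨B', hB', hz'⟩ := Component.mem_region.1 hz'
    exact eq_of_inter_nonempty hC hC' hB hB' ⟨z, hz, hz'⟩
  have hsep : ∀ C ∈ maxComponents S, ∀ C' ∈ maxComponents S, C ≠ C' → Sep C C' := by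
    intro C hC C' hC' hne z hz w hw
    rw [hlevel C hC, hlevel C' hC', max_self, ← hlevel C hC]
    obtain ⟨B, hB, hz⟩ := Component.mem_region.1 hz
    obtain ⟨B', hB', hw⟩ := Component.mem_region.1 hw
    rw [← (hgrid C hC).1.width_eq hB]
    exact Square.width_le_maxDist ((hgrid C hC).1.subset hB) ((hgrid C' hC').1.subset hB')
      (fun hi => hne (eq_of_inter_nonempty hC hC' hB hB' hi)) hz hw
  have hcover : ∀ z ∈ e.comp.region, F.IsRoot z → ∃ C' ∈ maxComponents S, z ∈ C'.region := by
    intro z hz hr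
    obtain ⟨B', hB', hz⟩ := hS.cover z hz hr
    obtain ⟨C', hC', hB'⟩ := exists_mem_maxComponents hB'
    exact ⟨C', hC', Component.toSet_subset_region hB' hz⟩
  refine ⟨⟨?_, ?_, ?_, ?_, ?_, ?_, ?_⟩, hinter⟩
  · intro c hc
    obtain ⟨C', hC', rfl⟩ := Finset.mem_image.1 hc
    obtain ⟨hg, hr⟩ := hgrid C' hC'
    have hNR : (N : ℝ) ≤ e.speed := by exact_mod_cast hNe
    have hanc : ancStar B₀ (bisectionChild e N C') = ancStar B₀ e := by
      simp [ancStar, bisectionChild]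
    refine ⟨⟨_, hg⟩, isConn_of_mem_maxComponents hC', ?_, ?_, hN, hNR.trans he.speed_le, ?_, ?_, ?_⟩
    · exact fun B hB _ => hS.root B (subset_of_mem_maxComponents hC' hB)
    -- A root of the parent lies in some child, hence in this one or in one separated from it. A
    -- root far from the parent remains far, since the child is smaller and its mesh finer.
    · intro z hz hroot
      rcases he.far z hz hroot with h1 | h1
      · obtain ⟨C'', hC'', hz''⟩ := hcover z h1 hroot
        exact far_of_mem hg hz'' (or_iff_not_imp_left.2 (hsep C'' hC'' C' hC'))
      · refine Or.inr fun p hp => le_trans ?_ (h1 p (hr hp))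
        exact zpow_le_zpow_right₀ one_le_two (by
          change C'.level ≤ _
          rw [hlevel C' hC']; lia)
    · rw [hanc]; exact he.anc_le
    · rw [hanc]
      have h4 : (0 : ℝ) < N := by
        obtain ⟨j, -, rfl⟩ := hN; positivity
      have h0 : 0 < (ancStar B₀ e).width := by
        by_contra hneg
        have h1 := hC.width_pos.trans_le he.width_le
        have h2 : 2 * (ancStar B₀ e).width / √(e.speed : ℝ) ≤ 0 :=
          div_nonpos_of_nonpos_of_nonneg (by linarith) (Real.sqrt_nonneg _)
        linarith
      refine (Component.width_mono hg.nonempty hr).trans (he.width_le.trans ?_)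
      refine div_le_div_of_nonneg_left (by linarith) (Real.sqrt_pos.2 h4) (Real.sqrt_le_sqrt hNR)
    · change _ ≤ (2 : ℝ) ^ C'.level
      rw [hlevel C' hC', zpow_sub_one₀ two_ne_zero]
      linarith
  · intro c hc
    obtain ⟨C', hC', rfl⟩ := Finset.mem_image.1 hc
    exact (hgrid C' hC').2
  · intro c hc
    obtain ⟨C', hC', rfl⟩ := Finset.mem_image.1 hc
    change C'.level ≤ _
    rw [hlevel C' hC']; lia
  · intro c hc B' hB'
    obtain ⟨C', hC', rfl⟩ := Finset.mem_image.1 hc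
    have hBS := subset_of_mem_maxComponents hC' hB'
    obtain ⟨B, hB, hBB⟩ := hS.sub B' hBS
    exact ⟨IsRefinement.ne (p := 0) hS hC hBS, B, hB, Square.openDouble_subset_of_mem hBB⟩
  · intro c hc c' hc' hne
    obtain ⟨C, hC, rfl⟩ := Finset.mem_image.1 hc
    obtain ⟨C', hC', rfl⟩ := Finset.mem_image.1 hc'
    exact hsep C hC C' hC' fun h => hne (by rw [h])
  · intro z hz hr
    obtain ⟨C', hC', hz⟩ := hcover z hz hr
    exact ⟨_, Finset.mem_image_of_mem _ hC', hz⟩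
  -- At most four times as many squares, one level lower: the weight drops by a factor of at least
  -- 4/8.
  · intro L hL
    rcases (maxComponents S).eq_empty_or_nonempty with h0 | ⟨C₁, hC₁⟩
    · rw [h0, Finset.image_empty, Finset.sum_empty]; exact weight_pos hC L
    · have hL1 := hL _ (Finset.mem_image_of_mem _ hC₁)
      change L ≤ C₁.level at hL1
      rw [hlevel C₁ hC₁] at hL1
      rw [Finset.sum_image fun C _ C' _ hCC => congrArg Entry.comp hCC]
      have e1 : ∀ C' ∈ maxComponents S, weight L (bisectionChild e N C') =
          C'.card * 8 ^ (e.comp.level - 1 - L).toNat := fun C' hC' => by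
        rw [weight, bisectionChild, hlevel C' hC']
      rw [Finset.sum_congr rfl e1, ← Finset.sum_mul, sum_card_maxComponents, weight,
        show (e.comp.level - L).toNat = (e.comp.level - 1 - L).toNat + 1 by lia, pow_succ]
      have hp : 0 < 8 ^ (e.comp.level - 1 - L).toNat := by positivity
      have hcp := Finset.card_pos.2 hC.nonempty
      calc S.card * 8 ^ (e.comp.level - 1 - L).toNat
          ≤ 4 * e.comp.card * 8 ^ (e.comp.level - 1 - L).toNat := Nat.mul_le_mul_right _ hcard
        _ < 8 * e.comp.card * 8 ^ (e.comp.level - 1 - L).toNat :=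
            Nat.mul_lt_mul_of_pos_right (by lia) hp
        _ = _ := by ring

lemma EntryInv.newton (hF : F ≠ 0) (hσ : 0 < cappedSeparation F B₀) (he : EntryInv F B₀ e)
    {k : ℕ} (hk : 1 < k) (h2Δ : numRoots F (e.comp.disk.scale 2).toSet = k) {x : ℂ}
    {C' : Component} (h : NewtonOutcome F e.comp e.speed k x (some (.success C'))) :
    Replaces F B₀ e {⟨C', e.speed ^ 2, (e.comp, true) :: e.ancestors⟩} := by
  obtain ⟨m, hC⟩ := he.grid
  obtain ⟨j, hj, hspeed⟩ := he.speed_eq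
  cases h with
  | count_eq a ha h y hy hd hc =>
  obtain ⟨href, hg, hconn, hcard, hw, hsep⟩ := newtonComponent_spec hF hC hspeed hk h2Δ hd hc
  obtain ⟨-, hr⟩ := hC.of_sub hg.nonempty href.sub
  set C' := newtonComponent e.comp e.speed y
  have hlevel : C'.level = e.comp.level - (2 ^ j + 1 : ℕ) := by
    rw [hg.level_eq, hC.level_eq]; push_cast; ring
  have hj2 : 2 ≤ 2 ^ j := by
    calc 2 = 2 ^ 1 := rfl
      _ ≤ 2 ^ j := Nat.pow_le_pow_right two_pos hj
  have hsp : (0 : ℝ) < e.speed := by rw [hspeed]; positivity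
  have hℓw : (2 : ℝ) ^ e.comp.level ≤ B₀.width := hC.level_le_width.trans hC.width_le
  have hanc : ancStar B₀ ⟨C', e.speed ^ 2, (e.comp, true) :: e.ancestors⟩ = e.comp := by
    simp [ancStar]
  have hcover : ∀ z ∈ e.comp.region, F.IsRoot z → z ∈ C'.region := by
    intro z hz hroot
    obtain ⟨B', hB', hz⟩ := href.cover z hz hroot
    exact Component.toSet_subset_region hB' hz
  refine ⟨?_, ?_, ?_, ?_, ?_, ?_, ?_⟩
  · intro c hc
    rw [Finset.mem_singleton] at hc
    subst hc
    refine ⟨⟨_, hg⟩, hconn, fun B hB _ => href.root B hB, ?_, ?_, ?_, ?_, ?_, ?_⟩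
    · intro z hz hroot
      refine (he.far z hz hroot).imp (fun h1 => hcover z h1 hroot) fun h1 p hp => ?_
      refine le_trans ?_ (h1 p (hr hp))
      exact zpow_le_zpow_right₀ one_le_two (by
        change C'.level ≤ _
        rw [hlevel]; lia)
    · refine ⟨j + 1, by lia, ?_⟩
      simp only [hspeed]
      rw [← pow_mul, ← pow_succ]
    -- From σ ≤ 2^ℓ/(4N) and 2^ℓ ≤ w(𝓑) one has N ≤ w(𝓑)/(4σ), far below the bound required before
    -- squaring.
    · simp only [Nat.cast_pow]
      refine pow_le_pow_left₀ hsp.le ?_ 2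
      rw [le_div_iff₀ hσ]
      rw [le_div_iff₀ (by positivity)] at hsep
      nlinarith [B₀.width_pos]
    · rw [hanc]; exact hC.width_le
    · rw [hanc]
      simp only [Nat.cast_pow]
      rw [Real.sqrt_sq hsp.le]
      refine hw.trans ?_
      have h1 := hC.level_le_width
      have h2 := hC.width_pos
      gcongr
      linarith
    -- The new mesh 2^ℓ/(2N) is at least 2σ, so a Newton step alone never comes near the lower
    -- bound.
    · change _ ≤ (2 : ℝ) ^ C'.level
      rw [hlevel, two_zpow_level_sub, show (2 : ℝ) ^ 2 ^ j = e.speed by rw [hspeed]; push_cast; rfl]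
      rw [show (2 : ℝ) ^ e.comp.level / (2 * e.speed) = 2 * (2 ^ e.comp.level / (4 * e.speed)) by
        field_simp; norm_num]
      linarith
  · intro c hc
    rw [Finset.mem_singleton] at hc
    subst hc
    exact hr
  · intro c hc
    rw [Finset.mem_singleton] at hc
    subst hc
    change C'.level ≤ _
    rw [hlevel]; lia
  · intro c hc B' hB'
    rw [Finset.mem_singleton] at hc
    subst hc
    obtain ⟨B, hB, hBB⟩ := href.sub B' hB'
    exact ⟨href.ne hC hB', B, hB, Square.openDouble_subset_of_mem hBB⟩
  · intro c hc c' hc' hne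
    rw [Finset.mem_singleton] at hc hc'
    exact absurd (hc.trans hc'.symm) hne
  · intro z hz hroot
    exact ⟨_, Finset.mem_singleton_self _, hcover z hz hroot⟩
  -- There are at most 9 < 8³ new squares, while the level drops by 2^j + 1 ≥ 3.
  · intro L hL
    have hL1 : L ≤ C'.level := hL _ (Finset.mem_singleton_self _)
    rw [Finset.sum_singleton, weight, weight]
    change C'.card * 8 ^ (C'.level - L).toNat < _
    have hcp := Finset.card_pos.2 hC.nonempty
    have hlt : (C'.level - L).toNat + 3 ≤ (e.comp.level - L).toNat := by lia
    calc C'.card * 8 ^ (C'.level - L).toNat ≤ 9 * 8 ^ (C'.level - L).toNat :=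
          Nat.mul_le_mul_right _ hcard
      _ < 8 ^ 3 * 8 ^ (C'.level - L).toNat :=
          Nat.mul_lt_mul_of_pos_right (by norm_num) (by positivity)
      _ = 8 ^ ((C'.level - L).toNat + 3) := by rw [pow_add]; ring
      _ ≤ 8 ^ (e.comp.level - L).toNat := Nat.pow_le_pow_right (by norm_num) hlt
      _ ≤ e.comp.card * 8 ^ (e.comp.level - L).toNat := Nat.le_mul_of_pos_left _ hcp

end EntryLemmas

/-! ### Small components are isolated -/

section Small

variable {F : ℂ[X]} {B₀ : Square} {e : Entry}

lemma sqrt_two_lt : √2 < 3 / 2 := by rw [Real.sqrt_lt' (by norm_num)]; norm_num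

lemma Disk.scale_two_scale_two (D : Disk) : ((D.scale 2).scale 2).toSet = (D.scale 4).toSet := by
  simp only [Disk.scale, Disk.toSet, ← mul_assoc]
  norm_num

/-- If the squares of a component are small compared to the separation of the roots, the interiors
of their doubles have a common root. -/
lemma EntryInv.exists_common_root (hF : F ≠ 0) (he : EntryInv F B₀ e)
    (hB₀ : ∀ B ∈ e.comp, B ≠ B₀)
    (hsmall : (2 : ℝ) ^ e.comp.level < cappedSeparation F B₀ / 2 ^ 10) :
    ∃ z, F.IsRoot z ∧ ∀ B ∈ e.comp, z ∈ B.openDouble := by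
  obtain ⟨m, hC⟩ := he.grid
  obtain ⟨B₁, hB₁⟩ := hC.nonempty
  obtain ⟨z, hz, hroot⟩ := he.root B₁ hB₁ (hB₀ B₁ hB₁)
  have hpos : (0 : ℝ) < 2 ^ e.comp.level := by positivity
  refine ⟨z, hroot, fun B hB => ?_⟩
  have hchain := he.conn B₁ hB₁ B hB
  induction hchain with
  | refl => exact hz
  | tail _ h ih =>
    rename_i X Y _
    have hX := ih h.1
    obtain ⟨z', hz', hroot'⟩ := he.root Y h.2.1 (hB₀ Y h.2.1)
    obtain ⟨p, hp, h1⟩ := Square.exists_mem_toSet_of_mem_openDouble hX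
    obtain ⟨p', hp', h2⟩ := Square.exists_mem_toSet_of_mem_openDouble hz'
    obtain ⟨q, hq, hq'⟩ := h.2.2
    have h3 := Square.maxDist_le_width hp hq
    have h4 := Square.maxDist_le_width hq' hp'
    rw [hC.width_eq h.1] at h1 h3
    rw [hC.width_eq h.2.1] at h2 h4
    -- The route from root to root takes half a mesh into X, one mesh across X, one across Y, and
    -- half a mesh out of Y.
    have hd : maxDist z z' < 3 * 2 ^ e.comp.level := by
      have t1 := maxDist_triangle z p z'
      have t2 := maxDist_triangle p q z'
      have t3 := maxDist_triangle q p' z'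
      rw [maxDist_comm z' p'] at h2
      linarith
    have hlt : dist z z' < cappedSeparation F B₀ := by
      have t1 := dist_le_sqrt_two_mul_maxDist z z'
      have t2 := sqrt_two_lt
      nlinarith [Real.sqrt_nonneg 2]
    have hzB : z ∈ B₀.double := Square.openDouble_subset_double _
      (Square.openDouble_subset_of_mem (hC.subset h.1) hX)
    rw [eq_of_dist_lt hF hroot hzB hroot' hlt]
    exact hz'

/-- The counting tests succeed for small components. -/
lemma EntryInv.count_eq_one (hn : F.natDegree ≠ 0) (he : EntryInv F B₀ e)
    (hsmall : (2 : ℝ) ^ e.comp.level < cappedSeparation F B₀ / 2 ^ 10) {z : ℂ} (hroot : F.IsRoot z)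
    (hz : ∀ B ∈ e.comp, z ∈ B.openDouble) {t : ℝ} (ht : t = 2 ∨ t = 4) {c : ℤ}
    (hc : CountOutcome F (e.comp.disk.scale t) (some c)) : c = 1 := by
  have hF : F ≠ 0 := fun h0 => hn (by rw [h0, natDegree_zero])
  obtain ⟨m, hC⟩ := he.grid
  obtain ⟨B, hB⟩ := hC.nonempty
  have hpos : (0 : ℝ) < 2 ^ e.comp.level := by positivity
  have hW := hC.width_pos
  have hW2 : e.comp.width ≤ 2 * 2 ^ e.comp.level := by
    rcases (hC.of_mem_openDouble hz).1 with h | h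
    · linarith
    · rw [h, zpow_add_one₀ two_ne_zero, mul_comm]
  have hd := Component.dist_center_lt hB (hz B hB)
  have hzB : z ∈ B₀.double := Square.openDouble_subset_double _
      (Square.openDouble_subset_of_mem (hC.subset hB) (hz B hB))
  -- Applying `CountOutcome.eq_of_numRoots` to 2Δ_C and 4Δ_C involves radii from √2·w(C) to 4w(C).
  -- The smallest of these disks already contains z; a second root in the largest would be within
  -- (√2 + 4)w(C) < σ of z.
  have key : ∀ r : ℝ, √2 * e.comp.width ≤ r → r ≤ 4 * e.comp.width →
      numRoots F (Metric.ball e.comp.center r) = 1 := by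
    intro r h1 h2
    have : rootsIn F (Metric.ball e.comp.center r) = {z} := by
      refine rootsIn_eq_singleton ((mem_roots hF).2 hroot) (hd.trans_le h1) fun y hy hyr => ?_
      have h3 := cappedSeparation_le_dist ((mem_roots hF).2 hroot) hzB hy
      rw [Metric.mem_ball] at hyr
      have h4 := dist_triangle_right z y e.comp.center
      have h5 := sqrt_two_lt
      nlinarith
    rw [numRoots, this, Multiset.card_singleton]
  have h2 := sqrt_two_lt
  have e1 : ((e.comp.disk.scale t).scale (2 * √2 / 3)).toSet =
      Metric.ball e.comp.center (2 * √2 / 3 * (t * (3 / 4 * e.comp.width))) := rfl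
  have e2 : ((e.comp.disk.scale t).scale (4 / 3)).toSet =
      Metric.ball e.comp.center (4 / 3 * (t * (3 / 4 * e.comp.width))) := rfl
  have hs0 := Real.sqrt_nonneg 2
  have ht2 : 2 ≤ t := by rcases ht with rfl | rfl <;> norm_num
  have ht4 : t ≤ 4 := by rcases ht with rfl | rfl <;> norm_num
  have hsW : 0 ≤ √2 * e.comp.width := by positivity
  have hsW2 : √2 * e.comp.width ≤ 3 / 2 * e.comp.width := by nlinarith
  have := hc.eq_of_numRoots hn
    (show 0 < t * (3 / 4 * e.comp.width) by nlinarith) (k := 1)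
    (by rw [e1]; exact key _ (by nlinarith) (by nlinarith))
    (by rw [e2]; exact key _ (by nlinarith) (by nlinarith))
  exact_mod_cast this

end Small

/-! ### The invariant of the algorithm -/

/-- The property of the disks in the output. -/
def OutInv (F : ℂ[X]) (B₀ : Square) (E : Finset Entry) (D : Disk) : Prop :=
  ∃ (z : ℂ) (j : ℤ), z ∈ B₀.double ∧ IsIsolating F D z ∧ IsIsolating F (D.scale 2) z ∧
    D.radius = 3 / 2 * 2 ^ j ∧ dist z D.center < √2 * 2 ^ j ∧
    ∀ e ∈ E, Disjoint (D.scale 2).toSet e.comp.region ∧ ∀ B ∈ e.comp, z ∉ B.openDouble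

/-- The part of the invariant that does not depend on the phase. -/
structure CoreInv (F : ℂ[X]) (B₀ : Square) (O : List Disk) (E : Finset Entry) : Prop where
  entry : ∀ e ∈ E, EntryInv F B₀ e
  sep : ∀ e ∈ E, ∀ e' ∈ E, e ≠ e' → Sep e.comp e'.comp
  cover : ∀ z ∈ B₀.toSet, F.IsRoot z →
    (∃ e ∈ E, z ∈ e.comp.region) ∨ ∃ D ∈ O, IsIsolating F D z
  out : ∀ D ∈ O, OutInv F B₀ E D
  disj : O.Pairwise fun D D' => Disjoint D.toSet D'.toSet

/-- The invariant of the algorithm. -/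
structure StateInv (F : ℂ[X]) (B₀ : Square) (s : State) : Prop where
  core : CoreInv F B₀ s.output s.entries
  ne : s = initialState B₀ ∨ ∀ e ∈ s.entries, ∀ B ∈ e.comp, B ≠ B₀
  pre : s.phase = .preprocessing → ∃ e, s.entries = {e} ∧ e.comp.region = B₀.toSet
  main : s.phase = .mainLoop → ∀ e ∈ s.entries, e.comp.region ≠ B₀.toSet

/-- The potential that decreases in every step. -/
def potential (L : ℤ) (E : Finset Entry) : ℕ := ∑ e ∈ E, weight L e

section Invariant

variable {F : ℂ[X]} {B₀ : Square} {O : List Disk} {E E' : Finset Entry} {e : Entry}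

lemma CoreInv.replace [DecidableEq Entry] (h : CoreInv F B₀ O E) (he : e ∈ E)
    (hr : Replaces F B₀ e E') : CoreInv F B₀ O (E.erase e ∪ E') := by
  have hsep : ∀ e' ∈ E.erase e, ∀ c ∈ E', Sep c.comp e'.comp := fun e' he' c hc =>
    (h.sep e he e' (Finset.mem_of_mem_erase he') (Finset.ne_of_mem_erase he').symm).mono
      (hr.region c hc) (hr.level c hc)
  refine ⟨?_, ?_, ?_, ?_, h.disj⟩
  · intro c hc
    rcases Finset.mem_union.1 hc with hc | hc
    · exact h.entry c (Finset.mem_of_mem_erase hc)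
    · exact hr.inv c hc
  · intro c hc c' hc' hne
    rcases Finset.mem_union.1 hc with hc | hc <;> rcases Finset.mem_union.1 hc' with hc' | hc'
    · exact h.sep c (Finset.mem_of_mem_erase hc) c' (Finset.mem_of_mem_erase hc') hne
    · exact (hsep c hc c' hc').symm
    · exact hsep c' hc' c hc
    · exact hr.sep c hc c' hc' hne
  · intro z hz hroot
    rcases h.cover z hz hroot with ⟨e', he', hz'⟩ | hO
    · left
      by_cases hee : e' = e
      · subst hee
        obtain ⟨c, hc, hzc⟩ := hr.cover z hz' hroot
        exact ⟨c, Finset.mem_union_right _ hc, hzc⟩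
      · exact ⟨e', Finset.mem_union_left _ (Finset.mem_erase.2 ⟨hee, he'⟩), hz'⟩
    · exact Or.inr hO
  · intro D hD
    obtain ⟨z, j, h1, h2, h3, h4, h5, h6⟩ := h.out D hD
    refine ⟨z, j, h1, h2, h3, h4, h5, fun c hc => ?_⟩
    rcases Finset.mem_union.1 hc with hc | hc
    · exact h6 c (Finset.mem_of_mem_erase hc)
    · refine ⟨(h6 e he).1.mono_right (hr.region c hc), fun B hB hzB => ?_⟩
      obtain ⟨-, B', hB', hsub⟩ := hr.double c hc B hB
      exact (h6 e he).2 B' hB' (hsub hzB)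

lemma level_ge_of_zpow_le {L : ℤ} (hL : (2 : ℝ) ^ L ≤ cappedSeparation F B₀ / 2 ^ 11)
    (h : EntryInv F B₀ e) : L ≤ e.comp.level :=
  (zpow_le_zpow_iff_right₀ one_lt_two).1 (hL.trans h.level_ge)

/-- Entries common to the old and the new part are counted only once in the union, which lowers the
sum further. -/
lemma Replaces.potential_lt [DecidableEq Entry] {L : ℤ}
    (hL : (2 : ℝ) ^ L ≤ cappedSeparation F B₀ / 2 ^ 11) (he : e ∈ E) (hr : Replaces F B₀ e E') :
    potential L (E.erase e ∪ E') < potential L E := by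
  have h1 := Finset.sum_union_inter (s₁ := E.erase e) (s₂ := E') (f := CIsolate.weight L)
  have h2 := hr.weight L fun c hc => level_ge_of_zpow_le hL (hr.inv c hc)
  have h3 := Finset.add_sum_erase E (CIsolate.weight L) he
  unfold potential
  lia

lemma StateInv.replace [DecidableEq Entry] (h : StateInv F B₀ ⟨.mainLoop, O, E⟩) (he : e ∈ E)
    (hr : Replaces F B₀ e E') : StateInv F B₀ ⟨.mainLoop, O, E.erase e ∪ E'⟩ := by
  refine ⟨h.core.replace he hr, Or.inr ?_, fun hp => (by cases hp), fun _ => ?_⟩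
  · intro c hc B hB
    rcases Finset.mem_union.1 hc with hc | hc
    · rcases h.ne with h0 | h0
      · cases h0
      · exact h0 c (Finset.mem_of_mem_erase hc) B hB
    · exact (hr.double c hc B hB).1
  · intro c hc
    rcases Finset.mem_union.1 hc with hc | hc
    · exact h.main rfl c (Finset.mem_of_mem_erase hc)
    · intro hcB
      obtain ⟨m, hC⟩ := (h.core.entry e he).grid
      exact h.main rfl e he (Set.Subset.antisymm hC.region_subset (hcB ▸ hr.region c hc))

/-! ### Inner loops stop -/

/-- A root of the initial square outside C is at least a full mesh away from C, whereas x is only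
half a mesh away. -/
lemma EntryInv.eval_ne_zero (he : EntryInv F B₀ e) {x : ℂ} (hx : IsStartPoint B₀ e.comp x) :
    F.eval x ≠ 0 := by
  intro h0
  obtain ⟨m, hC⟩ := he.grid
  obtain ⟨⟨hxB, hxC⟩, hdist, -⟩ := hx
  have hfar := (he.far x hxB h0).resolve_left hxC
  have h1 : (2 : ℝ) ^ e.comp.level ≤ Metric.infDist x e.comp.region :=
    (Metric.le_infDist (Component.region_nonempty hC.nonempty)).2
      fun p hp => (hfar p hp).trans (maxDist_le_dist _ _)
  rw [hdist] at h1
  exact absurd h1 (not_le.2 (zpow_lt_zpow_right₀ one_lt_two (by lia)))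

lemma EntryInv.newton_ne_none (hF : F ≠ 0) (he : EntryInv F B₀ e) {k : ℕ} {x : ℂ}
    (hx : IsStartPoint B₀ e.comp x) : ¬ NewtonOutcome F e.comp e.speed k x none := by
  obtain ⟨m, hC⟩ := he.grid
  obtain ⟨j, -, hspeed⟩ := he.speed_eq
  have hW := hC.width_pos
  have hE : 0 < ‖F.eval x‖ := norm_pos_iff.2 (he.eval_ne_zero hx)
  have hnn : 0 ≤ 4 * e.comp.radius * ‖F.derivative.eval x‖ := by
    unfold Component.radius; positivity
  intro h
  cases h with
  | compare_hang h => exact SoftCompareOutcome.ne_none hnn hE h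
  | iterate_hang a ha h hy =>
    refine NewtonIterateOutcome.ne_none (fun h0 => ?_) hy
    have := h.pos hE ha
    rw [h0] at this
    simp at this
  | count_hang a ha h y hy hd hc =>
    exact CountOutcome.ne_none hF (newtonDisk_radius_pos e.comp hspeed y) hc

lemma EntryInv.exists_newton (hF : F ≠ 0) (he : EntryInv F B₀ e) {k : ℕ} {x : ℂ}
    (hx : IsStartPoint B₀ e.comp x) : ∃ r, NewtonOutcome F e.comp e.speed k x (some r) := by
  have hnn := he.newton_ne_none hF (k := k) hx
  obtain ⟨_ | a, ha⟩ := SoftCompareOutcome.exists (4 * e.comp.radius * ‖F.derivative.eval x‖)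
    ‖F.eval x‖
  · exact absurd (.compare_hang ha) hnn
  by_cases hno : a = .no
  · exact ⟨_, .compare_no (hno ▸ ha)⟩
  obtain ⟨_ | y, hy⟩ := NewtonIterateOutcome.exists F e.comp.level e.speed k x
  · exact absurd (.iterate_hang a hno ha hy) hnn
  by_cases hd : Disjoint (newtonDisk e.comp e.speed y).toSet e.comp.region
  · exact ⟨_, .disk_outside a hno ha y hy hd⟩
  obtain ⟨_ | c, hc⟩ := CountOutcome.exists F (newtonDisk e.comp e.speed y)
  · exact absurd (.count_hang a hno ha y hy hd hc) hnn
  by_cases hck : c = k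
  · exact ⟨_, .count_eq a hno ha y hy hd (hck ▸ hc)⟩
  · exact ⟨_, .count_ne a hno ha y hy hd c hc hck⟩

lemma EntryInv.disk_radius_pos (he : EntryInv F B₀ e) {t : ℝ} (ht : 0 < t) :
    0 < (e.comp.disk.scale t).radius := by
  obtain ⟨m, hC⟩ := he.grid
  have := hC.width_pos
  change 0 < t * (3 / 4 * e.comp.width)
  positivity

lemma EntryInv.cluster_ne_none (hF : F ≠ 0) (he : EntryInv F B₀ e) {R : Finset Entry} :
    ¬ ClusterOutcome F R e.comp none := by
  intro h
  cases h with
  | hang hs h =>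
    rcases h with h | h
    · exact CountOutcome.ne_none hF (he.disk_radius_pos two_pos) h
    · exact CountOutcome.ne_none hF (he.disk_radius_pos four_pos) h

lemma EntryInv.exists_cluster (hF : F ≠ 0) (he : EntryInv F B₀ e) (R : Finset Entry) :
    ∃ k, ClusterOutcome F R e.comp (some k) := by
  by_cases hs : WellSeparated R e.comp
  · obtain ⟨a, ha⟩ := CountOutcome.exists_some hF (he.disk_radius_pos two_pos)
    obtain ⟨b, hb⟩ := CountOutcome.exists_some hF (he.disk_radius_pos four_pos)
    by_cases hab : a = b ∧ 1 ≤ a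
    · obtain ⟨rfl, h1⟩ := hab
      lift a to ℕ using by lia
      exact ⟨a, .positive hs a (by exact_mod_cast h1) ha hb⟩
    · exact ⟨0, .negative hs a b ha hb hab⟩
  · exact ⟨0, .not_separated hs⟩

/-! ### Lower bounds for the size of the squares before a bisection -/

/-- A component of very small mesh spans at most two squares, so it could cover 𝓑 only if w(𝓑) <
2σ/2^10. The cap σ ≤ 2^8 w(𝓑) forbids this. -/
lemma EntryInv.level_of_cover (hF : F ≠ 0) (he : EntryInv F B₀ e)
    (hcov : e.comp.region = B₀.toSet) :
    cappedSeparation F B₀ / 2 ^ 10 ≤ 2 ^ e.comp.level := by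
  by_contra! hsmall
  obtain ⟨m, hC⟩ := he.grid
  have hcap := cappedSeparation_le F B₀
  have hw := B₀.width_pos
  by_cases hB₀ : B₀ ∈ e.comp
  · have := hC.width_eq hB₀
    linarith
  · obtain ⟨z, -, hz⟩ := he.exists_common_root hF (fun B hB h => hB₀ (h ▸ hB)) hsmall
    have h1 : B₀.width ≤ e.comp.width := by
      rw [← Component.width_singleton]
      refine Component.width_mono (Finset.singleton_nonempty _) ?_
      rw [Component.region_singleton, hcov]
    rcases (hC.of_mem_openDouble hz).1 with h | h
    · linarith
    · rw [zpow_add_one₀ two_ne_zero] at h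
      linarith

lemma StateInv.level_of_reachesBisection [DecidableEq Entry] (hn : F.natDegree ≠ 0)
    (h : StateInv F B₀ ⟨.mainLoop, O, E⟩) (he : e ∈ E)
    (hr : ReachesBisection F B₀ (E.erase e) e) :
    cappedSeparation F B₀ / 2 ^ 10 ≤ 2 ^ e.comp.level := by
  by_contra! hsmall
  have hF : F ≠ 0 := fun h0 => hn (by rw [h0, natDegree_zero])
  have hne : ∀ e ∈ E, ∀ B ∈ e.comp, B ≠ B₀ := h.ne.resolve_left fun h0 => by cases h0
  have hinv := h.core.entry e he
  obtain ⟨m, hC⟩ := hinv.grid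
  obtain ⟨z, hroot, hz⟩ := hinv.exists_common_root hF (hne e he) hsmall
  obtain ⟨hW, hcen⟩ := hC.of_mem_openDouble hz
  have hpos : (0 : ℝ) < 2 ^ e.comp.level := by positivity
  have hW2 : e.comp.width ≤ 2 * 2 ^ e.comp.level := by
    rcases hW with h | h
    · linarith
    · rw [h, zpow_add_one₀ two_ne_zero, mul_comm]
  obtain ⟨B, hB⟩ := hC.nonempty
  have hd := Component.dist_center_lt hB (hz B hB)
  have hzB : z ∈ B₀.double := Square.openDouble_subset_double _
      (Square.openDouble_subset_of_mem (hC.subset hB) (hz B hB))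
  have hs2 := sqrt_two_lt
  have hs0 := Real.sqrt_nonneg 2
  have hWp := hC.width_pos
  -- Suppose another component C' meets 4Δ_C. As m_C lies in C, the mesh of C' is at most the
  -- distance of the meeting point from m_C, below 6·2^ℓ. So a root near C' is close enough to z to
  -- coincide with it, although the doubles of separated components cannot share it.
  have hsep : WellSeparated (E.erase e) e.comp := by
    intro e' he' _
    rw [Set.disjoint_left]
    intro p hp hpC
    have he'E := Finset.mem_of_mem_erase he'
    have hS := h.core.sep e' he'E e he (Finset.ne_of_mem_erase he')
    obtain ⟨m', hC'⟩ := (h.core.entry e' he'E).grid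
    obtain ⟨B', hB', hpB'⟩ := Component.mem_region.1 hpC
    obtain ⟨z', hz', hroot'⟩ := (h.core.entry e' he'E).root B' hB' (hne e' he'E B' hB')
    have hpd : dist p e.comp.center < 4 * (3 / 4 * e.comp.width) := hp
    have h1 : (2 : ℝ) ^ e'.comp.level ≤ dist p e.comp.center :=
      (le_max_left _ _).trans ((hS p hpC _ hcen).trans (maxDist_le_dist _ _))
    obtain ⟨q, hq, h2⟩ := Square.exists_mem_toSet_of_mem_openDouble hz'
    have h3 := Square.maxDist_le_width hq hpB'
    have h4 := maxDist_triangle z' q p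
    rw [hC'.width_eq hB'] at h2 h3
    have h5 : maxDist z' p < 9 * 2 ^ e.comp.level := by linarith
    have h6 := dist_le_sqrt_two_mul_maxDist z' p
    have h7 := dist_triangle_right z z' e.comp.center
    have h8 := dist_triangle z' p e.comp.center
    have hlt : dist z z' < cappedSeparation F B₀ := by nlinarith
    have heq := eq_of_dist_lt hF hroot hzB hroot' hlt
    subst heq
    exact hS.symm.disjoint_openDouble hC hC' hB hB' (hz B hB)
      (Square.openDouble_subset_double _ hz')
  have hkey : ∀ {k : ℕ}, k ≠ 1 → ¬ ClusterOutcome F (E.erase e) e.comp (some k) := by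
    intro k hk hcl
    cases hcl with
    | not_separated hs => exact hs hsep
    | negative hs a b ha hb hab =>
      have h1 := hinv.count_eq_one hn hsmall hroot hz (Or.inl rfl) ha
      have h2 := hinv.count_eq_one hn hsmall hroot hz (Or.inr rfl) hb
      exact hab ⟨h1.trans h2.symm, h1.ge⟩
    | positive hs k hk1 ha hb =>
      have h1 := hinv.count_eq_one hn hsmall hroot hz (Or.inl rfl) ha
      exact hk (by exact_mod_cast h1)
  rcases hr with hr | ⟨k, x, hk, hr, -, -⟩
  · exact hkey zero_ne_one hr
  · exact hkey (by lia) hr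

/-! ### Adding a disk to the output -/

/-- The open doubles of all squares of C lie in 2Δ_C, so their roots equal its only root z. Hence
w(C) is a power of two and m_C belongs to C, the two facts behind the disjointness of the disks. -/
lemma StateInv.isolate [DecidableEq Entry] (hF : F ≠ 0) (h : StateInv F B₀ ⟨.mainLoop, O, E⟩)
    (he : e ∈ E) (hc : ClusterOutcome F (E.erase e) e.comp (some 1)) :
    StateInv F B₀ ⟨.mainLoop, O ++ [e.comp.disk.scale 2], E.erase e⟩ := by
  have hne : ∀ e ∈ E, ∀ B ∈ e.comp, B ≠ B₀ := h.ne.resolve_left fun h0 => by cases h0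
  have hinv := h.core.entry e he
  obtain ⟨m, hC⟩ := hinv.grid
  cases hc with
  | positive hs _ hk ha hb =>
  have h2 := CountOutcome.numRoots_eq (k := 1) hF (hinv.disk_radius_pos two_pos) ha
  have h4 := CountOutcome.numRoots_eq (k := 1) hF (hinv.disk_radius_pos four_pos) hb
  obtain ⟨z, hz2⟩ := Multiset.card_eq_one.1 h2
  have hWp := hC.width_pos
  have hsub24 : (e.comp.disk.scale 2).toSet ⊆ (e.comp.disk.scale 4).toSet := by
    refine Disk.toSet_scale_subset ?_ (by norm_num)
    change 0 ≤ 3 / 4 * e.comp.width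
    positivity
  have hz4 : rootsIn F (e.comp.disk.scale 4).toSet = {z} := by
    rw [← hz2]
    exact (rootsIn_eq_of_numRoots_le hsub24 (by rw [h2, h4])).symm
  have hs2 := sqrt_two_lt
  have huniq : ∀ B ∈ e.comp, z ∈ B.openDouble := by
    intro B hB
    obtain ⟨z', hz', hroot'⟩ := hinv.root B hB (hne e he B hB)
    have hmem : z' ∈ rootsIn F (e.comp.disk.scale 2).toSet := by
      refine mem_rootsIn.2 ⟨(mem_roots hF).2 hroot', ?_⟩
      have := Component.dist_center_lt hB hz'
      change dist z' e.comp.center < 2 * (3 / 4 * e.comp.width)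
      nlinarith
    rw [hz2, Multiset.mem_singleton] at hmem
    exact hmem ▸ hz'
  obtain ⟨hW, hcen⟩ := hC.of_mem_openDouble huniq
  obtain ⟨j, hj⟩ : ∃ j : ℤ, e.comp.width = 2 ^ j := hW.elim (fun h => ⟨_, h⟩) fun h => ⟨_, h⟩
  obtain ⟨B, hB⟩ := hC.nonempty
  have hd := Component.dist_center_lt hB (huniq B hB)
  have hrest : ∀ e' ∈ E.erase e, Sep e.comp e'.comp := fun e' he' =>
    h.core.sep e he e' (Finset.mem_of_mem_erase he') (Finset.ne_of_mem_erase he').symm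
  refine ⟨⟨?_, ?_, ?_, ?_, ?_⟩, Or.inr ?_, fun hp => (by cases hp), fun _ => ?_⟩
  · exact fun e' he' => h.core.entry e' (Finset.mem_of_mem_erase he')
  · exact fun e₁ h₁ e₂ h₂ => h.core.sep e₁ (Finset.mem_of_mem_erase h₁) e₂
      (Finset.mem_of_mem_erase h₂)
  · intro y hy hyroot
    rcases h.core.cover y hy hyroot with ⟨e', he', hy'⟩ | ⟨D, hD, hyD⟩
    · by_cases hee : e' = e
      · subst hee
        refine Or.inr ⟨_, List.mem_append_right _ (List.mem_singleton_self _), ?_⟩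
        have hmem : y ∈ rootsIn F (e'.comp.disk.scale 2).toSet := by
          refine mem_rootsIn.2 ⟨(mem_roots hF).2 hyroot, ?_⟩
          refine Metric.ball_subset_ball ?_ (Component.region_subset_disk hC.nonempty hy')
          change 3 / 4 * e'.comp.width ≤ 2 * (3 / 4 * e'.comp.width)
          linarith
        rw [hz2, Multiset.mem_singleton] at hmem
        rw [hmem]
        exact hz2
      · exact Or.inl ⟨e', Finset.mem_erase.2 ⟨hee, he'⟩, hy'⟩
    · exact Or.inr ⟨D, List.mem_append_left _ hD, hyD⟩
  · intro D hD
    rcases List.mem_append.1 hD with hD | hD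
    · obtain ⟨y, i, g1, g2, g3, g4, g5, g6⟩ := h.core.out D hD
      exact ⟨y, i, g1, g2, g3, g4, g5, fun e' he' => g6 e' (Finset.mem_of_mem_erase he')⟩
    · rw [List.mem_singleton] at hD
      subst hD
      refine ⟨z, j, ?_, hz2, ?_, ?_, ?_, fun e' he' => ⟨?_, fun B' hB' hzB' => ?_⟩⟩
      · exact Square.openDouble_subset_double _
          (Square.openDouble_subset_of_mem (hC.subset hB) (huniq B hB))
      · rw [IsIsolating, Disk.scale_two_scale_two]; exact hz4
      · rw [← hj]
        change 2 * (3 / 4 * e.comp.width) = _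
        ring
      · rw [← hj]; exact hd
      · rw [Disk.scale_two_scale_two]
        -- Well-separatedness says nothing about an entry with the same component, but m_C would
        -- then have positive distance from itself.
        refine hs e' he' fun hcc => ?_
        have h1 := hrest e' he' _ hcen e.comp.center (by rw [hcc]; exact hcen)
        have h2 : (0 : ℝ) < 2 ^ e.comp.level := by positivity
        have h3 : maxDist e.comp.center e.comp.center = 0 := by simp [maxDist]
        rw [h3] at h1
        linarith [le_max_left ((2 : ℝ) ^ e.comp.level) (2 ^ e'.comp.level)]
      · obtain ⟨m', hC'⟩ := (h.core.entry e' (Finset.mem_of_mem_erase he')).grid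
        exact (hrest e' he').disjoint_openDouble hC hC' hB hB' (huniq B hB)
          (Square.openDouble_subset_double _ hzB')
  · refine List.pairwise_append.2 ⟨h.core.disj, List.pairwise_singleton _ _, fun D hD D' hD' => ?_⟩
    rw [List.mem_singleton] at hD'
    subst hD'
    obtain ⟨y, i, g1, g2, g3, g4, g5, g6⟩ := h.core.out D hD
    obtain ⟨g7, g8⟩ := g6 e he
    refine Metric.ball_disjoint_ball ?_
    change D.radius + 2 * (3 / 4 * e.comp.width) ≤ dist D.center e.comp.center
    rw [g4, hj]
    have k1 : 3 * (2 : ℝ) ^ i ≤ dist e.comp.center D.center := by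
      have := Set.disjoint_right.1 g7 hcen
      rw [Disk.toSet, Metric.mem_ball, not_lt] at this
      change 2 * D.radius ≤ _ at this
      rw [g4] at this
      change _ ≤ dist e.comp.center D.center at this
      linarith
    rw [dist_comm] at k1
    -- If the new disk is not larger, the distance 3·2^i of the centers suffices. Otherwise the old
    -- root y is outside 4Δ_C, hence at least 3·2^j from m_C, and it is within √2·2^i of the old
    -- center, where 2^i ≤ 2^j/2.
    rcases le_or_gt j i with hji | hij
    · have := zpow_le_zpow_right₀ (one_le_two (α := ℝ)) hji
      linarith
    · have k2 : (2 : ℝ) * 2 ^ i ≤ 2 ^ j := by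
        rw [mul_comm, ← zpow_add_one₀ two_ne_zero]
        exact zpow_le_zpow_right₀ one_le_two (by lia)
      have hyroot := (mem_rootsIn.1 (g2.symm ▸ Multiset.mem_singleton_self y :
        y ∈ rootsIn F D.toSet)).1
      have k3 : 3 * (2 : ℝ) ^ j ≤ dist y e.comp.center := by
        by_contra! hlt
        have hmem : y ∈ rootsIn F (e.comp.disk.scale 4).toSet := by
          refine mem_rootsIn.2 ⟨hyroot, ?_⟩
          change dist y e.comp.center < 4 * (3 / 4 * e.comp.width)
          rw [hj]; linarith
        rw [hz4, Multiset.mem_singleton] at hmem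
        exact g8 B hB (hmem ▸ huniq B hB)
      have k4 := dist_triangle y D.center e.comp.center
      have k5 : (0 : ℝ) < 2 ^ i := by positivity
      nlinarith
  · exact fun e' he' => hne e' (Finset.mem_of_mem_erase he')
  · exact fun e' he' => h.main rfl e' (Finset.mem_of_mem_erase he')

/-! ### The invariant holds in every reachable state -/

lemma stateInv_initialState (hσ : 0 < cappedSeparation F B₀) :
    StateInv F B₀ (initialState B₀) := by
  have hw := B₀.width_pos
  have hgrid : IsGridComp B₀ 0 {B₀} :=
    ⟨Finset.singleton_nonempty _, by rw [Square.subdivide_zero]⟩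
  have hlev : (2 : ℝ) ^ Component.level {B₀} = B₀.width :=
    (hgrid.width_eq (Finset.mem_singleton_self _)).symm
  have hcap := cappedSeparation_le F B₀
  have hsqrt : √(4 : ℝ) = 2 := by
    rw [show (4 : ℝ) = 2 ^ 2 by norm_num]; exact Real.sqrt_sq two_pos.le
  have hE : EntryInv F B₀ ⟨{B₀}, 4, []⟩ := by
    refine ⟨⟨0, hgrid⟩, ?_, ?_, ?_, ⟨1, le_rfl, rfl⟩, ?_, ?_, ?_, ?_⟩
    · intro B hB B' hB'
      rw [Finset.mem_singleton] at hB hB'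
      rw [hB, hB']
      exact Relation.ReflTransGen.refl
    · exact fun B hB hne => absurd (Finset.mem_singleton.1 hB) hne
    · intro z hz _
      left
      change z ∈ Component.region {B₀}
      rwa [Component.region_singleton]
    -- The cap 2^8 w(𝓑) in the definition of σ makes the initial speed 4 admissible.
    · have : (2 : ℝ) ≤ 2 ^ 9 * B₀.width / cappedSeparation F B₀ := by
        rw [le_div_iff₀ hσ]; linarith
      push_cast
      nlinarith
    · exact (Component.width_singleton B₀).le
    · change Component.width {B₀} ≤ 2 * Component.width {B₀} / √((4 : ℕ) : ℝ)
      push_cast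
      rw [hsqrt]
      linarith
    · change _ ≤ (2 : ℝ) ^ Component.level {B₀}
      rw [hlev]
      linarith
  refine ⟨⟨?_, ?_, ?_, ?_, List.Pairwise.nil⟩, Or.inl rfl, fun _ => ⟨_, rfl, ?_⟩,
    fun hp => (by cases hp)⟩
  · intro e he
    rw [Finset.mem_singleton.1 he]; exact hE
  · intro e he e' he' hne
    exact absurd ((Finset.mem_singleton.1 he).trans (Finset.mem_singleton.1 he').symm) hne
  · intro z hz _
    refine Or.inl ⟨_, Finset.mem_singleton_self _, ?_⟩
    change z ∈ Component.region {B₀}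
    rwa [Component.region_singleton]
  · intro D hD
    cases hD
  · exact Component.region_singleton B₀

/-- If the components still cover the connected square, there is just one of them, so the next round
again finds a single pair. If they do not, no single one covers it, which later guarantees a
starting point. -/
lemma StateInv.preprocess [DecidableEq Entry] (hn : F.natDegree ≠ 0)
    (h : StateInv F B₀ ⟨.preprocessing, O, {e}⟩)
    {D : Finset Component} (hD : BisectionOutcome F e.comp (some D)) :
    StateInv F B₀ ⟨nextPhase B₀ D, O, D.image (bisectionChild e 4)⟩ ∧
      Replaces F B₀ e (D.image (bisectionChild e 4)) := by
  have hF : F ≠ 0 := fun h0 => hn (by rw [h0, natDegree_zero])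
  have hinv := h.core.entry e (Finset.mem_singleton_self _)
  obtain ⟨e', he', hcov⟩ := h.pre rfl
  obtain rfl : e = e' := Finset.singleton_injective he'
  obtain ⟨hr, hinter⟩ := hinv.bisect hn (hinv.level_of_cover hF hcov) ⟨1, le_rfl, rfl⟩
    hinv.speed_ge hD
  have hcore := h.core.replace (Finset.mem_singleton_self e) hr
  rw [Finset.erase_singleton, Finset.empty_union] at hcore
  refine ⟨⟨hcore, Or.inr fun c hc B hB => (hr.double c hc B hB).1, ?_, ?_⟩, hr⟩
  · intro hp
    simp only [nextPhase] at hp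
    split_ifs at hp with hU
    obtain ⟨S, -, -, rfl⟩ := hD.exists_isRefinement hn
    obtain ⟨C, hC⟩ := exists_eq_singleton_of_cover hU
    rw [hC] at hU ⊢
    have hU' : C.region = B₀.toSet := by simpa using hU
    exact ⟨_, Finset.image_singleton _ _, hU'⟩
  · intro hp c hc hcB
    simp only [nextPhase] at hp
    split_ifs at hp with hU
    refine hU (Set.Subset.antisymm (Set.iUnion₂_subset fun C hC => ?_) ?_)
    · rw [← hcov]
      exact hr.region _ (Finset.mem_image_of_mem _ hC)
    · obtain ⟨C, hC, rfl⟩ := Finset.mem_image.1 hc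
      rw [← hcB]
      exact Set.subset_biUnion_of_mem (u := Component.region) hC

lemma StateInv.step (hn : F.natDegree ≠ 0) (hσ : 0 < cappedSeparation F B₀) {s t : State}
    (h : StateInv F B₀ s) (hst : Step F B₀ s (some t)) :
    StateInv F B₀ t ∧ ∀ L : ℤ, (2 : ℝ) ^ L ≤ cappedSeparation F B₀ / 2 ^ 11 →
      potential L t.entries < potential L s.entries := by
  classical
  have hF : F ≠ 0 := fun h0 => hn (by rw [h0, natDegree_zero])
  cases hst with
  | pre O e D hb =>
    obtain ⟨h1, hr⟩ := h.preprocess hn hb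
    have h2 := fun L hL => hr.potential_lt (L := L) hL (Finset.mem_singleton_self e)
    simp only [Finset.erase_singleton, Finset.empty_union] at h2
    refine ⟨?_, fun L hL => ?_⟩
    · convert h1
    · convert h2 L hL
  | isolate O E e he hc =>
    have h1 := h.isolate hF he (by convert hc)
    refine ⟨by convert h1, fun L _ => ?_⟩
    obtain ⟨m, hC⟩ := (h.core.entry e he).grid
    have h2 := weight_pos hC L
    have h3 := Finset.add_sum_erase E (weight L) he
    simp only [potential]
    convert (show ∑ e ∈ E.erase e, weight L e < ∑ e ∈ E, weight L e by lia)
  | newton O E e he k hk hc x hx C' hN =>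
    have h2 : numRoots F (e.comp.disk.scale 2).toSet = k := by
      cases hc with
      | not_separated => lia
      | negative => lia
      | positive hs _ _ ha hb =>
        exact ha.numRoots_eq hF ((h.core.entry e he).disk_radius_pos two_pos)
    have hr := (h.core.entry e he).newton hF hσ hk h2 hN
    have e1 : insert ⟨C', e.speed ^ 2, (e.comp, true) :: e.ancestors⟩ (E.erase e) =
        E.erase e ∪ {⟨C', e.speed ^ 2, (e.comp, true) :: e.ancestors⟩} := by
      rw [Finset.union_comm]; rfl
    have h3 := h.replace he hr
    have h4 := fun L hL => hr.potential_lt (L := L) hL he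
    rw [← e1] at h3 h4
    refine ⟨?_, fun L hL => ?_⟩
    · convert h3
    · convert h4 L hL
  | bisect O E e he hrb D hb =>
    have hinv := h.core.entry e he
    have hlev := h.level_of_reachesBisection hn he (by convert hrb)
    obtain ⟨j, hj, hspeed⟩ := hinv.speed_eq
    have hle : max 4 (Nat.sqrt e.speed) ≤ e.speed := max_le hinv.speed_ge (Nat.sqrt_le_self _)
    obtain ⟨hr, -⟩ := hinv.bisect hn hlev (N := max 4 (Nat.sqrt e.speed))
      (by rw [hspeed]; exact sqrt_two_pow_two_pow hj) hle hb
    have h3 := h.replace he hr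
    have h4 := fun L hL => hr.potential_lt (L := L) hL he
    refine ⟨?_, fun L hL => ?_⟩
    · convert h3
    · convert h4 L hL

lemma StateInv.of_reachable (hn : F.natDegree ≠ 0) (hσ : 0 < cappedSeparation F B₀) {s : State}
    (h : Reachable F B₀ s) : StateInv F B₀ s := by
  induction h with
  | refl => exact stateInv_initialState hσ
  | tail _ hst ih => exact (ih.step hn hσ hst).1

lemma StateInv.exists_isStartPoint (h : StateInv F B₀ ⟨.mainLoop, O, E⟩) (he : e ∈ E) :
    ∃ x, IsStartPoint B₀ e.comp x := by
  obtain ⟨m, hC⟩ := (h.core.entry e he).grid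
  exact hC.exists_isStartPoint (h.main rfl e he)

lemma StateInv.not_step_none (hF : F ≠ 0) {s : State} (h : StateInv F B₀ s) :
    ¬ Step F B₀ s none := by
  intro hst
  cases hst with
  | pre_hang O e hb => exact BisectionOutcome.ne_none hF hb
  | cluster_hang O E e he hc => exact (h.core.entry e he).cluster_ne_none hF hc
  | no_point O E e he k hk hc hx =>
    obtain ⟨x, hx'⟩ := h.exists_isStartPoint he
    exact hx x hx'
  | newton_hang O E e he k hk hc x hx hN => exact (h.core.entry e he).newton_ne_none hF hx hN
  | bisect_hang O E e he hr hb => exact BisectionOutcome.ne_none hF hb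

lemma StateInv.progress (hF : F ≠ 0) {s : State} (h : StateInv F B₀ s) :
    IsFinal s ∨ ∃ t, Step F B₀ s (some t) := by
  classical
  obtain ⟨ph, O, E⟩ := s
  cases ph with
  | preprocessing =>
    obtain ⟨e, he, -⟩ := h.pre rfl
    obtain rfl : E = {e} := he
    obtain ⟨D, hD⟩ := BisectionOutcome.exists_some (C := e.comp) hF
    exact Or.inr ⟨_, .pre O e D hD⟩
  | mainLoop =>
    rcases E.eq_empty_or_nonempty with rfl | ⟨e, he⟩
    · exact Or.inl ⟨rfl, rfl⟩
    · right
      have hinv := h.core.entry e he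
      obtain ⟨D, hD⟩ := BisectionOutcome.exists_some (C := e.comp) hF
      obtain ⟨k, hk⟩ := hinv.exists_cluster hF (@Finset.erase _ (Classical.decEq _) E e)
      rcases k with _ | _ | k
      · exact ⟨_, .bisect O E e he (Or.inl (by convert hk)) D hD⟩
      · exact ⟨_, .isolate O E e he (by convert hk)⟩
      · obtain ⟨x, hx⟩ := h.exists_isStartPoint he
        obtain ⟨_ | C', hN⟩ := hinv.exists_newton hF (k := k + 1 + 1) hx
        · exact ⟨_, .bisect O E e he
            (Or.inr ⟨k + 1 + 1, x, by lia, by convert hk, hx, hN⟩) D hD⟩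
        · exact ⟨_, .newton O E e he (k + 1 + 1) (by lia) (by convert hk) x hx C' hN⟩

lemma terminates (hn : F.natDegree ≠ 0) (hσ : 0 < cappedSeparation F B₀) : Terminates F B₀ := by
  have hF : F ≠ 0 := fun h0 => hn (by rw [h0, natDegree_zero])
  refine ⟨?_, fun s hs => ?_⟩
  · rintro ⟨run, h0, hrun⟩
    have hreach : ∀ i, Reachable F B₀ (run i) := by
      intro i
      induction i with
      | zero => rw [h0]; exact Relation.ReflTransGen.refl
      | succ i ih => exact ih.tail (hrun i)
    -- The level -2^j bounds all levels from below, so one fixed potential decreases along the whole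
    -- run.
    obtain ⟨j, hj⟩ := exists_two_zpow_neg_lt (show 0 < cappedSeparation F B₀ / 2 ^ 11 by positivity)
    have hdec := fun i => ((StateInv.of_reachable hn hσ (hreach i)).step hn hσ (hrun i)).2 _ hj.le
    obtain ⟨i, hi⟩ := WellFounded.not_rel_apply_succ (r := ((· < ·) : ℕ → ℕ → Prop))
      fun i => potential (-((2 ^ j : ℕ) : ℤ)) (run i).entries
    exact hi (hdec i)
  · have h := StateInv.of_reachable hn hσ hs
    exact ⟨h.not_step_none hF, h.progress hF⟩

lemma correctOutput (hn : F.natDegree ≠ 0) (hσ : 0 < cappedSeparation F B₀) {s : State}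
    (hs : Reachable F B₀ s) (hfin : IsFinal s) : CorrectOutput F B₀ s.output := by
  have h := StateInv.of_reachable hn hσ hs
  refine ⟨h.core.disj, fun D hD => ?_, fun z hz hroot => ?_⟩
  · obtain ⟨z, j, h1, h2, h3, -⟩ := h.core.out D hD
    exact ⟨z, h1, h2, h3⟩
  · refine (h.core.cover z hz hroot).resolve_left ?_
    rintro ⟨e, he, -⟩
    rw [hfin.2] at he
    simp at he

/-! ### Counting squares -/

/-- Assign to every square a root in its open double. Squares with the same root belong to one
component, by separation, and are pairwise adjacent, so at most nine share a root. -/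
lemma CoreInv.sum_card_le (h : CoreInv F B₀ O E) (hF : F ≠ 0) {E' : Finset Entry} (hE' : E' ⊆ E)
    (hne : ∀ e ∈ E', ∀ B ∈ e.comp, B ≠ B₀) {R : Set ℂ}
    (hR : ∀ e ∈ E', ∀ B ∈ e.comp, B.openDouble ⊆ R) :
    ∑ e ∈ E', e.comp.card ≤ 9 * numRoots F R := by
  classical
  have hroot : ∀ x : (_ : Entry) × Square, ∃ z, x ∈ E'.sigma (fun e => e.comp) →
      z ∈ x.2.openDouble ∧ F.IsRoot z := by
    intro x
    by_cases hx : x ∈ E'.sigma fun e => e.comp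
    · obtain ⟨h1, h2⟩ := Finset.mem_sigma.1 hx
      obtain ⟨z, hz, hr⟩ := (h.entry x.1 (hE' h1)).root x.2 h2 (hne _ h1 _ h2)
      exact ⟨z, fun _ => ⟨hz, hr⟩⟩
    · exact ⟨0, fun h => absurd h hx⟩
  choose f hf using hroot
  rw [← Finset.card_sigma]
  refine (Finset.card_le_mul_card_image_of_maps_to (f := f) (t := (rootsIn F R).toFinset)
    (fun x hx => ?_) 9 fun b _ => ?_).trans (Nat.mul_le_mul_left 9 (Multiset.toFinset_card_le _))
  · obtain ⟨h1, h2⟩ := Finset.mem_sigma.1 hx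
    obtain ⟨hz, hr⟩ := hf x hx
    exact Multiset.mem_toFinset.2 (mem_rootsIn.2 ⟨(mem_roots hF).2 hr, hR _ h1 _ h2 hz⟩)
  · rcases (Finset.filter (fun x => f x = b) (E'.sigma fun e => e.comp)).eq_empty_or_nonempty with
      h0 | ⟨x₀, hx₀⟩
    · rw [h0]; simp
    · obtain ⟨hx₀, hb₀⟩ := Finset.mem_filter.1 hx₀
      obtain ⟨h1, h2⟩ := Finset.mem_sigma.1 hx₀
      have hz₀ := (hf x₀ hx₀).1
      rw [hb₀] at hz₀
      obtain ⟨m, hC⟩ := (h.entry x₀.1 (hE' h1)).grid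
      have hfst : ∀ x ∈ Finset.filter (fun x => f x = b) (E'.sigma fun e => e.comp),
          x.1 = x₀.1 ∧ x.2 ∈ x₀.1.comp ∧ b ∈ x.2.openDouble := by
        intro x hx
        obtain ⟨hx, hxb⟩ := Finset.mem_filter.1 hx
        obtain ⟨g1, g2⟩ := Finset.mem_sigma.1 hx
        have hz := (hf x hx).1
        rw [hxb] at hz
        have heq : x.1 = x₀.1 := by
          by_contra hne'
          obtain ⟨m', hC'⟩ := (h.entry x.1 (hE' g1)).grid
          exact (h.sep x.1 (hE' g1) x₀.1 (hE' h1) hne').disjoint_openDouble hC' hC g2 h2 hz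
            (Square.openDouble_subset_double _ hz₀)
        exact ⟨heq, heq ▸ g2, hz⟩
      have hinj : Set.InjOn Sigma.snd
          (Finset.filter (fun x => f x = b) (E'.sigma fun e => e.comp) :
            Set ((_ : Entry) × Square)) := by
        rintro ⟨x1, x2⟩ hx ⟨y1, y2⟩ hy hxy
        have e1 := (hfst _ hx).1
        have e2 := (hfst _ hy).1
        simp only at e1 e2 hxy
        rw [e1, e2, hxy]
      rw [← Finset.card_image_of_injOn hinj]
      refine Square.card_le_nine _ (fun B hB => ?_) (hC.subset h2) fun B hB => ?_
      · obtain ⟨x, hx, rfl⟩ := Finset.mem_image.1 hB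
        exact hC.subset (hfst x hx).2.1
      · obtain ⟨x, hx, rfl⟩ := Finset.mem_image.1 hB
        exact Square.abs_corner_sub_le_of_openDouble (hC.subset h2)
          (hC.subset (hfst x hx).2.1) hz₀ (hfst x hx).2.2

lemma one_le_numRoots (hF : F ≠ 0) {R : Set ℂ} (h : ∃ z ∈ R, F.IsRoot z) : 1 ≤ numRoots F R := by
  obtain ⟨z, hz, hr⟩ := h
  exact Multiset.card_pos_iff_exists_mem.2 ⟨z, mem_rootsIn.2 ⟨(mem_roots hF).2 hr, hz⟩⟩

lemma IsGridComp.eq_singleton {m : ℕ} {C : Component} (hC : IsGridComp B₀ m C) (h : B₀ ∈ C) :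
    C = {B₀} := by
  have h1 := Square.exp_of_mem (hC.subset h)
  obtain rfl : m = 0 := by lia
  have h2 := hC.subset
  rw [Square.subdivide_zero] at h2
  exact Finset.Nonempty.subset_singleton_iff hC.nonempty |>.1 h2

end Invariant

end CIsolate
-- Deduction of the theorem from the invariant
open CIsolate
theorem mainTheorem6 (F : ℂ[X]) (n : ℕ) (hn : 2 ≤ n) (hdeg : F.natDegree = n)
    (hlead : 1 / 4 < ‖F.leadingCoeff‖) (hlead' : ‖F.leadingCoeff‖ ≤ 1) (B₀ : Square)
    (hsimple : ∀ z ∈ B₀.double, F.IsRoot z → F.rootMultiplicity z = 1) :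
    Terminates F B₀ ∧
    (∀ s, Reachable F B₀ s → IsFinal s → CorrectOutput F B₀ s.output) ∧
    ∀ s, Reachable F B₀ s →
      -- (a)
      (∀ e ∈ s.entries, e.comp.Nonempty ∧
        (∀ B ∈ e.comp, ∀ B' ∈ e.comp, ConnectedIn e.comp B B') ∧
        (∀ B ∈ e.comp, B.exp = e.comp.level ∧ B.toSet ⊆ B₀.toSet ∧
          ∃ p q : ℤ, B.corner = (⟨B₀.corner.re + p * (2 : ℝ) ^ e.comp.level,
            B₀.corner.im + q * (2 : ℝ) ^ e.comp.level⟩ : ℂ)) ∧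
        ∀ B ∈ e.comp, ∀ B' ∈ e.comp, B ≠ B' →
          Disjoint (interior B.toSet) (interior B'.toSet)) ∧
      -- (b)
      (∀ e₁ ∈ s.entries, ∀ e₂ ∈ s.entries, e₁ ≠ e₂ →
        (∀ z₁ ∈ e₁.comp.region, ∀ z₂ ∈ e₂.comp.region,
          max ((2 : ℝ) ^ e₁.comp.level) ((2 : ℝ) ^ e₂.comp.level) ≤
            max |z₁.re - z₂.re| |z₁.im - z₂.im|) ∧
        Disjoint (interior e₁.comp.enlarged) (interior e₂.comp.enlarged)) ∧
      -- (c)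
      (∀ z ∈ B₀.toSet, F.IsRoot z →
        (∃ e ∈ s.entries, z ∈ e.comp.region) ∨ ∃ D ∈ s.output, IsIsolating F D z) ∧
      -- (d)
      (∀ e ∈ s.entries, ∀ B ∈ e.comp, B ≠ B₀ → ∃ z ∈ B.double, F.IsRoot z) ∧
      -- (e)
      (∀ e ∈ s.entries, (∃ z ∈ B₀.double, F.IsRoot z) ∨ e.comp ≠ {B₀} →
        e.comp.card ≤ 9 * numRoots F e.comp.enlarged) ∧
      ((∃ z ∈ B₀.double, F.IsRoot z) ∨ s ≠ initialState B₀ →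
        ∑ e ∈ s.entries, e.comp.card ≤ 9 * numRoots F B₀.double) ∧
      -- (f)
      (∀ e ∈ s.entries,
        e.comp.width ≤ 2 * (ancStar B₀ e).width / √(e.speed : ℝ) ∧
        2 * (ancStar B₀ e).width / √(e.speed : ℝ) ≤ 2 * B₀.width / √(e.speed : ℝ)) ∧
      -- (g)
      (∀ e ∈ s.entries,
        cappedSeparation F B₀ ^ 2 / (2 ^ 17 * (n : ℝ) ^ 2 * B₀.width) ≤ (2 : ℝ) ^ e.comp.level ∧
        (2 : ℝ) ^ e.comp.level ≤ B₀.width ∧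
        4 ≤ e.speed ∧
        (e.speed : ℝ) ≤ (2 ^ 9 * B₀.width / cappedSeparation F B₀) ^ 2) := by
  have hn0 : F.natDegree ≠ 0 := by lia
  have hF : F ≠ 0 := fun h0 => hn0 (by rw [h0, natDegree_zero])
  have hσ := cappedSeparation_pos hF hsimple
  refine ⟨terminates hn0 hσ, fun s hs hfin => correctOutput hn0 hσ hs hfin, fun s hs => ?_⟩
  have h := StateInv.of_reachable hn0 hσ hs
  refine ⟨?_, ?_, h.core.cover, ?_, ?_, ?_, ?_, ?_⟩
  · intro e he
    have hinv := h.core.entry e he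
    obtain ⟨m, hC⟩ := hinv.grid
    refine ⟨hC.nonempty, hinv.conn, fun B hB => ⟨?_, ?_, ?_⟩, fun B hB B' hB' hne => ?_⟩
    · rw [hC.level_eq, Square.exp_of_mem (hC.subset hB)]
    · exact Square.toSet_subset_of_mem (hC.subset hB)
    · obtain ⟨p, q, -, -, rfl⟩ := Square.mem_subdivide.1 (hC.subset hB)
      exact ⟨p, q, by rw [hC.level_eq]; rfl⟩
    · exact Square.disjoint_interior_of_ne (hC.subset hB) (hC.subset hB') hne
  · intro e₁ h₁ e₂ h₂ hne
    have hsep := h.core.sep e₁ h₁ e₂ h₂ hne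
    obtain ⟨m₁, hC₁⟩ := (h.core.entry e₁ h₁).grid
    obtain ⟨m₂, hC₂⟩ := (h.core.entry e₂ h₂).grid
    refine ⟨hsep, Set.disjoint_left.2 fun z hz₁ hz₂ => ?_⟩
    obtain ⟨B₁, hB₁, hzB₁⟩ : ∃ B ∈ e₁.comp, z ∈ B.double := by
      simpa [Component.enlarged] using interior_subset hz₁
    -- Closed doubles may touch, so the common point is first moved into an open double without
    -- leaving the interior of the other enlarged component.
    obtain ⟨w, hw, hwB₁⟩ := Square.exists_mem_openDouble_of_mem_double hzB₁ isOpen_interior hz₂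
    obtain ⟨B₂, hB₂, hwB₂⟩ : ∃ B ∈ e₂.comp, w ∈ B.double := by
      simpa [Component.enlarged] using interior_subset hw
    exact hsep.disjoint_openDouble hC₁ hC₂ hB₁ hB₂ hwB₁ hwB₂
  · intro e he B hB hne
    obtain ⟨z, hz, hr⟩ := (h.core.entry e he).root B hB hne
    exact ⟨z, Square.openDouble_subset_double _ hz, hr⟩
  · intro e he hex
    obtain ⟨m, hC⟩ := (h.core.entry e he).grid
    by_cases hB₀ : B₀ ∈ e.comp
    · have hs := hC.eq_singleton hB₀
      rw [hs]
      have h1 := one_le_numRoots hF (hex.resolve_right fun h => h hs)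
      have h2 : Component.enlarged {B₀} = B₀.double := by simp [Component.enlarged]
      rw [h2, Finset.card_singleton]
      lia
    · have h1 := h.core.sum_card_le hF (E' := {e}) (by simpa using he)
        (R := e.comp.enlarged)
        (fun e' he' B hB hne => hB₀ (by
          rw [Finset.mem_singleton] at he'
          rw [← hne, ← he']; exact hB))
        (fun e' he' B hB z hz => by
          rw [Finset.mem_singleton] at he'
          rw [he'] at hB
          exact Set.mem_biUnion hB (Square.openDouble_subset_double _ hz))
      simpa using h1
  · intro hex
    by_cases hs : s = initialState B₀
    · have h1 := one_le_numRoots hF (hex.resolve_right fun h => h hs)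
      rw [hs]
      simp only [initialState, Finset.sum_singleton, Finset.card_singleton]
      lia
    · refine h.core.sum_card_le hF subset_rfl (h.ne.resolve_left hs) fun e he B hB => ?_
      obtain ⟨m, hC⟩ := (h.core.entry e he).grid
      exact (Square.openDouble_subset_of_mem (hC.subset hB)).trans
        (Square.openDouble_subset_double _)
  · intro e he
    have hinv := h.core.entry e he
    refine ⟨hinv.width_le, ?_⟩
    have := hinv.anc_le
    gcongr
  · intro e he
    have hinv := h.core.entry e he
    obtain ⟨m, hC⟩ := hinv.grid
    refine ⟨le_trans ?_ hinv.level_ge, hC.level_le_width.trans hC.width_le, hinv.speed_ge,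
      hinv.speed_le⟩
    have hw := B₀.width_pos
    have hcap := cappedSeparation_le F B₀
    have hnR : (4 : ℝ) ≤ (n : ℝ) ^ 2 := by
      have : (2 : ℝ) ≤ n := by exact_mod_cast hn
      nlinarith
    -- The invariant gives σ/2^11, and σ ≤ 2^8 w(𝓑) together with n² ≥ 4 turns this into the stated
    -- quadratic bound.
    rw [div_le_div_iff₀ (by positivity) (by positivity)]
    calc cappedSeparation F B₀ ^ 2 * 2 ^ 11
        ≤ cappedSeparation F B₀ * (2 ^ 8 * B₀.width) * 2 ^ 11 := by
          rw [sq]; gcongr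
      _ = cappedSeparation F B₀ * (2 ^ 17 * 4 * B₀.width) := by ring
      _ ≤ cappedSeparation F B₀ * (2 ^ 17 * (n : ℝ) ^ 2 * B₀.width) := by gcongr
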